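/- Let $\Omega\subset\mathbb{R}^n$ be open, connected and $\mathbb{Z}^n$-periodic ($\Omega+\mathbb{Z}^n=\Omega$) with nonempty $C^1$ boundary (so $n\ge 2$). Assume: (A1) $H\in C(\mathbb{R}^n\times\mathbb{R}^n)$ and $y\mapsto H(y,p)$ is $\mathbb{Z}^n$-periodic for every $p$; (A2) $\lim_{|p|\to\infty}\inf_{y\in\mathbb{R}^n}H(y,p)=+\infty$; (A3) $p\mapsto H(y,p)$ is convex for every $y$; (A4) $b$ is bounded and uniformly continuous on $\mathbb{R}^n\times\partial\Omega$, and $b(x,y+z)=b(x,y)$ for all $(x,y)\in\mathbb{R}^n\times\partial\Omega$ and $z\in\mathbb{Z}^n$; (A5) $g:\mathbb{R}^n\to\mathbb{R}$ is bounded and Lipschitz continuous, and $g\le\overline b$ on $\mathbb{R}^n$, where $\overline b(x):=\min_{z\in\partial\Omega}b(x,z)$. For $p\in\mathbb{R}^n$ let $\overline H(p)$ be the effective Hamiltonian, that is, the unique constant $c$ for which the state-constraint cell problem $$H(y,p+Dv(y))\le c\ \text{ in }\Omega,\qquad H(y,p+Dv(y))\ge c\ \text{ on }\overline\Omega$$ has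 a $\mathbb{Z}^n$-periodic viscosity solution $v\in C(\overline\Omega)$, and let $\overline L(v):=\sup_{p\in\mathbb{R}^n}\big(p\cdot v-\overline H(p)\big)\in(-\infty,+\infty]$ be its Legendre transform. Put $f(y,0):=g(y)$ and $f(y,\tau):=\overline b(y)$ for $\tau>0$. Consider the limit problem $$\max\{u-\overline b,\ u_t+\overline H(Du)\}=0\ \text{ in }\mathbb{R}^n\times(0,\infty),\qquad u(\cdot,0)=g\ \text{ on }\mathbb{R}^n .$$ It has exactly one viscosity solution $u$ in the class of continuous functions on $\mathbb{R}^n\times[0,\infty)$ that are bounded on $\mathbb{R}^n\times[0,T]$ for every $T>0$, and for all $x\in\mathbb{R}^n$ this solution satisfies $$u(x,t)=\begin{cases}\displaystyle\inf_{\tau\in[0,t),\ y\in\mathbb{R}^n}\Big\{(t-\tau)\,\overline L\Big(\frac{x-y}{t-\tau}\Big)+f(y,\tau)\Big\}, & t>0,\\[2mm] g(x), & t=0.\end{cases}$$ -/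

import Mathlib

open Set Filter Topology

noncomputable section

namespace PerforatedHJ

/-- The integer vector `k ∈ ℤⁿ`, as a point of Euclidean space. -/
def lattice {n : ℕ} (k : Fin n → ℤ) : EuclideanSpace ℝ (Fin n) :=
  WithLp.toLp 2 (fun i => (k i : ℝ))

/-- Near each of its boundary points, `Ω` is the strict sublevel set of a `C¹` function whose
derivative does not vanish at that point. -/
def HasC1Boundary {n : ℕ} (Ω : Set (EuclideanSpace ℝ (Fin n))) : Prop :=
  ∀ x ∈ frontier Ω, ∃ (U : Set (EuclideanSpace ℝ (Fin n))) (φ : EuclideanSpace ℝ (Fin n) → ℝ),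
    IsOpen U ∧ x ∈ U ∧ ContDiffOn ℝ 1 φ U ∧ fderiv ℝ φ x ≠ 0 ∧ Ω ∩ U = {y ∈ U | φ y < 0}

/-- Perforated domains: open, connected, `ℤⁿ`-periodic, with `C¹` boundary. The boundary is
nonempty, as it carries the Dirichlet data (this forces `n ≥ 2`). -/
structure IsPerforatedDomain {n : ℕ} (Ω : Set (EuclideanSpace ℝ (Fin n))) : Prop where
  isOpen : IsOpen Ω
  isConnected : IsConnected Ω
  periodic : ∀ (k : Fin n → ℤ) (x : EuclideanSpace ℝ (Fin n)), x + lattice k ∈ Ω ↔ x ∈ Ω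
  c1 : HasC1Boundary Ω
  frontier_nonempty : (frontier Ω).Nonempty

/-- `f` is bounded and uniformly continuous on `s`. -/
def IsBUCOn {X : Type*} [UniformSpace X] (f : X → ℝ) (s : Set X) : Prop :=
  (∃ C : ℝ, ∀ x ∈ s, |f x| ≤ C) ∧ UniformContinuousOn f s

/-- `v` is a `ℤⁿ`-periodic viscosity solution, continuous on `closure Ω`, of the state-constraint
cell problem `H(y, p + Dv(y)) ≤ c` in `Ω`, `H(y, p + Dv(y)) ≥ c` on `closure Ω`. -/
structure IsCellSolution {n : ℕ} (Ω : Set (EuclideanSpace ℝ (Fin n)))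
    (H : EuclideanSpace ℝ (Fin n) → EuclideanSpace ℝ (Fin n) → ℝ)
    (p : EuclideanSpace ℝ (Fin n)) (c : ℝ) (v : EuclideanSpace ℝ (Fin n) → ℝ) : Prop where
  continuousOn : ContinuousOn v (closure Ω)
  periodic : ∀ (k : Fin n → ℤ), ∀ y ∈ closure Ω, v (y + lattice k) = v y
  subsolution : ∀ φ : EuclideanSpace ℝ (Fin n) → ℝ, ContDiff ℝ 1 φ → ∀ y ∈ Ω,
    IsLocalMax (fun z => v z - φ z) y → H y (p + gradient φ y) ≤ c
  supersolution : ∀ φ : EuclideanSpace ℝ (Fin n) → ℝ, ContDiff ℝ 1 φ → ∀ y ∈ closure Ω,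
    IsLocalMinOn (fun z => v z - φ z) (closure Ω) y → c ≤ H y (p + gradient φ y)

/-- The effective Hamiltonian `H̄(p)`: the constant `c` for which the state-constraint cell problem
has a periodic viscosity solution. -/
def effectiveHamiltonian {n : ℕ} (Ω : Set (EuclideanSpace ℝ (Fin n)))
    (H : EuclideanSpace ℝ (Fin n) → EuclideanSpace ℝ (Fin n) → ℝ)
    (p : EuclideanSpace ℝ (Fin n)) : ℝ :=
  Classical.epsilon (fun c : ℝ => ∃ v, IsCellSolution Ω H p c v)

/-- The Legendre transform `v ↦ sup_p (p · v - F(p))`, with values in the extended reals. -/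
def legendre {n : ℕ} (F : EuclideanSpace ℝ (Fin n) → ℝ) (v : EuclideanSpace ℝ (Fin n)) : EReal :=
  ⨆ p : EuclideanSpace ℝ (Fin n), ((inner ℝ p v - F p : ℝ) : EReal)

/-- The effective boundary datum `b̄(x) = min_{z ∈ ∂Ω} b(x, z)`. -/
def effectiveDatum {n : ℕ} (Ω : Set (EuclideanSpace ℝ (Fin n)))
    (b : EuclideanSpace ℝ (Fin n) → EuclideanSpace ℝ (Fin n) → ℝ)
    (x : EuclideanSpace ℝ (Fin n)) : ℝ :=
  sInf (b x '' frontier Ω)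

/-- The terminal cost `f(x, t)`: `g(x)` at time `0` and `b̄(x)` at positive times. -/
def terminalCost {n : ℕ} (g bbar : EuclideanSpace ℝ (Fin n) → ℝ)
    (x : EuclideanSpace ℝ (Fin n)) (t : ℝ) : ℝ :=
  if t = 0 then g x else bbar x

/-- `u` is a viscosity solution of `max {u - B, u_t + F(Du)} = 0` in `ℝⁿ × (0, ∞)` with
`u(·, 0) = g`, in the class of continuous functions on `ℝⁿ × [0, ∞)` that are bounded on
`ℝⁿ × [0, T]` for every `T`. -/
structure IsLimitSolution {n : ℕ} (F B g : EuclideanSpace ℝ (Fin n) → ℝ)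
    (u : EuclideanSpace ℝ (Fin n) → ℝ → ℝ) : Prop where
  continuousOn : ContinuousOn (Function.uncurry u) (univ ×ˢ Ici 0)
  bounded : ∀ T : ℝ, ∃ C : ℝ, ∀ x, ∀ t ∈ Icc 0 T, |u x t| ≤ C
  initial : ∀ x, u x 0 = g x
  subsolution : ∀ φ : EuclideanSpace ℝ (Fin n) → ℝ → ℝ,
    ContDiffOn ℝ 1 (Function.uncurry φ) (univ ×ˢ Ioi 0) → ∀ x t, 0 < t →
    IsLocalMax (fun z : EuclideanSpace ℝ (Fin n) × ℝ => u z.1 z.2 - φ z.1 z.2) (x, t) →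
    max (u x t - B x)
      (deriv (fun s => φ x s) t + F (gradient (fun y => φ y t) x)) ≤ 0
  supersolution : ∀ φ : EuclideanSpace ℝ (Fin n) → ℝ → ℝ,
    ContDiffOn ℝ 1 (Function.uncurry φ) (univ ×ˢ Ioi 0) → ∀ x t, 0 < t →
    IsLocalMin (fun z : EuclideanSpace ℝ (Fin n) × ℝ => u z.1 z.2 - φ z.1 z.2) (x, t) →
    0 ≤ max (u x t - B x)
      (deriv (fun s => φ x s) t + F (gradient (fun y => φ y t) x))

end PerforatedHJ

end

open PerforatedHJ

/-! Write F for the effective Hamiltonian, B for the effective datum, L for the Legendre transform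
of F and V for `value`. The analysis of the limit problem needs only that F is finite, convex and
coercive, and this is extracted from the cell problem.

Cell problem. Let c be the infimum of the levels at which a subsolution of slope p exists. For each
z there is a maximal subsolution at level c normalized at z (`exists_maximal_sub`). If none of these
were a state-constraint supersolution, every z would have a subsolution strict near z
(`super_or_exists_strict`). By compactness of the periodicity cell, finitely many of them could be
averaged into one that is strict everywhere, contradicting the choice of c (`exists_cellSolution`).
The comparison `level_le_of_super` bounds the level of a corrector by that of any subsolution of the
same slope. Averaging correctors then gives convexity of F. Coercivity holds because subsolutions at
a bounded level are uniformly Lipschitz, while their increments over lattice vectors reveal p.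

Limit problem. By convexity, the inequality φ_t + F(Dφ) ≤ 0 amounts to the linear inequalities φ_t +
v·Dφ ≤ ℓ for all ℓ ≥ L(v). Jensen's inequality gives dynamic programming for V, hence V is Lipschitz
and solves the problem (`IsLimitData.isLimitSolution_value`). If u is any solution, integrating the
linear inequalities along straight lines gives u ≤ V (`IsLimitSolution.le_value`). Conversely,
linear inequalities survive mollification, so V is a uniform limit of smooth subsolutions. Slightly
perturbed, these are test functions touching u from below, and V ≤ u follows
(`IsLimitSolution.value_le`). The formula is then the definition of V rewritten in the extended
reals (`IsLimitData.value_eq_iInf`). -/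

namespace PerforatedHJ

/-! ### Viscosity subsolutions of linear transport inequalities. -/

section Transport

variable {F : Type*} [NormedAddCommGroup F] [NormedSpace ℝ F] [FiniteDimensional ℝ F]

/-- A viscosity subsolution of the linear equation `Dw · ξ ≤ a` on an open set grows at most at
rate `a` along segments in the direction `ξ`. -/
lemma le_add_of_viscosity_of_ne {U : Set F} (hU : IsOpen U) {w : F → ℝ} (hw : ContinuousOn w U)
    {ξ : F} (hξ : ξ ≠ 0) {a : ℝ}
    (hv : ∀ φ : F → ℝ, ContDiff ℝ 1 φ → ∀ y ∈ U, IsLocalMax (fun z => w z - φ z) y →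
      fderiv ℝ φ y ξ ≤ a)
    {x : F} {s : ℝ} (hs : 0 < s) (hseg : ∀ σ ∈ Icc 0 s, x + σ • ξ ∈ U) :
    w (x + s • ξ) ≤ w x + s * a := by
  by_contra! hlt
  have : ProperSpace F := FiniteDimensional.proper ℝ F
  obtain ⟨κ, hκ, hκw⟩ : ∃ κ > 0, w x + s * a + 3 * κ = w (x + s • ξ) :=
    ⟨(w (x + s • ξ) - (w x + s * a)) / 3, by linarith, by ring⟩
  -- Since `l ξ = 1`, `l` measures progress along `ξ`. The map `P` below is the transverse part,
  -- read in Euclidean coordinates so that its squared norm is differentiable.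
  obtain ⟨l, hl⟩ := SeparatingDual.exists_eq_one (R := ℝ) hξ
  let T := toEuclidean (E := F)
  have hTsymm : ∀ z, ‖z‖ ≤ ‖T.symm.toContinuousLinearMap‖ * ‖T z‖ := fun z => by
    simpa using T.symm.toContinuousLinearMap.le_opNorm (T z)
  set Cn := ‖T.symm.toContinuousLinearMap‖ with hCn
  have hCn0 : 0 ≤ Cn := norm_nonneg _
  have hcseg : IsCompact ((fun σ : ℝ => x + σ • ξ) '' Icc 0 s) :=
    isCompact_Icc.image (by fun_prop)
  obtain ⟨ε, hε, hεU⟩ := hcseg.exists_cthickening_subset_open hU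
    (by rintro _ ⟨σ, hσ, rfl⟩; exact hseg σ hσ)
  have hxU : x ∈ U := by simpa using hseg 0 ⟨le_rfl, hs.le⟩
  obtain ⟨ρ₀, hρ₀, hρw⟩ : ∃ ρ₀ > 0, ∀ y, dist y x < ρ₀ → w y < w x + κ := by
    have : ∀ᶠ y in 𝓝 x, w y < w x + κ :=
      (hw.continuousAt (hU.mem_nhds hxU)).eventually_lt continuousAt_const (by linarith)
    exact Metric.eventually_nhds_iff.1 this
  obtain ⟨ρ, hρ, hρε, hρρ⟩ : ∃ ρ > 0, Cn * ρ ≤ ε / 2 ∧ Cn * ρ < ρ₀ := by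
    have hm : 0 < min (ε / 2) ρ₀ := lt_min (by linarith) hρ₀
    have h1 : 0 < min (ε / 2) ρ₀ / (Cn + 1) := by positivity
    have h2 : Cn * (min (ε / 2) ρ₀ / (Cn + 1)) < min (ε / 2) ρ₀ := by
      rw [mul_div_assoc', div_lt_iff₀ (by positivity)]; nlinarith
    exact ⟨_, h1, h2.le.trans (min_le_left _ _), h2.trans_le (min_le_right _ _)⟩
  obtain ⟨τ, hτ, hτε⟩ : ∃ τ > 0, τ * ‖ξ‖ ≤ ε / 2 := by
    have := norm_pos_iff.2 hξ
    exact ⟨ε / 2 / ‖ξ‖, by positivity, by field_simp; rfl⟩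
  let P : F → EuclideanSpace ℝ (Fin (Module.finrank ℝ F)) := fun y => T (y - x - l (y - x) • ξ)
  have hPc : ContDiff ℝ 1 P := by fun_prop
  have hdec : ∀ y, y - (x + l (y - x) • ξ) = T.symm (P y) := fun y => by simp [P]; abel
  let K : Set F := {y | 0 ≤ l (y - x) ∧ l (y - x) ≤ s + τ ∧ ‖P y‖ ≤ ρ}
  have hPn : ∀ y, ‖P y‖ ≤ ρ → ‖T.symm (P y)‖ ≤ Cn * ρ := fun y hy => by
    have := hTsymm (T.symm (P y))
    rw [T.apply_symm_apply] at this
    exact this.trans (by gcongr)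
  have hKsub : K ⊆ Metric.cthickening ε ((fun σ : ℝ => x + σ • ξ) '' Icc 0 s) := by
    rintro y ⟨h0, h1, h2⟩
    refine Metric.mem_cthickening_of_dist_le y (x + min (l (y - x)) s • ξ) ε _
      ⟨_, ⟨le_min h0 hs.le, min_le_right _ _⟩, rfl⟩ ?_
    have e : y - (x + min (l (y - x)) s • ξ) =
        T.symm (P y) + (l (y - x) - min (l (y - x)) s) • ξ := by
      rw [← hdec, sub_smul]; abel
    have h3 : |l (y - x) - min (l (y - x)) s| ≤ τ := by
      rw [abs_le]; constructor <;> rcases min_cases (l (y - x)) s with h | h <;> linarith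
    rw [dist_eq_norm, e]
    calc _ ≤ ‖T.symm (P y)‖ + ‖(l (y - x) - min (l (y - x)) s) • ξ‖ := norm_add_le _ _
      _ ≤ ε / 2 + τ * ‖ξ‖ := by
          rw [norm_smul, Real.norm_eq_abs]
          gcongr
          exact (hPn y h2).trans hρε
      _ ≤ ε := by linarith
  have hKU : K ⊆ U := hKsub.trans hεU
  have hlc : Continuous fun y => l (y - x) := by fun_prop
  have hKclosed : IsClosed K :=
    (isClosed_le continuous_const hlc).inter
      ((isClosed_le hlc continuous_const).inter
        (isClosed_le hPc.continuous.norm continuous_const))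
  have hK : IsCompact K := hcseg.cthickening.of_isClosed_subset hKclosed hKsub
  obtain ⟨C, hC⟩ := hK.exists_bound_of_continuousOn (hw.mono hKU)
  have hlline : ∀ y (σ : ℝ), l (y + σ • ξ - x) = l (y - x) + σ := fun y σ => by
    rw [add_sub_right_comm, map_add, map_smul, hl, smul_eq_mul, mul_one]
  have hPline : ∀ y (σ : ℝ), P (y + σ • ξ) = P y := fun y σ => by
    simp only [P, hlline]
    congr 1
    rw [add_smul]; abel
  have hPx : P x = 0 := by simp [P]
  -- `A` dominates the variation of `w` and of the linear term on `K`. The weights `N` and `B` make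
  -- the penalty at least `A` on the lateral face `‖P y‖ = ρ` and on the top face; `hρw` excludes
  -- the bottom face. The maximum is therefore interior, where the exponential gives `φ` a slope
  -- along `ξ` strictly larger than `a`.
  set A : ℝ := |C| + |w x| + |a| * (s + τ) + 1 with hA
  have hA0 : 0 < A := by positivity
  set N := A / ρ ^ 2 with hN
  set B := A / (κ * τ) with hB
  have hN0 : 0 < N := by positivity
  have hB0 : 0 < B := by positivity
  let φ : F → ℝ := fun y =>
    a * l (y - x) + κ * Real.exp (B * (l (y - x) - s)) + N * ‖P y‖ ^ 2
  have hφ : ContDiff ℝ 1 φ := by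
    have h1 : ContDiff ℝ 1 (fun y => ‖P y‖ ^ 2) := hPc.norm_sq ℝ
    have h2 : ContDiff ℝ 1 (fun y => l (y - x)) := by fun_prop
    exact ((contDiff_const.mul h2).add (contDiff_const.mul
      (Real.contDiff_exp.comp (contDiff_const.mul (h2.sub contDiff_const))))).add
      (contDiff_const.mul h1)
  have hmem : x + s • ξ ∈ K := by
    refine ⟨?_, ?_, ?_⟩
    · rw [hlline]; simp [hs.le]
    · rw [hlline]; simp [hτ.le]
    · rw [hPline, hPx]; simp [hρ.le]
  obtain ⟨y, hyK, hymax⟩ := hK.exists_isMaxOn ⟨_, hmem⟩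
    ((hw.mono hKU).sub hφ.continuous.continuousOn)
  have hval : w x + 2 * κ ≤ w y - φ y := by
    have h1 : w (x + s • ξ) - φ (x + s • ξ) ≤ w y - φ y := hymax hmem
    have : φ (x + s • ξ) = a * s + κ := by simp only [φ, hlline, hPline, hPx]; simp
    linarith
  have hwy : w y ≤ |C| := (le_abs_self _).trans ((hC y hyK).trans (le_abs_self _))
  have hal : -(|a| * (s + τ)) ≤ a * l (y - x) := by
    have h1 : |a * l (y - x)| ≤ |a| * (s + τ) := by
      rw [abs_mul, abs_of_nonneg hyK.1]
      exact mul_le_mul_of_nonneg_left hyK.2.1 (abs_nonneg _)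
    linarith [neg_abs_le (a * l (y - x))]
  have hexp : 0 < κ * Real.exp (B * (l (y - x) - s)) := by positivity
  have hNP : 0 ≤ N * ‖P y‖ ^ 2 := by positivity
  have hφy : φ y = a * l (y - x) + κ * Real.exp (B * (l (y - x) - s)) + N * ‖P y‖ ^ 2 := rfl
  have hwx := neg_abs_le (w x)
  have h0 : 0 < l (y - x) := by
    refine lt_of_le_of_ne hyK.1 fun h => ?_
    have h1 : w y < w x + κ := by
      refine hρw y ?_
      have := hdec y
      rw [← h, zero_smul, add_zero] at this
      rw [dist_eq_norm, this]
      exact (hPn y hyK.2.2).trans_lt hρρ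
    rw [← h, mul_zero] at hφy
    rw [← h] at hexp
    linarith
  have h1 : l (y - x) < s + τ := by
    refine lt_of_le_of_ne hyK.2.1 fun h => ?_
    have : A ≤ κ * Real.exp (B * (l (y - x) - s)) := by
      have h2 := Real.add_one_le_exp (B * (l (y - x) - s))
      have h3 : κ * (B * (l (y - x) - s)) = A := by rw [h, hB]; field_simp; ring
      nlinarith
    linarith
  have h2 : ‖P y‖ < ρ := by
    refine lt_of_le_of_ne hyK.2.2 fun h => ?_
    have : N * ‖P y‖ ^ 2 = A := by rw [h, hN]; field_simp
    linarith
  have hnhds : K ∈ 𝓝 y := by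
    have ho : IsOpen {y | 0 < l (y - x) ∧ l (y - x) < s + τ ∧ ‖P y‖ < ρ} :=
      (isOpen_lt continuous_const hlc).inter
        ((isOpen_lt hlc continuous_const).inter
          (isOpen_lt hPc.continuous.norm continuous_const))
    exact mem_of_superset (ho.mem_nhds ⟨h0, h1, h2⟩) fun z hz => ⟨hz.1.le, hz.2.1.le, hz.2.2.le⟩
  have hd := hv φ hφ y (hKU hyK) (hymax.isLocalMax hnhds)
  have hd1 : HasDerivAt (fun σ : ℝ => φ (y + σ • ξ)) (fderiv ℝ φ y ξ) 0 := by
    have hline : HasDerivAt (fun σ : ℝ => y + σ • ξ) ξ 0 := by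
      simpa using ((hasDerivAt_id (0 : ℝ)).smul_const ξ).const_add y
    have hfd : HasFDerivAt φ (fderiv ℝ φ y) (y + (0 : ℝ) • ξ) := by
      simpa using ((hφ.differentiable one_ne_zero) y).hasFDerivAt
    exact hfd.comp_hasDerivAt 0 hline
  have hd2 : HasDerivAt (fun σ : ℝ => φ (y + σ • ξ))
      (a + κ * (Real.exp (B * (l (y - x) - s)) * B)) 0 := by
    have e : (fun σ : ℝ => φ (y + σ • ξ)) = fun σ =>
        a * (l (y - x) + σ) + κ * Real.exp (B * (l (y - x) + σ - s)) + N * ‖P y‖ ^ 2 := by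
      funext σ; simp only [φ, hlline, hPline]
    rw [e]
    have i1 : HasDerivAt (fun σ : ℝ => l (y - x) + σ) 1 0 := (hasDerivAt_id _).const_add _
    have i2 := (((i1.sub_const s).const_mul B).exp.const_mul κ)
    simpa using ((i1.const_mul a).add i2).add_const (N * ‖P y‖ ^ 2)
  rw [hd1.unique hd2] at hd
  have : 0 < κ * (Real.exp (B * (l (y - x) - s)) * B) := by positivity
  linarith

/-- Every function continuous on a nonempty open set is touched from above by a `C¹` function
somewhere in that set. -/
lemma exists_isLocalMax_sub [Nontrivial F] {U : Set F} (hU : IsOpen U) (hne : U.Nonempty)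
    {w : F → ℝ} (hw : ContinuousOn w U) :
    ∃ φ : F → ℝ, ContDiff ℝ 1 φ ∧ ∃ y ∈ U, IsLocalMax (fun z => w z - φ z) y := by
  by_contra! h
  obtain ⟨x, hx⟩ := hne
  obtain ⟨ξ, hξ⟩ := exists_ne (0 : F)
  have hc : ContinuousAt (fun σ : ℝ => x + σ • ξ) 0 := by fun_prop
  have hn : ∀ᶠ σ : ℝ in 𝓝 0, x + σ • ξ ∈ U := hc.eventually_mem (by simpa using hU.mem_nhds hx)
  obtain ⟨r, hr, hrU⟩ := Metric.eventually_nhds_iff.1 hn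
  -- If nothing touches `w` from above, the viscosity hypothesis is vacuous for every rate `a`, so
  -- `w` would have to decrease arbitrarily fast.
  have key : ∀ a : ℝ, w (x + (r / 2) • ξ) ≤ w x + r / 2 * a := fun a =>
    le_add_of_viscosity_of_ne hU hw hξ (fun φ hφ y hy hm => absurd hm (h φ hφ y hy))
      (by linarith) fun σ hσ => hrU (by
        rw [Real.dist_eq, sub_zero, abs_of_nonneg hσ.1]; linarith [hσ.2])
  have := key ((w (x + (r / 2) • ξ) - w x - 1) / (r / 2))
  rw [mul_div_cancel₀ _ (by positivity)] at this
  linarith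

/-- Includes the direction `ξ = 0`, where the content is `0 ≤ a`; it comes from the existence of
some touching point. -/
lemma le_add_of_viscosity [Nontrivial F] {U : Set F} (hU : IsOpen U) {w : F → ℝ}
    (hw : ContinuousOn w U) {ξ : F} {a : ℝ}
    (hv : ∀ φ : F → ℝ, ContDiff ℝ 1 φ → ∀ y ∈ U, IsLocalMax (fun z => w z - φ z) y →
      fderiv ℝ φ y ξ ≤ a)
    {x : F} {s : ℝ} (hs : 0 ≤ s) (hseg : ∀ σ ∈ Icc 0 s, x + σ • ξ ∈ U) :
    w (x + s • ξ) ≤ w x + s * a := by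
  rcases hs.eq_or_lt with rfl | hs
  · simp
  by_cases hξ : ξ = 0
  · subst hξ
    obtain ⟨φ, hφ, y, hy, hm⟩ := exists_isLocalMax_sub hU ⟨_, hseg 0 ⟨le_rfl, hs.le⟩⟩ hw
    have := hv φ hφ y hy hm
    rw [map_zero] at this
    simpa using mul_nonneg hs.le this
  · exact le_add_of_viscosity_of_ne hU hw hξ hv hs hseg

end Transport

/-! ### Finite convex functions. -/

section Convex

variable {E : Type*} [NormedAddCommGroup E] [InnerProductSpace ℝ E] [FiniteDimensional ℝ E]

lemma _root_.ConvexOn.continuous_of_univ {F : E → ℝ} (hF : ConvexOn ℝ univ F) : Continuous F :=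
  continuousOn_univ.1 (hF.continuousOn isOpen_univ)

/-- Approximate subgradients of a finite convex function. -/
lemma exists_approx_subgradient {F : E → ℝ} (hF : ConvexOn ℝ univ F) (p : E) {δ : ℝ}
    (hδ : 0 < δ) : ∃ v : E, ∀ q, F p - δ + inner ℝ v (q - p) ≤ F q := by
  have : CompleteSpace E := FiniteDimensional.complete ℝ E
  obtain ⟨l, c, h1, h2⟩ := ConvexOn.exists_affine_le_of_lt (𝕜 := ℝ) (mem_univ p)
    (show F p - δ < F p by linarith) isClosed_univ
    (hF.continuous_of_univ.lowerSemicontinuous.lowerSemicontinuousOn _) hF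
  refine ⟨(InnerProductSpace.toDual ℝ E).symm l, fun q => ?_⟩
  have h3 := h1 ⟨q, mem_univ q⟩
  simp only [RCLike.re_to_real, Pi.add_apply, domRestrict_apply, Function.comp_apply, Function.const_apply] at h3 h2
  rw [InnerProductSpace.toDual_symm_apply, map_sub]
  linarith

/-- A convex function with bounded sublevel sets grows at least linearly. -/
lemma exists_linear_growth {F : E → ℝ} (hF : ConvexOn ℝ univ F)
    (hco : ∀ M : ℝ, ∃ R : ℝ, ∀ p, F p ≤ M → ‖p‖ ≤ R) :
    ∃ a > 0, ∃ C ≥ 0, ∀ p, a * ‖p‖ - C ≤ F p := by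
  obtain ⟨R₀, hR₀⟩ := hco (F 0 + 1)
  set R := |R₀| + 1 with hR
  have hR1 : 0 < R := by positivity
  obtain ⟨C, hC⟩ := (isCompact_closedBall (0 : E) R).exists_bound_of_continuousOn
    hF.continuous_of_univ.continuousOn
  refine ⟨R⁻¹, by positivity, |C| + |F 0| + 1, by positivity, fun p => ?_⟩
  rcases le_or_gt ‖p‖ R with hp | hp
  · have h1 := hC p (by simpa using hp)
    rw [Real.norm_eq_abs] at h1
    have h2 : R⁻¹ * ‖p‖ ≤ 1 := by rw [inv_mul_le_iff₀ hR1]; linarith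
    linarith [neg_abs_le (F p), le_abs_self C, abs_nonneg (F 0)]
  · have hp0 : 0 < ‖p‖ := hR1.trans hp
    -- The point `θ • p` has norm `R`, hence lies outside the sublevel set `F ≤ F 0 + 1`; convexity
    -- along the segment from `0` to `p` multiplies this unit gain by `θ⁻¹`.
    set θ := R / ‖p‖ with hθ
    have hθ0 : 0 < θ := by positivity
    have hθ1 : θ ≤ 1 := by rw [hθ, div_le_one hp0]; exact hp.le
    have h1 := hF.2 (mem_univ (0 : E)) (mem_univ p) (sub_nonneg.2 hθ1) hθ0.le (by ring)
    have h2 : F 0 + 1 < F (θ • p) := by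
      by_contra! hle
      have := hR₀ _ hle
      rw [norm_smul, Real.norm_eq_abs, abs_of_pos hθ0, hθ, div_mul_cancel₀ _ hp0.ne'] at this
      linarith [le_abs_self R₀]
    simp only [smul_zero, zero_add, smul_eq_mul] at h1
    have h3 : 1 ≤ θ * (F p - F 0) := by linarith
    have h4 : R⁻¹ * ‖p‖ ≤ F p - F 0 := by
      have : R⁻¹ * ‖p‖ = θ⁻¹ := by rw [hθ]; field_simp
      rw [this]
      calc θ⁻¹ = θ⁻¹ * 1 := by ring
        _ ≤ θ⁻¹ * (θ * (F p - F 0)) := by gcongr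
        _ = _ := by field_simp
    linarith [neg_abs_le (F 0), abs_nonneg C]

end Convex

/-- If `w` is touched from above by `φ` at `y` and `w` grows at rate at most `b` on short segments
ending at `y` in the direction `ξ`, then so does `φ` infinitesimally. -/
lemma fderiv_le_of_isLocalMax {F : Type*} [NormedAddCommGroup F] [NormedSpace ℝ F]
    {w φ : F → ℝ} {y ξ : F} {b : ℝ} (hφ : DifferentiableAt ℝ φ y)
    (hm : IsLocalMax (fun z => w z - φ z) y)
    (hw : ∀ᶠ s : ℝ in 𝓝[>] 0, w y ≤ w (y - s • ξ) + s * b) : fderiv ℝ φ y ξ ≤ b := by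
  have hline : HasDerivAt (fun s : ℝ => y - s • ξ) (-ξ) 0 := by
    simpa using ((hasDerivAt_id (0 : ℝ)).smul_const ξ).const_sub y
  have hfd : HasFDerivAt φ (fderiv ℝ φ y) (y - (0 : ℝ) • ξ) := by simpa using hφ.hasFDerivAt
  have hd : HasDerivAt (fun s : ℝ => φ (y - s • ξ)) (fderiv ℝ φ y (-ξ)) 0 :=
    hfd.comp_hasDerivAt 0 hline
  have ht := hd.tendsto_slope_zero_right
  have hev : ∀ᶠ s : ℝ in 𝓝 0, w (y - s • ξ) - φ (y - s • ξ) ≤ w y - φ y := by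
    have : Tendsto (fun s : ℝ => y - s • ξ) (𝓝 0) (𝓝 y) := by
      simpa using hline.continuousAt.tendsto
    exact this.eventually hm
  have : -b ≤ fderiv ℝ φ y (-ξ) := by
    refine ge_of_tendsto ht ?_
    filter_upwards [hw, hev.filter_mono nhdsWithin_le_nhds, self_mem_nhdsWithin] with s h1 h2 hs
    have hs0 : (0 : ℝ) < s := hs
    simp only [zero_add, zero_smul, sub_zero, smul_eq_mul]
    rw [le_inv_mul_iff₀ hs0]
    linarith
  rw [map_neg] at this
  linarith

/-! ### Subsolutions of a convex Hamiltonian and their linear inequalities. -/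

section

variable {n : ℕ}

local notation "𝔼" => EuclideanSpace ℝ (Fin n)

/-- Standing assumptions on the Hamiltonian, with coercivity as uniform boundedness of sublevel
sets. -/
structure IsCellHamiltonian (H : 𝔼 → 𝔼 → ℝ) : Prop where
  cont : Continuous (Function.uncurry H)
  per : ∀ (k : Fin n → ℤ) (y p : 𝔼), H (y + lattice k) p = H y p
  coer : ∀ c : ℝ, ∃ R : ℝ, ∀ y q, H y q ≤ c → ‖q‖ ≤ R
  conv : ∀ y, ConvexOn ℝ univ (H y)

/-- `w` is a viscosity subsolution of `H(y, Dw) ≤ c` on `U`. -/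
def ViscSubOn (H : 𝔼 → 𝔼 → ℝ) (c : ℝ) (U : Set 𝔼) (w : 𝔼 → ℝ) : Prop :=
  ∀ φ : 𝔼 → ℝ, ContDiff ℝ 1 φ → ∀ y ∈ U, IsLocalMax (fun z => w z - φ z) y →
    H y (gradient φ y) ≤ c

/-- `w` is continuous on `closure Ω` and a viscosity subsolution of `H(y, Dw) ≤ c` in `Ω`. -/
structure IsSub (Ω : Set 𝔼) (H : 𝔼 → 𝔼 → ℝ) (c : ℝ) (w : 𝔼 → ℝ) : Prop where
  continuousOn : ContinuousOn w (closure Ω)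
  visc : ViscSubOn H c Ω w

/-- `w - ⟨p, ·⟩` is `ℤⁿ`-periodic on `closure Ω`. -/
def QuasiPeriodic (Ω : Set 𝔼) (p : 𝔼) (w : 𝔼 → ℝ) : Prop :=
  ∀ (k : Fin n → ℤ), ∀ y ∈ closure Ω, w (y + lattice k) = w y + inner ℝ p (lattice k)

/-- `w` is `R`-Lipschitz along segments contained in `Ω`. -/
def SegLipschitz (Ω : Set 𝔼) (R : ℝ) (w : 𝔼 → ℝ) : Prop :=
  ∀ x y, segment ℝ x y ⊆ Ω → w y - w x ≤ R * ‖y - x‖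

lemma ViscSubOn.mono {H : 𝔼 → 𝔼 → ℝ} {c c' : ℝ} {U U' : Set 𝔼} {w : 𝔼 → ℝ}
    (h : ViscSubOn H c U w) (hc : c ≤ c') (hU : U' ⊆ U) : ViscSubOn H c' U' w :=
  fun φ hφ y hy hm => (h φ hφ y (hU hy) hm).trans hc

lemma IsSub.mono {Ω : Set 𝔼} {H : 𝔼 → 𝔼 → ℝ} {c c' : ℝ} {w : 𝔼 → ℝ}
    (h : IsSub Ω H c w) (hc : c ≤ c') : IsSub Ω H c' w :=
  ⟨h.continuousOn, h.visc.mono hc subset_rfl⟩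

/-- Joint local uniform continuity of the Hamiltonian, uniformly for momenta in a ball. -/
lemma IsCellHamiltonian.exists_close {H : 𝔼 → 𝔼 → ℝ} (hH : IsCellHamiltonian H) (y₀ : 𝔼) (R : ℝ)
    {δ : ℝ} (hδ : 0 < δ) :
    ∃ r > 0, ∀ x y e q : 𝔼, dist x y₀ < r → dist y y₀ < r → ‖e‖ < r → ‖q‖ ≤ R →
      H y (q + e) ≤ H x q + δ := by
  have h := (isCompact_closedBall (0 : 𝔼) R).eventually_forall_of_forall_eventually
    (x₀ := ((y₀, y₀), (0 : 𝔼)))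
    (P := fun (z : (𝔼 × 𝔼) × 𝔼) q => H z.1.2 (q + z.2) < H z.1.1 q + δ) ?_
  · obtain ⟨r, hr, hr'⟩ := Metric.eventually_nhds_iff.1 h
    refine ⟨r, hr, fun x y e q hx hy he hq => ?_⟩
    refine (@hr' ((x, y), e) ?_ q (by simpa using hq)).le
    simp only [Prod.dist_eq, dist_zero_right]
    exact max_lt (max_lt hx hy) he
  · intro q _
    have h1 : Continuous fun z : ((𝔼 × 𝔼) × 𝔼) × 𝔼 => H z.1.1.2 (z.2 + z.1.2) :=
      hH.cont.comp (f := fun z : ((𝔼 × 𝔼) × 𝔼) × 𝔼 => (z.1.1.2, z.2 + z.1.2)) (by fun_prop)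
    have h2 : Continuous fun z : ((𝔼 × 𝔼) × 𝔼) × 𝔼 => H z.1.1.1 z.2 + δ :=
      (hH.cont.comp (f := fun z : ((𝔼 × 𝔼) × 𝔼) × 𝔼 => (z.1.1.1, z.2)) (by fun_prop)).add
        continuous_const
    exact h1.continuousAt.eventually_lt h2.continuousAt (by simpa using hδ)

/-- Near a point, viscosity subsolutions satisfy the linear inequalities given by affine minorants
of the frozen Hamiltonian, with a radius independent of the subsolution. -/
lemma IsCellHamiltonian.exists_linear_bound [Nontrivial 𝔼] {H : 𝔼 → 𝔼 → ℝ}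
    (hH : IsCellHamiltonian H) {U : Set 𝔼} (hU : IsOpen U) {y₀ : 𝔼} (hy₀ : y₀ ∈ U) (c : ℝ) {δ : ℝ}
    (hδ : 0 < δ) :
    ∃ r > 0, Metric.ball y₀ r ⊆ U ∧ ∀ w, ContinuousOn w U → ViscSubOn H c U w →
      ∀ ξ a, (∀ q, inner ℝ ξ q - a ≤ H y₀ q) → ∀ x s, 0 ≤ s → x ∈ Metric.ball y₀ r →
        x + s • ξ ∈ Metric.ball y₀ r → w (x + s • ξ) ≤ w x + s * (a + c + δ) := by
  obtain ⟨R, hR⟩ := hH.coer c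
  obtain ⟨r₁, hr₁, h₁⟩ := hH.exists_close y₀ R hδ
  obtain ⟨r₂, hr₂, h₂⟩ := Metric.isOpen_iff.1 hU y₀ hy₀
  refine ⟨min r₁ r₂, lt_min hr₁ hr₂,
    (Metric.ball_subset_ball (min_le_right _ _)).trans h₂, ?_⟩
  intro w hwc hw ξ a ha x s hs hx hx'
  have hsub : Metric.ball y₀ (min r₁ r₂) ⊆ U :=
    (Metric.ball_subset_ball (min_le_right _ _)).trans h₂
  refine le_add_of_viscosity Metric.isOpen_ball (hwc.mono hsub) ?_ hs ?_
  · intro φ hφ y hy hm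
    have h3 := hw φ hφ y (hsub hy) hm
    have h4 := h₁ y y₀ 0 (gradient φ y) ((Metric.mem_ball.1 hy).trans_le (min_le_left _ _))
      (by simpa using hr₁) (by simpa using hr₁) (hR _ _ h3)
    rw [add_zero] at h4
    have h5 := ha (gradient φ y)
    rw [real_inner_comm, inner_gradient_left] at h5
    linarith
  · intro σ hσ
    rcases hs.eq_or_lt with rfl | hs
    · have : σ = 0 := le_antisymm hσ.2 hσ.1
      simpa [this] using hx
    · have := (convex_ball y₀ (min r₁ r₂)).add_smul_sub_mem hx hx'
        (t := σ / s) ⟨by have := hσ.1; positivity, by rw [div_le_one hs]; exact hσ.2⟩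
      rwa [add_sub_cancel_left, smul_smul, div_mul_cancel₀ _ hs.ne'] at this

/-- To check the subsolution inequality it suffices to check linear inequalities. -/
lemma IsCellHamiltonian.le_of_linear {H : 𝔼 → 𝔼 → ℝ} (hH : IsCellHamiltonian H) {c : ℝ}
    {w φ : 𝔼 → ℝ} {y₀ : 𝔼} (hφ : ContDiff ℝ 1 φ) (hm : IsLocalMax (fun z => w z - φ z) y₀)
    (h : ∀ δ > 0, ∀ ξ a, (∀ q, inner ℝ ξ q - a ≤ H y₀ q) →
      ∀ᶠ s : ℝ in 𝓝[>] 0, w y₀ ≤ w (y₀ - s • ξ) + s * (a + c + δ)) :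
    H y₀ (gradient φ y₀) ≤ c := by
  refine le_of_forall_pos_le_add fun δ hδ => ?_
  -- An affine minorant of `H y₀` that is exact at the gradient up to `δ / 2` turns the derivative
  -- bound in its direction `ξ` into a bound on `H y₀` itself.
  obtain ⟨ξ, hξ⟩ := exists_approx_subgradient (hH.conv y₀) (gradient φ y₀) (half_pos hδ)
  have h1 := fderiv_le_of_isLocalMax ((hφ.differentiable one_ne_zero) y₀) hm
    (h (δ / 2) (half_pos hδ) ξ (inner ℝ ξ (gradient φ y₀) - H y₀ (gradient φ y₀) + δ / 2)
      fun q => by have := hξ q; rw [inner_sub_right] at this; linarith)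
  rw [← inner_gradient_left, real_inner_comm] at h1
  linarith

lemma eventually_sub_smul_mem_ball (y₀ ξ : 𝔼) {r : ℝ} (hr : 0 < r) :
    ∀ᶠ s : ℝ in 𝓝[>] 0, y₀ - s • ξ ∈ Metric.ball y₀ r := by
  have : ContinuousAt (fun s : ℝ => y₀ - s • ξ) 0 := by fun_prop
  exact (this.eventually_mem (by simpa using Metric.ball_mem_nhds y₀ hr)).filter_mono
    nhdsWithin_le_nhds

/-- Convex combinations of viscosity subsolutions of a convex Hamiltonian. -/
lemma ViscSubOn.convexCombination [Nontrivial 𝔼] {H : 𝔼 → 𝔼 → ℝ} (hH : IsCellHamiltonian H)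
    {U : Set 𝔼} (hU : IsOpen U) {w₀ w₁ : 𝔼 → ℝ} {c₀ c₁ α β : ℝ} (hα : 0 ≤ α) (hβ : 0 ≤ β)
    (hαβ : α + β = 1) (hc₀ : ContinuousOn w₀ U) (hc₁ : ContinuousOn w₁ U)
    (h₀ : ViscSubOn H c₀ U w₀) (h₁ : ViscSubOn H c₁ U w₁) :
    ViscSubOn H (α * c₀ + β * c₁) U (fun y => α * w₀ y + β * w₁ y) := by
  intro φ hφ y hy hm
  refine hH.le_of_linear hφ hm fun δ hδ ξ a ha => ?_
  obtain ⟨r₀, hr₀, -, hl₀⟩ := hH.exists_linear_bound hU hy c₀ hδ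
  obtain ⟨r₁, hr₁, -, hl₁⟩ := hH.exists_linear_bound hU hy c₁ hδ
  filter_upwards [eventually_sub_smul_mem_ball y ξ hr₀, eventually_sub_smul_mem_ball y ξ hr₁,
    self_mem_nhdsWithin] with s hs₀ hs₁ hs
  have hs' : (0 : ℝ) < s := hs
  have e₀ := hl₀ w₀ hc₀ h₀ ξ a ha _ s hs'.le hs₀ (by simpa using hr₀)
  have e₁ := hl₁ w₁ hc₁ h₁ ξ a ha _ s hs'.le hs₁ (by simpa using hr₁)
  rw [sub_add_cancel] at e₀ e₁
  have f₀ := mul_le_mul_of_nonneg_left e₀ hα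
  have f₁ := mul_le_mul_of_nonneg_left e₁ hβ
  have : α * (s * (a + c₀ + δ)) + β * (s * (a + c₁ + δ)) =
      s * (a + (α * c₀ + β * c₁) + δ) := by
    obtain rfl : β = 1 - α := by linarith
    ring
  linarith

/-- Subsolutions are Lipschitz along segments. -/
lemma IsSub.segLipschitz [Nontrivial 𝔼] {Ω : Set 𝔼} (hΩ : IsOpen Ω) {H : 𝔼 → 𝔼 → ℝ} {c R : ℝ}
    (hR : ∀ y q, H y q ≤ c → ‖q‖ ≤ R) {w : 𝔼 → ℝ} (hw : IsSub Ω H c w) :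
    SegLipschitz Ω R w := by
  intro x y hxy
  have := le_add_of_viscosity (ξ := y - x) (x := x) (s := 1) (a := R * ‖y - x‖) hΩ
    (hw.continuousOn.mono subset_closure) ?_ zero_le_one ?_
  · rw [one_smul, one_mul, add_sub_cancel] at this
    linarith
  · intro φ hφ z hz hm
    rw [← inner_gradient_left]
    exact (real_inner_le_norm _ _).trans
      (mul_le_mul_of_nonneg_right (hR _ _ (hw.visc φ hφ z hz hm)) (norm_nonneg _))
  · intro σ hσ
    exact hxy (by rw [segment_eq_image']; exact ⟨σ, hσ, rfl⟩)

/-! ### Interior cones and Lipschitz bounds up to the boundary. -/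

/-- Interior cone condition, up to the boundary. -/
lemma IsPerforatedDomain.exists_cone {Ω : Set 𝔼} (hΩ : IsPerforatedDomain Ω) {y₀ : 𝔼}
    (hy₀ : y₀ ∈ closure Ω) :
    ∃ ν : 𝔼, ∃ r > 0, ∀ y ∈ closure Ω, dist y y₀ < r → ∀ e, dist e ν < r → ∀ ε, 0 < ε → ε < r →
      y + ε • e ∈ Ω := by
  by_cases hin : y₀ ∈ Ω
  · obtain ⟨ρ, hρ, hρΩ⟩ := Metric.isOpen_iff.1 hΩ.isOpen y₀ hin
    refine ⟨0, min 1 (ρ / 2), by positivity, fun y _ hy e he ε hε hεr => hρΩ ?_⟩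
    rw [dist_zero_right] at he
    rw [Metric.mem_ball, dist_eq_norm, add_sub_right_comm]
    calc ‖y - y₀ + ε • e‖ ≤ ‖y - y₀‖ + ‖ε • e‖ := norm_add_le _ _
      _ = dist y y₀ + ε * ‖e‖ := by rw [norm_smul, Real.norm_eq_abs, abs_of_pos hε, dist_eq_norm]
      _ < ρ / 2 + 1 * (ρ / 2) := by
          have h1 := hy.trans_le (min_le_right _ _)
          have h2 := he.trans_le (min_le_right _ _)
          have h3 := hεr.trans_le (min_le_left _ _)
          have : ε * ‖e‖ ≤ 1 * (ρ / 2) := by gcongr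
          linarith
      _ = ρ := by ring
  · have hfr : y₀ ∈ frontier Ω := by rw [hΩ.isOpen.frontier_eq]; exact ⟨hy₀, hin⟩
    obtain ⟨U, φ, hU, hyU, hφ, hne, hΩU⟩ := hΩ.c1 y₀ hfr
    obtain ⟨u, hu⟩ : ∃ u, fderiv ℝ φ y₀ u ≠ 0 := by
      by_contra! h
      exact hne (ContinuousLinearMap.ext h)
    set D := fderiv ℝ φ y₀ with hD
    -- Normalized so that `φ` decreases at unit rate along `ν`. Strict differentiability makes the
    -- decrease uniform in the base point, which may itself be on the frontier.
    set ν : 𝔼 := (-(D u)⁻¹) • u with hν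
    have hDν : D ν = -1 := by rw [hν, map_smul, smul_eq_mul]; field_simp
    have hstrict : HasStrictFDerivAt φ D y₀ :=
      (hφ.contDiffAt (hU.mem_nhds hyU)).hasStrictFDerivAt one_ne_zero
    set κ : ℝ := (4 * (‖ν‖ + 1))⁻¹ with hκ
    have hκ0 : 0 < κ := by positivity
    have hev := hstrict.isLittleO.def hκ0
    obtain ⟨r₁, hr₁, h₁⟩ := Metric.eventually_nhds_iff.1 hev
    obtain ⟨r₂, hr₂, h₂⟩ := Metric.isOpen_iff.1 hU y₀ hyU
    have hle : ∀ y ∈ closure Ω, y ∈ U → φ y ≤ 0 := by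
      intro y hy hyU'
      by_contra! hpos
      have h3 : ∀ᶠ z in 𝓝 y, z ∈ U ∧ 0 < φ z :=
        (hU.eventually_mem hyU').and ((hφ.continuousOn.continuousAt
          (hU.mem_nhds hyU')).eventually (lt_mem_nhds hpos))
      obtain ⟨z, hz, hzΩ⟩ := mem_closure_iff_nhds.1 hy _ h3
      have h4 : z ∈ Ω ∩ U := ⟨hzΩ, hz.1⟩
      rw [hΩU] at h4
      exact absurd h4.2 (not_lt.2 hz.2.le)
    set ρ := min r₁ r₂ with hρ
    have hρ0 : 0 < ρ := lt_min hr₁ hr₂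
    set r := min (min 1 (ρ / 2)) (min (ρ / (2 * (‖ν‖ + 1))) (4 * (‖D‖ + 1))⁻¹) with hr
    have hr0 : 0 < r := by positivity
    refine ⟨ν, r, hr0, fun y hy hyr e he ε hε hεr => ?_⟩
    have he1 : ‖e‖ ≤ ‖ν‖ + 1 := by
      have : dist e ν < 1 := he.trans_le ((min_le_left _ _).trans (min_le_left _ _))
      rw [dist_eq_norm] at this
      linarith [norm_le_norm_add_norm_sub' e ν]
    have hy1 : dist y y₀ < ρ / 2 := hyr.trans_le ((min_le_left _ _).trans (min_le_right _ _))
    have hy2 : dist (y + ε • e) y₀ < ρ := by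
      have h3 : ε * ‖e‖ ≤ ρ / 2 := by
        have : ε ≤ ρ / (2 * (‖ν‖ + 1)) :=
          (hεr.trans_le ((min_le_right _ _).trans (min_le_left _ _))).le
        calc ε * ‖e‖ ≤ ρ / (2 * (‖ν‖ + 1)) * (‖ν‖ + 1) := by gcongr
          _ = ρ / 2 := by field_simp
      calc dist (y + ε • e) y₀ ≤ dist (y + ε • e) y + dist y y₀ := dist_triangle _ _ _
        _ = ε * ‖e‖ + dist y y₀ := by
            rw [dist_eq_norm, add_sub_cancel_left, norm_smul, Real.norm_eq_abs, abs_of_pos hε]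
        _ < ρ := by linarith
    have hyU' : y ∈ U := h₂ (Metric.mem_ball.2 (by linarith [min_le_right r₁ r₂]))
    have hzU : y + ε • e ∈ U := h₂ (Metric.mem_ball.2 (hy2.trans_le (min_le_right _ _)))
    have h3 := @h₁ (y + ε • e, y) (by
      rw [Prod.dist_eq]
      exact max_lt (hy2.trans_le (min_le_left _ _)) (by linarith [min_le_left r₁ r₂]))
    simp only [add_sub_cancel_left, map_smul, smul_eq_mul, norm_smul, Real.norm_eq_abs,
      abs_of_pos hε] at h3
    have h4 := (abs_le.1 h3).2
    have h5 : D e ≤ -1 + 1 / 4 := by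
      have h6 : D e = D ν + D (e - ν) := by rw [map_sub]; ring
      have h7 : D (e - ν) ≤ ‖D‖ * ‖e - ν‖ := (le_abs_self _).trans (D.le_opNorm _)
      have h8 : ‖e - ν‖ ≤ (4 * (‖D‖ + 1))⁻¹ := by
        rw [← dist_eq_norm]
        exact (he.trans_le ((min_le_right _ _).trans (min_le_right _ _))).le
      have h9 : ‖D‖ * ‖e - ν‖ ≤ 1 / 4 := by
        calc ‖D‖ * ‖e - ν‖ ≤ (‖D‖ + 1) * (4 * (‖D‖ + 1))⁻¹ := by gcongr; linarith
          _ = 1 / 4 := by field_simp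
      linarith
    have h6 : κ * (ε * ‖e‖) ≤ ε * (1 / 4) := by
      calc κ * (ε * ‖e‖) ≤ κ * (ε * (‖ν‖ + 1)) := by gcongr
        _ = ε * (1 / 4) := by rw [hκ]; field_simp
    have h7 : ε * D e ≤ ε * (-1 + 1 / 4) := by gcongr
    have h8 : φ (y + ε • e) < 0 := by nlinarith [hle y hy hyU']
    have h9 : y + ε • e ∈ Ω ∩ U := by rw [hΩU]; exact ⟨hzU, h8⟩
    exact h9.1

/-- Functions Lipschitz along segments in `Ω` are locally Lipschitz up to the boundary. -/
lemma IsPerforatedDomain.exists_local_lipschitz {Ω : Set 𝔼} (hΩ : IsPerforatedDomain Ω) {y₀ : 𝔼}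
    (hy₀ : y₀ ∈ closure Ω) :
    ∃ r > 0, ∃ C ≥ 0, ∀ R ≥ 0, ∀ w, ContinuousOn w (closure Ω) → SegLipschitz Ω R w →
      ∀ y ∈ closure Ω, ∀ z ∈ closure Ω, dist y y₀ < r → dist z y₀ < r →
        w z - w y ≤ C * R * ‖z - y‖ := by
  obtain ⟨ν, r, hr, hcone⟩ := hΩ.exists_cone hy₀
  refine ⟨min r (r ^ 2 / 8), by positivity, 2 / r * (2 * ‖ν‖ + r), by positivity, ?_⟩
  intro R hR w hwc hw y hy z hz hyr hzr
  rcases eq_or_ne z y with rfl | hne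
  · simp
  have hend : ∀ y ∈ closure Ω, dist y y₀ < r → ∀ e, dist e ν < r → ∀ ε, 0 < ε → ε < r →
      |w (y + ε • e) - w y| ≤ R * (ε * ‖e‖) := by
    intro y hy hyr e he ε hε hεr
    have hmem : ∀ σ, 0 < σ → σ ≤ ε → y + σ • e ∈ Ω := fun σ h0 h1 =>
      hcone y hy hyr e he σ h0 (h1.trans_lt hεr)
    have hseg : ∀ s, 0 < s → s < ε → segment ℝ (y + s • e) (y + ε • e) ⊆ Ω := by
      intro s hs hsε x hx
      rw [segment_eq_image'] at hx
      obtain ⟨θ, hθ, rfl⟩ := hx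
      have : y + s • e + θ • (y + ε • e - (y + s • e)) = y + (s + θ * (ε - s)) • e := by
        module
      beta_reduce
      rw [this]
      refine hmem _ ?_ ?_
      · nlinarith [hθ.1]
      · nlinarith [hθ.2]
    have hlim : Tendsto (fun s : ℝ => w (y + s • e)) (𝓝[>] 0) (𝓝 (w y)) := by
      have h1 : Tendsto (fun s : ℝ => y + s • e) (𝓝[>] 0) (𝓝[closure Ω] y) := by
        refine tendsto_nhdsWithin_iff.2 ⟨?_, ?_⟩
        · have : ContinuousAt (fun s : ℝ => y + s • e) 0 := by fun_prop
          simpa using this.tendsto.mono_left nhdsWithin_le_nhds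
        · filter_upwards [Ioo_mem_nhdsGT hε] with s hs
          exact subset_closure (hmem s hs.1 hs.2.le)
      exact (hwc y hy).tendsto.comp h1
    have hbd : ∀ᶠ s : ℝ in 𝓝[>] 0, |w (y + ε • e) - w (y + s • e)| ≤ R * (ε * ‖e‖) := by
      filter_upwards [Ioo_mem_nhdsGT hε] with s hs
      have h1 := hw _ _ (hseg s hs.1 hs.2)
      have h2 := hw _ _ ((segment_symm ℝ _ _).subset.trans (hseg s hs.1 hs.2))
      have h3 : ‖y + ε • e - (y + s • e)‖ ≤ ε * ‖e‖ := by
        rw [add_sub_add_left_eq_sub, ← sub_smul, norm_smul, Real.norm_eq_abs,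
          abs_of_pos (by linarith [hs.2])]
        gcongr
        linarith [hs.1]
      rw [norm_sub_rev] at h2
      have h4 := mul_le_mul_of_nonneg_left h3 hR
      rw [abs_le]
      constructor <;> linarith
    exact le_of_tendsto (tendsto_const_nhds.sub hlim).abs hbd
  have hd : 0 < ‖z - y‖ := norm_pos_iff.2 (sub_ne_zero.2 hne)
  have hd2 : ‖z - y‖ < r ^ 2 / 4 := by
    rw [← dist_eq_norm]
    calc dist z y ≤ dist z y₀ + dist y y₀ := dist_triangle_right _ _ _
      _ < r ^ 2 / 8 + r ^ 2 / 8 :=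
        add_lt_add (hzr.trans_le (min_le_right _ _)) (hyr.trans_le (min_le_right _ _))
      _ = r ^ 2 / 4 := by ring
  -- The segment from `y` to `z` may leave `Ω`, so both points are joined to `z + ε • ν = y + ε •
  -- e`. This `ε` gives `‖e - ν‖ = r / 2`, which keeps both rays in the cone, and a detour
  -- proportional to `‖z - y‖`.
  set ε := 2 / r * ‖z - y‖ with hε
  have hε0 : 0 < ε := by positivity
  have hεr : ε < r := by
    calc ε < 2 / r * (r ^ 2 / 4) := by rw [hε]; gcongr
      _ = r / 2 := by field_simp; norm_num
      _ < r := by linarith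
  set e := ν + ε⁻¹ • (z - y) with he
  have hen : ‖ε⁻¹ • (z - y)‖ = r / 2 := by
    rw [norm_smul, Real.norm_eq_abs, abs_of_pos (by positivity), hε]; field_simp
  have heν : dist e ν < r := by
    rw [dist_eq_norm, he, add_sub_cancel_left, hen]; linarith
  have hzy : y + ε • e = z + ε • ν := by
    rw [he, smul_add, smul_inv_smul₀ hε0.ne']; abel
  have h1 := hend y hy (hyr.trans_le (min_le_left _ _)) e heν ε hε0 hεr
  have h2 := hend z hz (hzr.trans_le (min_le_left _ _)) ν (by simpa using hr) ε hε0 hεr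
  rw [hzy] at h1
  have hne' : ‖e‖ ≤ ‖ν‖ + r := by
    have := norm_add_le ν (ε⁻¹ • (z - y))
    rw [hen] at this
    linarith
  have h3 : R * (ε * ‖e‖) ≤ R * (ε * (‖ν‖ + r)) := by gcongr
  calc w z - w y ≤ R * (ε * (‖ν‖ + r)) + R * (ε * ‖ν‖) := by
        linarith [(abs_le.1 h1).2, (abs_le.1 h2).1]
    _ = _ := by rw [hε]; ring

/-- Oscillation bound between two given points, linear in the Lipschitz constant along segments. -/
lemma IsPerforatedDomain.exists_chain_bound {Ω : Set 𝔼} (hΩ : IsPerforatedDomain Ω) {y z : 𝔼}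
    (hy : y ∈ closure Ω) (hz : z ∈ closure Ω) :
    ∃ C ≥ 0, ∀ R ≥ 0, ∀ w, ContinuousOn w (closure Ω) → SegLipschitz Ω R w →
      |w z - w y| ≤ C * R := by
  refine hΩ.isConnected.isPreconnected.closure.induction₂
    (fun y z => ∃ C ≥ 0, ∀ R ≥ 0, ∀ w, ContinuousOn w (closure Ω) → SegLipschitz Ω R w →
      |w z - w y| ≤ C * R) ?_ ?_ ?_ hy hz
  · intro x hx
    obtain ⟨r, hr, C, hC, h⟩ := hΩ.exists_local_lipschitz hx
    filter_upwards [self_mem_nhdsWithin, mem_nhdsWithin_of_mem_nhds (Metric.ball_mem_nhds x hr)]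
      with z hz hzr
    refine ⟨C * ‖z - x‖, by positivity, fun R hR w hwc hw => ?_⟩
    have h1 := h R hR w hwc hw x hx z hz (by simpa using hr) hzr
    have h2 := h R hR w hwc hw z hz x hx hzr (by simpa using hr)
    rw [norm_sub_rev] at h2
    rw [abs_le]
    constructor <;> linarith
  · rintro x y z - - - ⟨C, hC, h⟩ ⟨C', hC', h'⟩
    refine ⟨C + C', by positivity, fun R hR w hwc hw => ?_⟩
    have h1 := h R hR w hwc hw
    have h2 := h' R hR w hwc hw
    calc |w z - w x| ≤ |w z - w y| + |w y - w x| := abs_sub_le _ _ _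
      _ ≤ _ := by linarith
  · rintro x y - - ⟨C, hC, h⟩
    exact ⟨C, hC, fun R hR w hwc hw => by rw [abs_sub_comm]; exact h R hR w hwc hw⟩

/-! ### Stability of subsolutions. -/

/-- Stability of subsolutions under operations that only see pairs of values, such as suprema and
pointwise limits. -/
lemma IsSub.of_two_point [Nontrivial 𝔼] {Ω : Set 𝔼} (hΩ : IsPerforatedDomain Ω)
    {H : 𝔼 → 𝔼 → ℝ} (hH : IsCellHamiltonian H) {c : ℝ} {w : 𝔼 → ℝ}
    (h : ∀ δ > 0, ∀ κ > 0, ∀ x ∈ closure Ω, ∀ x' ∈ closure Ω,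
      ∃ u, IsSub Ω H (c + δ) u ∧ w x' - w x ≤ u x' - u x + κ) : IsSub Ω H c w := by
  constructor
  · intro y₀ hy₀
    obtain ⟨R₀, hR₀⟩ := hH.coer (c + 1)
    obtain ⟨r, hr, C, hC, hL⟩ := hΩ.exists_local_lipschitz hy₀
    have hle : ∀ y ∈ closure Ω, ∀ z ∈ closure Ω, dist y y₀ < r → dist z y₀ < r →
        w z - w y ≤ C * |R₀| * ‖z - y‖ := by
      intro y hy z hz hyr hzr
      refine le_of_forall_pos_le_add fun κ hκ => ?_
      obtain ⟨u, hu, huw⟩ := h 1 one_pos κ hκ y hy z hz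
      have hs : SegLipschitz Ω |R₀| u := hu.segLipschitz hΩ.isOpen fun y q hq =>
        (hR₀ y q hq).trans (le_abs_self _)
      linarith [hL |R₀| (abs_nonneg _) u hu.continuousOn hs y hy z hz hyr hzr]
    rw [ContinuousWithinAt, tendsto_iff_norm_sub_tendsto_zero]
    have hlim : Tendsto (fun z => C * |R₀| * ‖z - y₀‖) (𝓝[closure Ω] y₀) (𝓝 0) := by
      have : ContinuousAt (fun z => C * |R₀| * ‖z - y₀‖) y₀ := by fun_prop
      simpa using this.tendsto.mono_left nhdsWithin_le_nhds
    refine squeeze_zero' (Eventually.of_forall fun _ => norm_nonneg _) ?_ hlim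
    filter_upwards [self_mem_nhdsWithin, mem_nhdsWithin_of_mem_nhds (Metric.ball_mem_nhds y₀ hr)]
      with z hz hzr
    have h1 := hle y₀ hy₀ z hz (by simpa using hr) hzr
    have h2 := hle z hz y₀ hy₀ hzr (by simpa using hr)
    rw [norm_sub_rev] at h2
    rw [Real.norm_eq_abs, abs_le]
    constructor <;> linarith
  · intro φ hφ y hy hm
    refine hH.le_of_linear hφ hm fun δ hδ ξ a ha => ?_
    -- The radius does not depend on the subsolution, so it can be fixed before the competitor `u`,
    -- which varies with `s` and `κ`.
    obtain ⟨r, hr, hrΩ, hl⟩ := hH.exists_linear_bound hΩ.isOpen hy (c + δ / 2) (half_pos hδ)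
    filter_upwards [eventually_sub_smul_mem_ball y ξ hr, self_mem_nhdsWithin] with s hs₀ hs
    have hs' : (0 : ℝ) < s := hs
    refine le_of_forall_pos_le_add fun κ hκ => ?_
    obtain ⟨u, hu, huw⟩ := h (δ / 2) (half_pos hδ) κ hκ _ (subset_closure (hrΩ hs₀)) y
      (subset_closure hy)
    have e := hl u (hu.continuousOn.mono subset_closure) hu.visc ξ a ha _ s hs'.le hs₀
      (by simpa using hr)
    rw [sub_add_cancel] at e
    have : a + (c + δ / 2) + δ / 2 = a + c + δ := by ring
    rw [this] at e
    linarith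

/-! ### Lattice translations and the compact periodicity cell. -/

lemma lattice_zero : lattice (0 : Fin n → ℤ) = 0 := by
  ext i; simp [lattice]

lemma lattice_add (k l : Fin n → ℤ) : lattice (k + l) = lattice k + lattice l := by
  ext i; simp [lattice]

lemma lattice_neg (k : Fin n → ℤ) : lattice (-k) = -lattice k := by
  ext i; simp [lattice]

lemma one_le_norm_lattice {k : Fin n → ℤ} (hk : k ≠ 0) : 1 ≤ ‖lattice k‖ := by
  obtain ⟨i, hi⟩ := Function.ne_iff.1 hk
  have h1 : ‖lattice k i‖ ≤ ‖lattice k‖ := PiLp.norm_apply_le _ _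
  have h2 : (1 : ℝ) ≤ |((k i : ℤ) : ℝ)| := by
    exact_mod_cast Int.one_le_abs hi
  exact h2.trans h1

/-- The closed unit cube. -/
def unitCube (n : ℕ) : Set (EuclideanSpace ℝ (Fin n)) := {x | ∀ i, x i ∈ Icc (0 : ℝ) 1}

lemma isCompact_unitCube : IsCompact (unitCube n) := by
  have : unitCube n = (EuclideanSpace.equiv (Fin n) ℝ).toHomeomorph ⁻¹' (univ.pi fun _ => Icc 0 1) := by
    ext x; simp [unitCube, Pi.le_def, forall_and]
  rw [this, Homeomorph.isCompact_preimage]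
  exact isCompact_univ_pi fun _ => isCompact_Icc

lemma exists_add_lattice_mem_unitCube (y : 𝔼) : ∃ k : Fin n → ℤ, y + lattice k ∈ unitCube n := by
  refine ⟨fun i => -⌊y i⌋, fun i => ?_⟩
  have h1 := Int.floor_le (y i)
  have h2 := Int.lt_floor_add_one (y i)
  simp only [lattice, PiLp.add_apply, Int.cast_neg, mem_Icc]
  constructor <;> linarith

lemma IsPerforatedDomain.add_lattice_mem_closure {Ω : Set 𝔼} (hΩ : IsPerforatedDomain Ω)
    (k : Fin n → ℤ) (y : 𝔼) : y + lattice k ∈ closure Ω ↔ y ∈ closure Ω := by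
  have h1 : (Homeomorph.addRight (lattice k)) ⁻¹' Ω = Ω := by
    ext x; simp [hΩ.periodic k x]
  have h2 := (Homeomorph.addRight (lattice k)).preimage_closure Ω
  rw [h1] at h2
  exact (Set.ext_iff.1 h2 y)

lemma IsPerforatedDomain.exists_translate {Ω : Set 𝔼} (hΩ : IsPerforatedDomain Ω) {y : 𝔼}
    (hy : y ∈ closure Ω) : ∃ k : Fin n → ℤ, y + lattice k ∈ closure Ω ∩ unitCube n := by
  obtain ⟨k, hk⟩ := exists_add_lattice_mem_unitCube y
  exact ⟨k, (hΩ.add_lattice_mem_closure k y).2 hy, hk⟩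

lemma isCompact_closure_inter_unitCube (Ω : Set 𝔼) : IsCompact (closure Ω ∩ unitCube n) :=
  isCompact_unitCube.inter_left isClosed_closure

/-! ### Comparison for the state-constraint cell problem. -/

lemma hasGradientAt_norm_sq_affine {E : Type*} [NormedAddCommGroup E] [InnerProductSpace ℝ E]
    [CompleteSpace E] (a : ℝ) (u x : E) :
    HasGradientAt (fun z => ‖a • z - u‖ ^ 2) ((2 * a) • (a • x - u)) x := by
  rw [hasGradientAt_iff_hasFDerivAt]
  have h1 : HasFDerivAt (fun z : E => a • z - u) (a • ContinuousLinearMap.id ℝ E) x :=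
    ((hasFDerivAt_id x).const_smul a).sub_const u
  refine h1.norm_sq.congr_fderiv (ContinuousLinearMap.ext fun z => ?_)
  simp
  ring

lemma contDiff_norm_sq_affine {E : Type*} [NormedAddCommGroup E] [InnerProductSpace ℝ E]
    (a : ℝ) (u : E) : ContDiff ℝ 1 (fun z => ‖a • z - u‖ ^ 2) :=
  ContDiff.norm_sq ℝ (by fun_prop)

/-- Comparison: the level of a state-constraint supersolution is at most that of any
subsolution. -/
theorem level_le_of_super [Nontrivial 𝔼] {Ω : Set 𝔼} (hΩ : IsPerforatedDomain Ω)
    {H : 𝔼 → 𝔼 → ℝ} (hH : IsCellHamiltonian H) {p : 𝔼} {c c' : ℝ} {w v : 𝔼 → ℝ}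
    (hw : IsSub Ω H c w) (hwp : QuasiPeriodic Ω p w)
    (hv : ContinuousOn v (closure Ω)) (hvp : QuasiPeriodic Ω p v)
    (hsup : ∀ φ : 𝔼 → ℝ, ContDiff ℝ 1 φ → ∀ y ∈ closure Ω,
      IsLocalMinOn (fun z => v z - φ z) (closure Ω) y → c' ≤ H y (gradient φ y)) : c' ≤ c := by
  obtain ⟨y₁, hy₁⟩ := hΩ.isConnected.nonempty.closure
  obtain ⟨k, hk⟩ := hΩ.exists_translate hy₁
  obtain ⟨y₀, hy₀, hmax₀⟩ := (isCompact_closure_inter_unitCube Ω).exists_isMaxOn ⟨_, hk⟩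
    ((hw.continuousOn.sub hv).mono inter_subset_left)
  have hmax : ∀ y ∈ closure Ω, w y - v y ≤ w y₀ - v y₀ := by
    intro y hy
    obtain ⟨k, hk⟩ := hΩ.exists_translate hy
    have h1 : w (y + lattice k) - v (y + lattice k) ≤ w y₀ - v y₀ := hmax₀ hk
    rw [hwp k y hy, hvp k y hy] at h1
    linarith
  have hy₀c : y₀ ∈ closure Ω := hy₀.1
  refine le_of_forall_pos_le_add fun δ hδ => ?_
  obtain ⟨ν, r, hr, hcone⟩ := hΩ.exists_cone hy₀c
  obtain ⟨R, hR⟩ := hH.coer c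
  obtain ⟨r₁, hr₁, hclose⟩ := hH.exists_close y₀ R hδ
  set ρ := min r r₁ with hρ
  have hρ0 : 0 < ρ := lt_min hr hr₁
  set K := closure Ω ∩ Metric.closedBall y₀ ρ with hK
  have hKc : IsCompact K := (isCompact_closedBall _ _).inter_left isClosed_closure
  have hKΩ : K ⊆ closure Ω := inter_subset_left
  have hy₀K : y₀ ∈ K := ⟨hy₀c, by simp [hρ0.le]⟩
  obtain ⟨Cw, hCw⟩ := hKc.exists_bound_of_continuousOn (hw.continuousOn.mono hKΩ)
  obtain ⟨Cv, hCv⟩ := hKc.exists_bound_of_continuousOn (hv.mono hKΩ)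
  have hCw0 : 0 ≤ Cw := (norm_nonneg _).trans (hCw _ hy₀K)
  have hCv0 : 0 ≤ Cv := (norm_nonneg _).trans (hCv _ hy₀K)
  set θ := ρ / 4 with hθ
  have hθ0 : 0 < θ := by positivity
  have huc : UniformContinuousOn w K := hKc.uniformContinuousOn_of_continuous
    (hw.continuousOn.mono hKΩ)
  obtain ⟨η, hη, hηw⟩ := Metric.uniformContinuousOn_iff.1 huc (θ ^ 2 / 3) (by positivity)
  -- Boundedness alone gives the crude estimate `‖e‖ ^ 2 ≤ C₂` at the maximum of `Φ`. For small `ε`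
  -- this makes `x` and `y` close, and uniform continuity of `w` then improves it to `‖e‖ < θ`.
  set C₂ := 2 * Cw + 2 * Cv + θ ^ 2 / 3 with hC₂
  have hC₂0 : 0 ≤ C₂ := by positivity
  obtain ⟨ε, hε, hεr, hεη, hεθ⟩ : ∃ ε > 0, ε < r ∧ ε * (‖ν‖ + C₂ + 1) < η ∧
      ε * (‖ν‖ + C₂ + 1) < θ := by
    have h1 : Tendsto (fun ε : ℝ => ε * (‖ν‖ + C₂ + 1)) (𝓝[>] 0) (𝓝 0) := by
      have : ContinuousAt (fun ε : ℝ => ε * (‖ν‖ + C₂ + 1)) 0 := by fun_prop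
      simpa using this.tendsto.mono_left nhdsWithin_le_nhds
    have := (h1.eventually (gt_mem_nhds hη)).and ((h1.eventually (gt_mem_nhds hθ0)).and
      (Ioo_mem_nhdsGT hr))
    obtain ⟨ε, h2, h3, h4⟩ := this.exists
    exact ⟨ε, h4.1, h4.2, h2, h3⟩
  have hεν : ε * ‖ν‖ ≤ ε * (‖ν‖ + C₂ + 1) := by gcongr; linarith
  have hxν : y₀ + ε • ν ∈ K := by
    refine ⟨subset_closure (hcone y₀ hy₀c (by simpa using hr) ν (by simpa using hr) ε hε hεr), ?_⟩
    rw [Metric.mem_closedBall, dist_eq_norm, add_sub_cancel_left, norm_smul, Real.norm_eq_abs,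
      abs_of_pos hε]
    linarith
  have hwν : w y₀ - θ ^ 2 / 3 ≤ w (y₀ + ε • ν) := by
    have h1 := hηw _ hxν _ hy₀K (by
      rw [dist_eq_norm, add_sub_cancel_left, norm_smul, Real.norm_eq_abs, abs_of_pos hε]
      linarith)
    rw [Real.dist_eq] at h1
    linarith [(abs_lt.1 h1).1]
  -- Doubling of variables with the penalty shifted by the inward direction `ν`: a maximum satisfies
  -- `x = y + ε • (e + ν)` with `e` small, so `x` lies in the open set `Ω`, where the subsolution
  -- may be tested, while `y` may lie on the frontier. The last term localizes near `y₀`.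
  let Φ : 𝔼 × 𝔼 → ℝ := fun z => w z.1 - v z.2 - ‖ε⁻¹ • z.1 - (ε⁻¹ • z.2 + ν)‖ ^ 2 - ‖z.2 - y₀‖ ^ 2
  have hΦ : ContinuousOn Φ (K ×ˢ K) := by
    refine ((ContinuousOn.sub ?_ ?_).sub (Continuous.continuousOn (by fun_prop))).sub
      (Continuous.continuousOn (by fun_prop))
    · exact (hw.continuousOn.mono hKΩ).comp continuousOn_fst fun z hz => hz.1
    · exact (hv.mono hKΩ).comp continuousOn_snd fun z hz => hz.2
  obtain ⟨⟨x, y⟩, ⟨hxK, hyK⟩, hxy⟩ := (hKc.prod hKc).exists_isMaxOn ⟨(y₀, y₀), hy₀K, hy₀K⟩ hΦ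
  simp only at hxK hyK
  set e := ε⁻¹ • x - (ε⁻¹ • y + ν) with he
  have hbase : w y₀ - v y₀ - θ ^ 2 / 3 ≤ w x - v y - ‖e‖ ^ 2 - ‖y - y₀‖ ^ 2 := by
    have h1 : Φ (y₀ + ε • ν, y₀) ≤ Φ (x, y) := hxy ⟨hxν, hy₀K⟩
    have h2 : Φ (y₀ + ε • ν, y₀) = w (y₀ + ε • ν) - v y₀ := by
      simp only [Φ]
      rw [smul_add, inv_smul_smul₀ hε.ne']
      simp
    have h3 : Φ (x, y) = w x - v y - ‖e‖ ^ 2 - ‖y - y₀‖ ^ 2 := rfl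
    linarith
  have hxye : x - y = ε • (e + ν) := by
    rw [he, smul_add, smul_sub, smul_add, smul_inv_smul₀ hε.ne', smul_inv_smul₀ hε.ne']; abel
  have hen : ‖e‖ ≤ C₂ + 1 := by
    have h1 := (le_abs_self _).trans (hCw x hxK)
    have h2 := (neg_le_abs _).trans (hCv y hyK)
    have h3 := (neg_le_abs _).trans (hCw y₀ hy₀K)
    have h4 := (le_abs_self _).trans (hCv y₀ hy₀K)
    have h5 : ‖e‖ ^ 2 ≤ C₂ := by nlinarith [sq_nonneg ‖y - y₀‖]
    nlinarith [norm_nonneg e]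
  have hxyn : ‖x - y‖ ≤ ε * (‖ν‖ + C₂ + 1) := by
    rw [hxye, norm_smul, Real.norm_eq_abs, abs_of_pos hε]
    gcongr
    linarith [norm_add_le e ν]
  have hwxy : w x ≤ w y + θ ^ 2 / 3 := by
    have h1 := hηw x hxK y hyK (by rw [dist_eq_norm]; linarith)
    rw [Real.dist_eq] at h1
    linarith [(abs_lt.1 h1).2]
  have hsum : ‖e‖ ^ 2 + ‖y - y₀‖ ^ 2 < θ ^ 2 := by
    have := hmax y hyK.1
    nlinarith [sq_pos_of_pos hθ0]
  have heθ : ‖e‖ < θ := lt_of_pow_lt_pow_left₀ 2 hθ0.le (by nlinarith [sq_nonneg ‖y - y₀‖])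
  have hyθ : ‖y - y₀‖ < θ := lt_of_pow_lt_pow_left₀ 2 hθ0.le (by nlinarith [sq_nonneg ‖e‖])
  have hρr : ρ ≤ r := min_le_left _ _
  have hρr₁ : ρ ≤ r₁ := min_le_right _ _
  have hyd : dist y y₀ < ρ := by rw [dist_eq_norm]; linarith
  have hxd : dist x y₀ < ρ := by
    calc dist x y₀ ≤ dist x y + dist y y₀ := dist_triangle _ _ _
      _ < ρ := by rw [dist_eq_norm, dist_eq_norm]; linarith
  have hxΩ : x ∈ Ω := by
    have h1 : x = y + ε • (e + ν) := by rw [← hxye]; abel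
    rw [h1]
    refine hcone y hyK.1 (by linarith) _ ?_ ε hε hεr
    rw [dist_eq_norm, add_sub_cancel_right]
    linarith
  set q := (2 * ε⁻¹) • e with hq
  have hsubx : H x q ≤ c := by
    have hφ := hasGradientAt_norm_sq_affine ε⁻¹ (ε⁻¹ • y + ν) x
    have h1 := hw.visc _ (contDiff_norm_sq_affine ε⁻¹ (ε⁻¹ • y + ν)) x hxΩ ?_
    · rwa [hφ.gradient] at h1
    · filter_upwards [hΩ.isOpen.mem_nhds hxΩ, Metric.isOpen_ball.mem_nhds hxd] with z hz hz'
      have h1 : Φ (z, y) ≤ Φ (x, y) :=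
        hxy ⟨⟨subset_closure hz, Metric.ball_subset_closedBall hz'⟩, hyK⟩
      simp only [Φ] at h1
      linarith
  have hsupy : c' ≤ H y (q + (-2 : ℝ) • (y - y₀)) := by
    let φ : 𝔼 → ℝ := fun z => -‖(-ε⁻¹) • z - (ν - ε⁻¹ • x)‖ ^ 2 - ‖(1 : ℝ) • z - y₀‖ ^ 2
    have hφc : ContDiff ℝ 1 φ :=
      (contDiff_norm_sq_affine _ _).neg.sub (contDiff_norm_sq_affine _ _)
    have hge : ∀ z, ‖(-ε⁻¹) • z - (ν - ε⁻¹ • x)‖ = ‖ε⁻¹ • x - (ε⁻¹ • z + ν)‖ := fun z => by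
      congr 1; module
    have hgr : HasGradientAt φ (q + (-2 : ℝ) • (y - y₀)) y := by
      rw [hasGradientAt_iff_hasFDerivAt]
      refine ((hasGradientAt_iff_hasFDerivAt.1
        (hasGradientAt_norm_sq_affine (-ε⁻¹) (ν - ε⁻¹ • x) y)).neg.sub
        (hasGradientAt_iff_hasFDerivAt.1 (hasGradientAt_norm_sq_affine 1 y₀ y))).congr_fderiv ?_
      rw [← map_neg, ← map_sub]
      congr 1
      rw [hq, he]
      module
    have h1 := hsup φ hφc y hyK.1 ?_
    · rwa [hgr.gradient] at h1
    · filter_upwards [self_mem_nhdsWithin,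
        mem_nhdsWithin_of_mem_nhds (Metric.isOpen_ball.mem_nhds hyd)] with z hz hz'
      have h1 : Φ (x, z) ≤ Φ (x, y) := hxy ⟨hxK, ⟨hz, Metric.ball_subset_closedBall hz'⟩⟩
      simp only [Φ] at h1
      simp only [φ, hge, one_smul]
      linarith
  have hfin := hclose x y ((-2 : ℝ) • (y - y₀)) q (by linarith) (by linarith) (by
    rw [norm_smul]; norm_num; linarith) (hR _ _ hsubx)
  linarith

/-! ### Translates, and raising a subsolution near an orbit. -/

lemma ViscSubOn.translate {H : 𝔼 → 𝔼 → ℝ} (hH : IsCellHamiltonian H) {c : ℝ} {U : Set 𝔼}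
    {w : 𝔼 → ℝ} (h : ViscSubOn H c U w) (k : Fin n → ℤ) (a : ℝ) :
    ViscSubOn H c {y | y + lattice k ∈ U} (fun y => w (y + lattice k) - a) := by
  intro φ hφ y hy hm
  have h1 := h (fun z => φ (z - lattice k)) (hφ.comp (contDiff_id.sub contDiff_const)) _ hy ?_
  · rw [hH.per] at h1
    have : gradient (fun z => φ (z - lattice k)) (y + lattice k) = gradient φ y := by
      simp [gradient, fderiv_comp_sub]
    rwa [this] at h1
  · have ht : Tendsto (fun z => z - lattice k) (𝓝 (y + lattice k)) (𝓝 y) := by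
      have : ContinuousAt (fun z => z - lattice k) (y + lattice k) := by fun_prop
      simpa using this.tendsto
    filter_upwards [ht.eventually hm] with z hz
    simp only [sub_add_cancel] at hz
    simp only [add_sub_cancel_right]
    linarith

lemma ViscSubOn.congr {H : 𝔼 → 𝔼 → ℝ} {c : ℝ} {U : Set 𝔼} (hU : IsOpen U) {w w' : 𝔼 → ℝ}
    (h : ViscSubOn H c U w) (hww : ∀ y ∈ U, w' y = w y) : ViscSubOn H c U w' := by
  intro φ hφ y hy hm
  refine h φ hφ y hy ?_
  filter_upwards [hm, hU.mem_nhds hy] with z hz hzU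
  rwa [hww z hzU, hww y hy] at hz

lemma IsSub.translate {Ω : Set 𝔼} (hΩ : IsPerforatedDomain Ω) {H : 𝔼 → 𝔼 → ℝ}
    (hH : IsCellHamiltonian H) {c : ℝ} {w : 𝔼 → ℝ} (h : IsSub Ω H c w) (k : Fin n → ℤ) (a : ℝ) :
    IsSub Ω H c (fun y => w (y + lattice k) - a) := by
  constructor
  · refine (h.continuousOn.comp (by fun_prop) fun y hy => ?_).sub continuousOn_const
    exact (hΩ.add_lattice_mem_closure k y).2 hy
  · exact (h.visc.translate hH k a).mono le_rfl fun y hy => (hΩ.periodic k y).2 hy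

/-- Carries strictness from a neighbourhood to its lattice translates, so that compactness of one
cell is enough. -/
lemma ViscSubOn.translate_quasiPeriodic {Ω : Set 𝔼} (hΩ : IsPerforatedDomain Ω) {H : 𝔼 → 𝔼 → ℝ}
    (hH : IsCellHamiltonian H) {c : ℝ} {p : 𝔼} {w : 𝔼 → ℝ} (hw : QuasiPeriodic Ω p w)
    {N : Set 𝔼} (hN : IsOpen N) (h : ViscSubOn H c (N ∩ Ω) w) (k : Fin n → ℤ) :
    ViscSubOn H c ({y | y + lattice k ∈ N} ∩ Ω) w := by
  have h1 := (h.translate hH k (inner ℝ p (lattice k))).mono le_rfl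
    (U' := {y | y + lattice k ∈ N} ∩ Ω) fun y hy => ⟨hy.1, (hΩ.periodic k y).2 hy.2⟩
  refine h1.congr ?_ fun y hy => ?_
  · exact (hN.preimage (by fun_prop : Continuous fun y => y + lattice k)).inter hΩ.isOpen
  · rw [hw k y (subset_closure hy.2)]; ring

/-- If the state-constraint supersolution property fails at `y₀`, a quasi-periodic subsolution can
be raised near the orbit of `y₀`, becoming strict there. -/
lemma exists_bump [Nontrivial 𝔼] {Ω : Set 𝔼} (hΩ : IsPerforatedDomain Ω) {H : 𝔼 → 𝔼 → ℝ}
    (hH : IsCellHamiltonian H) {c : ℝ} {p : 𝔼} {m : 𝔼 → ℝ} (hm : IsSub Ω H c m)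
    (hmp : QuasiPeriodic Ω p m) {y₀ : 𝔼} (hy₀ : y₀ ∈ closure Ω) {φ : 𝔼 → ℝ}
    (hφ : ContDiff ℝ 1 φ) (hmin : IsLocalMinOn (fun z => m z - φ z) (closure Ω) y₀)
    (hlt : H y₀ (gradient φ y₀) < c) {ρ₀ : ℝ} (hρ₀ : 0 < ρ₀) :
    ∃ w, IsSub Ω H c w ∧ QuasiPeriodic Ω p w ∧ m y₀ < w y₀ ∧
      (∀ y ∈ closure Ω, (∀ k, ρ₀ ≤ dist (y + lattice k) y₀) → w y = m y) ∧
      ∃ r > 0, ∃ η > 0, ViscSubOn H (c - η) (Metric.ball y₀ r ∩ Ω) w := by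
  have hgradc : Continuous (gradient φ) :=
    (InnerProductSpace.toDual ℝ 𝔼).symm.continuous.comp (hφ.continuous_fderiv one_ne_zero)
  set η := (c - H y₀ (gradient φ y₀)) / 2 with hη
  have hη0 : 0 < η := by rw [hη]; linarith
  have hev1 : ∀ᶠ z in 𝓝 y₀, H z (gradient φ z - (2 : ℝ) • (z - y₀)) < c - η := by
    have : Continuous fun z => H z (gradient φ z - (2 : ℝ) • (z - y₀)) :=
      hH.cont.comp (f := fun z => (z, gradient φ z - (2 : ℝ) • (z - y₀))) (by fun_prop)
    refine this.continuousAt.eventually (gt_mem_nhds ?_)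
    simp only [sub_self, smul_zero, sub_zero]
    rw [hη]; linarith
  obtain ⟨r₁, hr₁, h₁⟩ := Metric.eventually_nhds_iff.1 hev1
  obtain ⟨r₀, hr₀, h₀⟩ := Metric.mem_nhdsWithin_iff.1 hmin
  set ρ := min (min r₀ r₁) (min ρ₀ (1 / 2)) with hρ
  have hρ0 : 0 < ρ := by positivity
  have hρr₀ : ρ ≤ r₀ := (min_le_left _ _).trans (min_le_left _ _)
  have hρr₁ : ρ ≤ r₁ := (min_le_left _ _).trans (min_le_right _ _)
  have hρρ₀ : ρ ≤ ρ₀ := (min_le_right _ _).trans (min_le_left _ _)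
  have hρh : ρ ≤ 1 / 2 := (min_le_right _ _).trans (min_le_right _ _)
  -- At distance more than `ρ / 2` from `y₀` the quadratic term of `ψ` exceeds `ρ ^ 2 / 4 > δ`, so
  -- there `ψ < m` and the maximum glues continuously with `m`.
  set δ := ρ ^ 2 / 8 with hδ
  have hδ0 : 0 < δ := by positivity
  let ψ : 𝔼 → ℝ := fun z => φ z + (m y₀ - φ y₀ + δ) - ‖(1 : ℝ) • z - y₀‖ ^ 2
  have hψc : ContDiff ℝ 1 ψ := (hφ.add contDiff_const).sub (contDiff_norm_sq_affine _ _)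
  have hψg : ∀ z, gradient ψ z = gradient φ z - (2 : ℝ) • (z - y₀) := fun z => by
    refine HasGradientAt.gradient ?_
    rw [hasGradientAt_iff_hasFDerivAt]
    refine (((hasGradientAt_iff_hasFDerivAt.1
      ((hφ.differentiable one_ne_zero) z).hasGradientAt).add_const _).sub
      (hasGradientAt_iff_hasFDerivAt.1 (hasGradientAt_norm_sq_affine 1 y₀ z))).congr_fderiv ?_
    rw [← map_sub]
    congr 1
    module
  have hψm : ∀ z ∈ closure Ω, dist z y₀ < ρ → ψ z ≤ m z + δ - dist z y₀ ^ 2 := by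
    intro z hz hzρ
    have h2 : m y₀ - φ y₀ ≤ m z - φ z := h₀ ⟨Metric.mem_ball.2 (by linarith), hz⟩
    simp only [ψ, one_smul, dist_eq_norm]
    linarith
  have hψy₀ : ψ y₀ = m y₀ + δ := by simp [ψ]; ring
  classical
  let w₁ : 𝔼 → ℝ := fun z => if dist z y₀ < ρ then max (m z) (ψ z) else m z
  have hw₁m : ∀ z, m z ≤ w₁ z := fun z => by
    simp only [w₁]; split_ifs
    · exact le_max_left _ _
    · exact le_rfl
  have hw₁ψ : ∀ z, dist z y₀ < ρ → ψ z ≤ w₁ z := fun z hz => by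
    simp only [w₁, if_pos hz]; exact le_max_right _ _
  have hw₁δ : ∀ z ∈ closure Ω, w₁ z ≤ m z + δ := fun z hz => by
    simp only [w₁]; split_ifs with h
    · exact max_le (by linarith) ((hψm z hz h).trans (by nlinarith [sq_nonneg (dist z y₀)]))
    · linarith
  have hw₁far : ∀ z, ρ ≤ dist z y₀ → w₁ z = m z := fun z hz => by
    simp only [w₁, if_neg (not_lt.2 hz)]
  -- Subsolutions are tested only at points of `Ω`, so `ψ` may be inserted even when `y₀` is on the
  -- frontier.
  have hw₁sub : IsSub Ω H c w₁ := by
    constructor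
    · intro z hz
      by_cases hd : dist z y₀ < ρ
      · have h2 : ContinuousWithinAt (fun z => max (m z) (ψ z)) (closure Ω) z :=
          (hm.continuousOn z hz).max hψc.continuous.continuousWithinAt
        refine h2.congr_of_eventuallyEq ?_ (if_pos hd)
        filter_upwards [mem_nhdsWithin_of_mem_nhds (Metric.isOpen_ball.mem_nhds hd)] with x hx
        exact if_pos hx
      · have hd' : ρ / 2 < dist z y₀ := by linarith
        refine (hm.continuousOn z hz).congr_of_eventuallyEq ?_ (if_neg hd)
        filter_upwards [self_mem_nhdsWithin, mem_nhdsWithin_of_mem_nhds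
          ((isOpen_lt continuous_const (by fun_prop :
            Continuous fun x : 𝔼 => dist x y₀)).mem_nhds hd')] with x hx hx'
        replace hx' : ρ / 2 < dist x y₀ := hx'
        simp only [w₁]; split_ifs with h
        · refine max_eq_left ((hψm x hx h).trans ?_)
          rw [hδ]
          nlinarith
        · rfl
    · intro χ hχ z hz hmax
      by_cases heq : w₁ z = m z
      · refine hm.visc χ hχ z hz ?_
        filter_upwards [hmax] with x hx
        linarith [hw₁m x]
      · have hd : dist z y₀ < ρ := by
          by_contra h
          exact heq (hw₁far z (not_lt.1 h))
        have heq' : w₁ z = ψ z := by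
          simp only [w₁, if_pos hd] at heq ⊢
          rcases max_choice (m z) (ψ z) with h | h
          · exact absurd h heq
          · exact h
        have hmax' : IsLocalMax (fun x => ψ x - χ x) z := by
          filter_upwards [hmax, Metric.isOpen_ball.mem_nhds hd] with x hx hx'
          linarith [hw₁ψ x hx']
        have hg : gradient ψ z = gradient χ z := by
          have h2 := hmax'.fderiv_eq_zero
          rw [fderiv_fun_sub ((hψc.differentiable one_ne_zero) z)
            ((hχ.differentiable one_ne_zero) z), sub_eq_zero] at h2
          simp only [gradient, h2]
        rw [← hg, hψg]
        have := @h₁ z (by linarith)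
        linarith
  -- The supremum of all translates restores quasi-periodicity. As `ρ ≤ 1 / 2` and nonzero lattice
  -- vectors have norm at least 1, only `t 0` is raised near `y₀`.
  let t : (Fin n → ℤ) → 𝔼 → ℝ := fun k y => w₁ (y + lattice k) - inner ℝ p (lattice k)
  have htm : ∀ k, ∀ y ∈ closure Ω, m y ≤ t k y := fun k y hy => by
    have := hw₁m (y + lattice k)
    rw [hmp k y hy] at this
    simp only [t]; linarith
  have htδ : ∀ k, ∀ y ∈ closure Ω, t k y ≤ m y + δ := fun k y hy => by
    have := hw₁δ (y + lattice k) ((hΩ.add_lattice_mem_closure k y).2 hy)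
    rw [hmp k y hy] at this
    simp only [t]; linarith
  have htfar : ∀ k, ∀ y ∈ closure Ω, ρ ≤ dist (y + lattice k) y₀ → t k y = m y :=
    fun k y hy hd => by simp only [t, hw₁far _ hd, hmp k y hy]; ring
  have htsub : ∀ k, IsSub Ω H c (t k) := fun k => hw₁sub.translate hΩ hH k _
  have hbdd : ∀ y ∈ closure Ω, BddAbove (range fun k => t k y) := fun y hy =>
    ⟨m y + δ, by rintro _ ⟨k, rfl⟩; exact htδ k y hy⟩
  let w : 𝔼 → ℝ := fun y => ⨆ k, t k y
  have hwt : ∀ k, ∀ y ∈ closure Ω, t k y ≤ w y := fun k y hy => le_ciSup (hbdd y hy) k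
  have ht0 : ∀ y, t 0 y = w₁ y := fun y => by simp [t, lattice_zero]
  have hwqp : ∀ k, ∀ y ∈ closure Ω, w (y + lattice k) ≤ w y + inner ℝ p (lattice k) := by
    intro k y hy
    refine ciSup_le fun l => ?_
    have h2 := hwt (k + l) y hy
    simp only [t, lattice_add, inner_add_right] at h2 ⊢
    rw [add_assoc]
    linarith
  refine ⟨w, ?_, ?_, ?_, ?_, ?_⟩
  · refine IsSub.of_two_point hΩ hH fun δ' hδ' κ hκ x hx x' hx' => ?_
    obtain ⟨k, hk⟩ := exists_lt_of_lt_ciSup (show w x' - κ < ⨆ k, t k x' by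
      change w x' - κ < w x'; linarith)
    exact ⟨t k, (htsub k).mono (by linarith), by linarith [hwt k x hx]⟩
  · intro k y hy
    refine le_antisymm (hwqp k y hy) ?_
    have h2 := hwqp (-k) (y + lattice k) ((hΩ.add_lattice_mem_closure k y).2 hy)
    rw [lattice_neg, add_neg_cancel_right, inner_neg_right] at h2
    linarith
  · have h2 := hwt 0 y₀ hy₀
    rw [ht0] at h2
    have h3 := hw₁ψ y₀ (by simpa using hρ0)
    linarith
  · intro y hy hfar
    have : ∀ k, t k y = m y := fun k => htfar k y hy (hρρ₀.trans (hfar k))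
    simp only [w, this, ciSup_const]
  · have hev2 : ∀ᶠ z in 𝓝[closure Ω] y₀, m z < ψ z :=
      (hm.continuousOn y₀ hy₀).eventually_lt hψc.continuous.continuousWithinAt (by linarith)
    obtain ⟨r₂, hr₂, h₂⟩ := Metric.mem_nhdsWithin_iff.1 hev2
    refine ⟨min ρ r₂, by positivity, η, hη0, ?_⟩
    have hwψ : ∀ z ∈ Metric.ball y₀ (min ρ r₂) ∩ Ω, w z = ψ z := by
      rintro z ⟨hz, hzΩ⟩
      have hzc := subset_closure hzΩ
      have hzρ : dist z y₀ < ρ := (Metric.mem_ball.1 hz).trans_le (min_le_left _ _)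
      have hzψ : m z < ψ z :=
        h₂ ⟨Metric.ball_subset_ball (min_le_right _ _) hz, hzc⟩
      refine le_antisymm (ciSup_le fun k => ?_) ?_
      · by_cases hk : k = 0
        · subst hk
          rw [ht0]
          simp only [w₁, if_pos hzρ]
          exact max_le hzψ.le le_rfl
        · rw [htfar k z hzc ?_]
          · exact hzψ.le
          · have h3 := one_le_norm_lattice hk
            have h4 : ‖lattice k‖ ≤ dist (z + lattice k) y₀ + dist z y₀ := by
              calc ‖lattice k‖ = dist (z + lattice k) z := by simp [dist_eq_norm]
                _ ≤ _ := dist_triangle_right _ _ _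
            linarith
      · have h3 := hwt 0 z hzc
        rw [ht0] at h3
        exact (hw₁ψ z hzρ).trans h3
    refine ViscSubOn.congr (w := ψ) (Metric.isOpen_ball.inter hΩ.isOpen) ?_ hwψ
    intro χ hχ z hz hmax
    have hg : gradient ψ z = gradient χ z := by
      have h3 := hmax.fderiv_eq_zero
      rw [fderiv_fun_sub ((hψc.differentiable one_ne_zero) z)
        ((hχ.differentiable one_ne_zero) z), sub_eq_zero] at h3
      simp only [gradient, h3]
    rw [← hg, hψg]
    exact (@h₁ z (by linarith [Metric.mem_ball.1 hz.1, min_le_left ρ r₂])).le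

/-! ### The critical level and solvability of the cell problem. -/

/-- The levels `c` at which there is a subsolution with asymptotic slope `p`. -/
def subLevels (Ω : Set 𝔼) (H : 𝔼 → 𝔼 → ℝ) (p : 𝔼) : Set ℝ :=
  {c | ∃ w, IsSub Ω H c w ∧ QuasiPeriodic Ω p w}

lemma gradient_inner_left (p y : 𝔼) : HasGradientAt (fun z : 𝔼 => inner ℝ p z) p y := by
  rw [hasGradientAt_iff_hasFDerivAt]
  exact (InnerProductSpace.toDual ℝ 𝔼 p).hasFDerivAt

lemma IsCellHamiltonian.exists_upper_bound {H : 𝔼 → 𝔼 → ℝ} (hH : IsCellHamiltonian H) (p : 𝔼) :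
    ∃ c, ∀ y, H y p ≤ c := by
  obtain ⟨C, hC⟩ := (isCompact_unitCube (n := n)).exists_bound_of_continuousOn
    (f := fun y => H y p) (hH.cont.comp (f := fun y => (y, p)) (by fun_prop)).continuousOn
  refine ⟨C, fun y => ?_⟩
  obtain ⟨k, hk⟩ := exists_add_lattice_mem_unitCube y
  rw [← hH.per k]
  exact (le_abs_self _).trans (hC _ hk)

lemma IsCellHamiltonian.exists_lower_bound {H : 𝔼 → 𝔼 → ℝ} (hH : IsCellHamiltonian H) :
    ∃ c, ∀ y q, c ≤ H y q := by
  obtain ⟨R, hR⟩ := hH.coer 0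
  obtain ⟨C, hC⟩ := ((isCompact_unitCube (n := n)).prod
    (isCompact_closedBall (0 : 𝔼) R)).exists_bound_of_continuousOn hH.cont.continuousOn
  refine ⟨min 0 (-C), fun y q => ?_⟩
  rcases le_or_gt (H y q) 0 with h | h
  · obtain ⟨k, hk⟩ := exists_add_lattice_mem_unitCube y
    have h1 := hC (y + lattice k, q) ⟨hk, by simpa using hR y q h⟩
    simp only [Function.uncurry_apply_pair, hH.per] at h1
    exact (min_le_right _ _).trans (neg_le_of_abs_le h1)
  · exact (min_le_left _ _).trans h.le

/-- The linear function of slope `p` is a subsolution at any level bounding `H(·, p)`. -/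
lemma subLevels_nonempty {Ω : Set 𝔼} {H : 𝔼 → 𝔼 → ℝ} (hH : IsCellHamiltonian H) (p : 𝔼) :
    (subLevels Ω H p).Nonempty := by
  obtain ⟨c, hc⟩ := hH.exists_upper_bound p
  refine ⟨c, fun z => inner ℝ p z, ⟨(by fun_prop : Continuous _).continuousOn, ?_⟩,
    fun k y _ => inner_add_right _ _ _⟩
  intro φ hφ y _ hm
  have h2 := hm.fderiv_eq_zero
  have h3 := gradient_inner_left p y
  rw [fderiv_fun_sub h3.differentiableAt ((hφ.differentiable one_ne_zero) y), sub_eq_zero] at h2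
  have : gradient φ y = p := by rw [← h3.gradient]; simp only [gradient, h2]
  rw [this]
  exact hc y

/-- A subsolution is touched from above at some point of `Ω`, where its level dominates a value of
`H`. -/
lemma subLevels_bddBelow [Nontrivial 𝔼] {Ω : Set 𝔼} (hΩ : IsPerforatedDomain Ω)
    {H : 𝔼 → 𝔼 → ℝ} (hH : IsCellHamiltonian H) (p : 𝔼) : BddBelow (subLevels Ω H p) := by
  obtain ⟨C, hC⟩ := hH.exists_lower_bound
  refine ⟨C, ?_⟩
  rintro c ⟨w, hw, -⟩
  obtain ⟨φ, hφ, y, hy, hm⟩ := exists_isLocalMax_sub hΩ.isOpen hΩ.isConnected.nonempty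
    (hw.continuousOn.mono subset_closure)
  exact (hC _ _).trans (hw.visc φ hφ y hy hm)

/-- At the critical level there is a maximal subsolution normalized at a given point. -/
lemma exists_maximal_sub [Nontrivial 𝔼] {Ω : Set 𝔼} (hΩ : IsPerforatedDomain Ω)
    {H : 𝔼 → 𝔼 → ℝ} (hH : IsCellHamiltonian H) (p : 𝔼) {z : 𝔼} (hz : z ∈ closure Ω) :
    ∃ m, IsSub Ω H (sInf (subLevels Ω H p)) m ∧ QuasiPeriodic Ω p m ∧ m z = 0 ∧
      ∀ w, IsSub Ω H (sInf (subLevels Ω H p)) w → QuasiPeriodic Ω p w →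
        ∀ y ∈ closure Ω, w y - w z ≤ m y := by
  set c := sInf (subLevels Ω H p) with hc
  have hex : ∀ c' > c, ∃ w, IsSub Ω H c' w ∧ QuasiPeriodic Ω p w := by
    intro c' hc'
    obtain ⟨c'', ⟨w, hw, hwp⟩, hlt⟩ := exists_lt_of_csInf_lt (subLevels_nonempty hH p) hc'
    exact ⟨w, hw.mono hlt.le, hwp⟩
  obtain ⟨R₀, hR₀⟩ := hH.coer (c + 1)
  -- Subsolutions are so far available only at levels above `c`. `A y` collects the bounds on `w y -
  -- w z` valid for all subsolutions at some level `c' > c`; its infimum is the limit, as `c'`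
  -- decreases to `c`, of the maximal increments.
  let A : 𝔼 → Set ℝ := fun y =>
    {r | ∃ c' > c, ∀ w, IsSub Ω H c' w → QuasiPeriodic Ω p w → w y - w z ≤ r}
  have hosc : ∀ y ∈ closure Ω, ∃ C, ∀ w, IsSub Ω H (c + 1) w → |w y - w z| ≤ C := by
    intro y hy
    obtain ⟨C, hC, h⟩ := hΩ.exists_chain_bound hz hy
    exact ⟨C * |R₀|, fun w hw => h _ (abs_nonneg _) w hw.continuousOn
      (hw.segLipschitz hΩ.isOpen fun y q hq => (hR₀ y q hq).trans (le_abs_self _))⟩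
  have hAne : ∀ y ∈ closure Ω, (A y).Nonempty := by
    intro y hy
    obtain ⟨C, h⟩ := hosc y hy
    exact ⟨C, c + 1, by linarith, fun w hw _ => (le_abs_self _).trans (h w hw)⟩
  have hAbdd : ∀ y ∈ closure Ω, BddBelow (A y) := by
    intro y hy
    obtain ⟨C, h⟩ := hosc y hy
    refine ⟨-C, ?_⟩
    rintro r ⟨c', hc', hr⟩
    obtain ⟨w, hw, hwp⟩ := hex (min c' (c + 1)) (lt_min hc' (by linarith))
    have h1 := hr w (hw.mono (min_le_left _ _)) hwp
    have h2 := (abs_le.1 (h w (hw.mono (min_le_right _ _)))).1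
    linarith
  let m : 𝔼 → ℝ := fun y => sInf (A y)
  have hmle : ∀ y ∈ closure Ω, ∀ r, (∀ c' > c, ∃ w, IsSub Ω H c' w ∧ QuasiPeriodic Ω p w ∧
      r ≤ w y - w z) → r ≤ m y := by
    intro y hy r h
    refine le_csInf (hAne y hy) ?_
    rintro r' ⟨c', hc', hr'⟩
    obtain ⟨w, hw, hwp, hle⟩ := h c' hc'
    exact hle.trans (hr' w hw hwp)
  have hmex : ∀ y ∈ closure Ω, ∀ κ > 0, ∀ c' > c, ∃ w, IsSub Ω H c' w ∧ QuasiPeriodic Ω p w ∧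
      m y - κ < w y - w z := by
    intro y hy κ hκ c' hc'
    by_contra! hcon
    have : m y ≤ m y - κ := csInf_le (hAbdd y hy) ⟨c', hc', hcon⟩
    linarith
  have hmup : ∀ y ∈ closure Ω, ∀ κ > 0, ∃ c' > c, ∀ w, IsSub Ω H c' w → QuasiPeriodic Ω p w →
      w y - w z ≤ m y + κ := by
    intro y hy κ hκ
    obtain ⟨r, ⟨c', hc', hr⟩, hlt⟩ := exists_lt_of_csInf_lt (hAne y hy)
      (show sInf (A y) < m y + κ by change m y < m y + κ; linarith)
    exact ⟨c', hc', fun w hw hwp => (hr w hw hwp).trans hlt.le⟩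
  have hqp : ∀ k, ∀ y ∈ closure Ω, m y + inner ℝ p (lattice k) ≤ m (y + lattice k) := by
    intro k y hy
    refine le_of_forall_pos_le_add fun κ hκ => ?_
    have := hmle (y + lattice k) ((hΩ.add_lattice_mem_closure k y).2 hy)
      (m y + inner ℝ p (lattice k) - κ) fun c' hc' => by
        obtain ⟨w, hw, hwp, hlt⟩ := hmex y hy κ hκ c' hc'
        exact ⟨w, hw, hwp, by rw [hwp k y hy]; linarith⟩
    linarith
  refine ⟨m, ?_, ?_, ?_, ?_⟩
  · refine IsSub.of_two_point hΩ hH fun δ hδ κ hκ x hx x' hx' => ?_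
    obtain ⟨c₁, hc₁, h₁⟩ := hmup x hx (κ / 2) (half_pos hκ)
    obtain ⟨w, hw, hwp, hlt⟩ := hmex x' hx' (κ / 2) (half_pos hκ) (min c₁ (c + δ))
      (lt_min hc₁ (by linarith))
    refine ⟨w, hw.mono (min_le_right _ _), ?_⟩
    have := h₁ w (hw.mono (min_le_left _ _)) hwp
    linarith
  · intro k y hy
    refine le_antisymm ?_ (hqp k y hy)
    have h2 := hqp (-k) (y + lattice k) ((hΩ.add_lattice_mem_closure k y).2 hy)
    rw [lattice_neg, add_neg_cancel_right, inner_neg_right] at h2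
    linarith
  · refine le_antisymm (csInf_le (hAbdd z hz) ⟨c + 1, by linarith, fun w _ _ => by simp⟩) ?_
    refine hmle z hz 0 fun c' hc' => ?_
    obtain ⟨w, hw, hwp⟩ := hex c' hc'
    exact ⟨w, hw, hwp, by simp⟩
  · exact fun w hw hwp y hy => hmle y hy _ fun c' hc' => ⟨w, hw.mono hc'.le, hwp, le_rfl⟩

/-- Distinct points of the orbit are at distance at least 1, so at most one is closer than `1 / 2`
to `y`. -/
lemma exists_pos_le_dist_orbit {z y : 𝔼} (h : ∀ k, z + lattice k ≠ y) :
    ∃ ρ > 0, ∀ k, ρ ≤ dist (z + lattice k) y := by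
  by_cases hex : ∃ k₀, dist (z + lattice k₀) y < 1 / 2
  · obtain ⟨k₀, hk₀⟩ := hex
    refine ⟨dist (z + lattice k₀) y, dist_pos.2 (h k₀), fun k => ?_⟩
    by_cases hk : k = k₀
    · rw [hk]
    · have h1 := one_le_norm_lattice (sub_ne_zero.2 hk)
      have h2 : ‖lattice (k - k₀)‖ ≤ dist (z + lattice k) y + dist (z + lattice k₀) y := by
        rw [sub_eq_add_neg, lattice_add, lattice_neg]
        refine le_trans (le_of_eq ?_) (dist_triangle_right _ _ _)
        rw [dist_eq_norm]; congr 1; abel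
      linarith
  · push Not at hex
    exact ⟨1 / 2, by norm_num, hex⟩

/-- Either the maximal subsolution at `z` is a state-constraint supersolution, or there is a
subsolution that is strict near `z`. -/
lemma super_or_exists_strict [Nontrivial 𝔼] {Ω : Set 𝔼} (hΩ : IsPerforatedDomain Ω)
    {H : 𝔼 → 𝔼 → ℝ} (hH : IsCellHamiltonian H) {p : 𝔼} {c : ℝ} {z : 𝔼} (hz : z ∈ closure Ω)
    {m : 𝔼 → ℝ} (hm : IsSub Ω H c m) (hmp : QuasiPeriodic Ω p m) (hmz : m z = 0)
    (hmax : ∀ w, IsSub Ω H c w → QuasiPeriodic Ω p w → ∀ y ∈ closure Ω, w y - w z ≤ m y) :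
    (∀ φ : 𝔼 → ℝ, ContDiff ℝ 1 φ → ∀ y ∈ closure Ω,
      IsLocalMinOn (fun x => m x - φ x) (closure Ω) y → c ≤ H y (gradient φ y)) ∨
    ∃ w, IsSub Ω H c w ∧ QuasiPeriodic Ω p w ∧ ∃ N, IsOpen N ∧ z ∈ N ∧ ∃ η > 0,
      ViscSubOn H (c - η) (N ∩ Ω) w := by
  rw [or_iff_not_imp_left]
  intro hns
  push Not at hns
  obtain ⟨φ, hφ, y₀, hy₀, hmin, hlt⟩ := hns
  by_cases horb : ∃ k, z + lattice k = y₀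
  · obtain ⟨k, hk⟩ := horb
    obtain ⟨w, hw, hwp, -, -, r, hr, η, hη, hs⟩ :=
      exists_bump hΩ hH hm hmp hy₀ hφ hmin hlt one_pos
    refine ⟨w, hw, hwp, {y | y + lattice k ∈ Metric.ball y₀ r}, ?_, ?_, η, hη,
      hs.translate_quasiPeriodic hΩ hH hwp Metric.isOpen_ball k⟩
    · exact Metric.isOpen_ball.preimage (by fun_prop : Continuous fun y => y + lattice k)
    · change z + lattice k ∈ Metric.ball y₀ r
      rw [hk]; exact Metric.mem_ball_self hr
  · push Not at horb
    -- A bump supported away from the orbit of `z` keeps the value at `z` and raises the one at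
    -- `y₀`, against maximality.
    obtain ⟨ρ, hρ, hfar⟩ := exists_pos_le_dist_orbit horb
    obtain ⟨w, hw, hwp, hgt, heq, -⟩ := exists_bump hΩ hH hm hmp hy₀ hφ hmin hlt hρ
    have h1 := hmax w hw hwp y₀ hy₀
    rw [heq z hz hfar, hmz] at h1
    linarith

/-- Solvability of the state-constraint cell problem at the critical level. -/
theorem exists_cellSolution [Nontrivial 𝔼] {Ω : Set 𝔼} (hΩ : IsPerforatedDomain Ω)
    {H : 𝔼 → 𝔼 → ℝ} (hH : IsCellHamiltonian H) (p : 𝔼) :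
    ∃ c v, IsCellSolution Ω H p c v := by
  set c := sInf (subLevels Ω H p) with hc
  have hkey : ∃ m, IsSub Ω H c m ∧ QuasiPeriodic Ω p m ∧ ∀ φ : 𝔼 → ℝ, ContDiff ℝ 1 φ →
      ∀ y ∈ closure Ω, IsLocalMinOn (fun x => m x - φ x) (closure Ω) y →
        c ≤ H y (gradient φ y) := by
    by_contra hno
    obtain ⟨z₀, hz₀⟩ := hΩ.isConnected.nonempty.closure
    have hstrict : ∀ z ∈ closure Ω, ∃ w, IsSub Ω H c w ∧ QuasiPeriodic Ω p w ∧
        ∃ N, IsOpen N ∧ z ∈ N ∧ ∃ η > 0, ViscSubOn H (c - η) (N ∩ Ω) w := by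
      intro z hz
      obtain ⟨m, hm, hmp, hmz, hmax⟩ := exists_maximal_sub hΩ hH p hz
      rcases super_or_exists_strict hΩ hH hz hm hmp hmz hmax with h | h
      · exact absurd ⟨m, hm, hmp, h⟩ hno
      · exact h
    have hglobal : ∃ w, IsSub Ω H c w ∧ QuasiPeriodic Ω p w ∧ ∃ N, IsOpen N ∧
        closure Ω ∩ unitCube n ⊆ N ∧ ∃ η > 0, ViscSubOn H (c - η) (N ∩ Ω) w := by
      refine (isCompact_closure_inter_unitCube Ω).induction_on
        (p := fun K => ∃ w, IsSub Ω H c w ∧ QuasiPeriodic Ω p w ∧ ∃ N, IsOpen N ∧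
          K ⊆ N ∧ ∃ η > 0, ViscSubOn H (c - η) (N ∩ Ω) w) ?_ ?_ ?_ ?_
      · obtain ⟨w, hw, hwp, -⟩ := hstrict z₀ hz₀
        exact ⟨w, hw, hwp, ∅, isOpen_empty, subset_rfl, 1, one_pos,
          fun φ _ y hy _ => absurd hy.1 (notMem_empty y)⟩
      · rintro s t hst ⟨w, hw, hwp, N, hN, htN, h⟩
        exact ⟨w, hw, hwp, N, hN, hst.trans htN, h⟩
      -- The average of two subsolutions is strict wherever one of them is, with half the margin.
      · rintro s t ⟨w, hw, hwp, N, hN, hsN, η, hη, h⟩ ⟨w', hw', hwp', N', hN', hsN', η', hη', h'⟩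
        have h2 : (0 : ℝ) ≤ 1 / 2 := by norm_num
        refine ⟨fun y => 1 / 2 * w y + 1 / 2 * w' y, ⟨?_, ?_⟩, ?_, N ∪ N', hN.union hN',
          union_subset_union hsN hsN', min η η' / 2, by positivity, ?_⟩
        · exact (continuousOn_const.mul hw.continuousOn).add
            (continuousOn_const.mul hw'.continuousOn)
        · exact (ViscSubOn.convexCombination hH hΩ.isOpen h2 h2 (by norm_num)
            (hw.continuousOn.mono subset_closure) (hw'.continuousOn.mono subset_closure)
            hw.visc hw'.visc).mono (by linarith) subset_rfl
        · intro k y hy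
          beta_reduce
          rw [hwp k y hy, hwp' k y hy]; ring
        · have hc : ∀ N : Set 𝔼, N ∩ Ω ⊆ closure Ω := fun N =>
            inter_subset_right.trans subset_closure
          have e := ViscSubOn.convexCombination hH (hN.inter hΩ.isOpen) h2 h2 (by norm_num)
            (hw.continuousOn.mono (hc N)) (hw'.continuousOn.mono (hc N)) h
            (hw'.visc.mono le_rfl inter_subset_right)
          have e' := ViscSubOn.convexCombination hH (hN'.inter hΩ.isOpen) h2 h2 (by norm_num)
            (hw.continuousOn.mono (hc N')) (hw'.continuousOn.mono (hc N'))
            (hw.visc.mono le_rfl inter_subset_right) h'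
          have l1 := min_le_left η η'
          have l2 := min_le_right η η'
          rintro φ hφ y ⟨hy | hy, hyΩ⟩ hm
          · linarith [e φ hφ y ⟨hy, hyΩ⟩ hm]
          · linarith [e' φ hφ y ⟨hy, hyΩ⟩ hm]
      · intro z hz
        obtain ⟨w, hw, hwp, N, hN, hzN, h⟩ := hstrict z hz.1
        exact ⟨N, mem_nhdsWithin_of_mem_nhds (hN.mem_nhds hzN), w, hw, hwp, N, hN, subset_rfl, h⟩
    obtain ⟨w, hw, hwp, N, hN, hKN, η, hη, h⟩ := hglobal
    have hmem : c - η ∈ subLevels Ω H p := by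
      refine ⟨w, ⟨hw.continuousOn, fun φ hφ y hy hm => ?_⟩, hwp⟩
      obtain ⟨k, hk⟩ := hΩ.exists_translate (subset_closure hy)
      exact h.translate_quasiPeriodic hΩ hH hwp hN k φ hφ y ⟨hKN hk, hy⟩ hm
    have := csInf_le (subLevels_bddBelow hΩ hH p) hmem
    linarith
  obtain ⟨m, hm, hmp, hsup⟩ := hkey
  have hgrad : ∀ φ : 𝔼 → ℝ, ContDiff ℝ 1 φ → ∀ y,
      gradient (fun z => φ z + inner ℝ p z) y = p + gradient φ y := fun φ hφ y => by
    refine HasGradientAt.gradient ?_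
    rw [hasGradientAt_iff_hasFDerivAt, add_comm p, map_add]
    exact (hasGradientAt_iff_hasFDerivAt.1
      ((hφ.differentiable one_ne_zero) y).hasGradientAt).add
      (hasGradientAt_iff_hasFDerivAt.1 (gradient_inner_left p y))
  have hcd : ∀ φ : 𝔼 → ℝ, ContDiff ℝ 1 φ → ContDiff ℝ 1 (fun z => φ z + inner ℝ p z) :=
    fun φ hφ => hφ.add (contDiff_const.inner ℝ contDiff_id)
  refine ⟨c, fun y => m y - inner ℝ p y, ?_, ?_, ?_, ?_⟩
  · exact hm.continuousOn.sub (by fun_prop : Continuous fun y : 𝔼 => inner ℝ p y).continuousOn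
  · intro k y hy
    beta_reduce
    rw [hmp k y hy, inner_add_right]; ring
  · intro φ hφ y hy hmax
    rw [← hgrad φ hφ]
    refine hm.visc _ (hcd φ hφ) y hy ?_
    filter_upwards [hmax] with z hz
    linarith
  · intro φ hφ y hy hmin
    rw [← hgrad φ hφ]
    refine hsup _ (hcd φ hφ) y hy ?_
    filter_upwards [hmin] with z hz
    linarith

/-! ### Convexity and coercivity of the effective Hamiltonian. -/

/-- Adding the linear part moves `p` from the equation into the slope at infinity, so that
correctors for different `p` solve inequalities with the same `H` and can be averaged. -/
lemma IsCellSolution.affine_add {Ω : Set 𝔼} {H : 𝔼 → 𝔼 → ℝ} {p : 𝔼} {c : ℝ} {v : 𝔼 → ℝ}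
    (h : IsCellSolution Ω H p c v) :
    IsSub Ω H c (fun y => v y + inner ℝ p y) ∧ QuasiPeriodic Ω p (fun y => v y + inner ℝ p y) ∧
    ∀ φ : 𝔼 → ℝ, ContDiff ℝ 1 φ → ∀ y ∈ closure Ω,
      IsLocalMinOn (fun z => v z + inner ℝ p z - φ z) (closure Ω) y → c ≤ H y (gradient φ y) := by
  have hgrad : ∀ φ : 𝔼 → ℝ, ContDiff ℝ 1 φ → ∀ y,
      p + gradient (fun z => φ z - inner ℝ p z) y = gradient φ y := fun φ hφ y => by
    rw [← eq_sub_iff_add_eq']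
    refine HasGradientAt.gradient ?_
    rw [hasGradientAt_iff_hasFDerivAt, map_sub]
    exact (hasGradientAt_iff_hasFDerivAt.1
      ((hφ.differentiable one_ne_zero) y).hasGradientAt).sub
      (hasGradientAt_iff_hasFDerivAt.1 (gradient_inner_left p y))
  have hcd : ∀ φ : 𝔼 → ℝ, ContDiff ℝ 1 φ → ContDiff ℝ 1 (fun z => φ z - inner ℝ p z) :=
    fun φ hφ => hφ.sub (contDiff_const.inner ℝ contDiff_id)
  refine ⟨⟨?_, ?_⟩, ?_, ?_⟩
  · exact h.continuousOn.add (by fun_prop : Continuous fun y : 𝔼 => inner ℝ p y).continuousOn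
  · intro φ hφ y hy hmax
    rw [← hgrad φ hφ]
    refine h.subsolution _ (hcd φ hφ) y hy ?_
    filter_upwards [hmax] with z hz
    linarith
  · intro k y hy
    beta_reduce
    rw [h.periodic k y hy, inner_add_right]; ring
  · intro φ hφ y hy hmin
    rw [← hgrad φ hφ]
    refine h.supersolution _ (hcd φ hφ) y hy ?_
    filter_upwards [hmin] with z hz
    linarith

lemma effectiveHamiltonian_spec [Nontrivial 𝔼] {Ω : Set 𝔼} (hΩ : IsPerforatedDomain Ω)
    {H : 𝔼 → 𝔼 → ℝ} (hH : IsCellHamiltonian H) (p : 𝔼) :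
    ∃ v, IsCellSolution Ω H p (effectiveHamiltonian Ω H p) v :=
  Classical.epsilon_spec (exists_cellSolution hΩ hH p)

/-- The average of the correctors for `p` and `q` is a subsolution at the averaged level with the
averaged slope; comparison with the corrector of that slope concludes. -/
theorem convexOn_effectiveHamiltonian [Nontrivial 𝔼] {Ω : Set 𝔼} (hΩ : IsPerforatedDomain Ω)
    {H : 𝔼 → 𝔼 → ℝ} (hH : IsCellHamiltonian H) :
    ConvexOn ℝ univ (effectiveHamiltonian Ω H) := by
  refine ⟨convex_univ, fun p _ q _ α β hα hβ hαβ => ?_⟩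
  obtain ⟨v, hv⟩ := effectiveHamiltonian_spec hΩ hH p
  obtain ⟨v', hv'⟩ := effectiveHamiltonian_spec hΩ hH q
  obtain ⟨v'', hv''⟩ := effectiveHamiltonian_spec hΩ hH (α • p + β • q)
  obtain ⟨h1, h1p, -⟩ := hv.affine_add
  obtain ⟨h2, h2p, -⟩ := hv'.affine_add
  obtain ⟨h3, h3p, h3s⟩ := hv''.affine_add
  refine level_le_of_super hΩ hH
    (w := fun y => α * (v y + inner ℝ p y) + β * (v' y + inner ℝ q y)) ⟨?_, ?_⟩ ?_
    h3.continuousOn h3p h3s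
  · exact (continuousOn_const.mul h1.continuousOn).add (continuousOn_const.mul h2.continuousOn)
  · exact ViscSubOn.convexCombination hH hΩ.isOpen hα hβ hαβ
      (h1.continuousOn.mono subset_closure) (h2.continuousOn.mono subset_closure) h1.visc h2.visc
  · intro k y hy
    have e1 := h1p k y hy
    have e2 := h2p k y hy
    beta_reduce at e1 e2 ⊢
    rw [e1, e2, inner_add_left, inner_smul_left, inner_smul_left]
    simp only [conj_trivial]
    ring

/-- At level at most `M` the Lipschitz constant along segments is controlled by the coercivity of
`H` alone. Increments over the basis lattice vectors are then bounded, and they are exactly the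
coordinates of `p`. -/
theorem coercive_effectiveHamiltonian [Nontrivial 𝔼] {Ω : Set 𝔼} (hΩ : IsPerforatedDomain Ω)
    {H : 𝔼 → 𝔼 → ℝ} (hH : IsCellHamiltonian H) (M : ℝ) :
    ∃ R : ℝ, ∀ p, effectiveHamiltonian Ω H p ≤ M → ‖p‖ ≤ R := by
  obtain ⟨y, hy⟩ := hΩ.isConnected.nonempty.closure
  obtain ⟨R, hR⟩ := hH.coer M
  have hch : ∀ i : Fin n, ∃ C ≥ 0, ∀ R ≥ 0, ∀ w, ContinuousOn w (closure Ω) →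
      SegLipschitz Ω R w → |w (y + lattice (Pi.single i 1)) - w y| ≤ C * R := fun i =>
    hΩ.exists_chain_bound hy ((hΩ.add_lattice_mem_closure _ y).2 hy)
  choose C hC hCw using hch
  refine ⟨∑ i, C i * |R|, fun p hp => ?_⟩
  obtain ⟨v, hv⟩ := effectiveHamiltonian_spec hΩ hH p
  obtain ⟨h1, h1p, -⟩ := hv.affine_add
  have hseg : SegLipschitz Ω |R| (fun y => v y + inner ℝ p y) :=
    (h1.mono hp).segLipschitz hΩ.isOpen fun y q hq => (hR y q hq).trans (le_abs_self _)
  have hcoord : ∀ i, |p i| ≤ C i * |R| := fun i => by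
    have h2 := hCw i |R| (abs_nonneg _) _ h1.continuousOn hseg
    have h3 := h1p (Pi.single i 1) y hy
    beta_reduce at h2 h3
    rw [h3, add_sub_cancel_left] at h2
    have h4 : lattice (Pi.single i 1 : Fin n → ℤ) = EuclideanSpace.single i (1 : ℝ) := by
      ext j
      by_cases hj : j = i
      · subst hj; simp [lattice]
      · simp [lattice, hj]
    rwa [h4, EuclideanSpace.inner_single_right, one_mul, conj_trivial] at h2
  calc ‖p‖ = ‖∑ i, p i • EuclideanSpace.single i (1 : ℝ)‖ := by
        congr 1
        have := (EuclideanSpace.basisFun (Fin n) ℝ).sum_repr p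
        simpa using this.symm
    _ ≤ ∑ i, ‖p i • EuclideanSpace.single i (1 : ℝ)‖ := norm_sum_le _ _
    _ ≤ ∑ i, C i * |R| := Finset.sum_le_sum fun i _ => by
        rw [norm_smul]; simpa using hcoord i

lemma IsCellHamiltonian.of_tendsto {H : 𝔼 → 𝔼 → ℝ} (hcont : Continuous (Function.uncurry H))
    (hper : ∀ (k : Fin n → ℤ) (y p : 𝔼), H (y + lattice k) p = H y p)
    (hcoer : Tendsto (fun p : 𝔼 => ⨅ y : 𝔼, H y p) (cocompact 𝔼) atTop)
    (hconv : ∀ y : 𝔼, ConvexOn ℝ univ (H y)) : IsCellHamiltonian H := by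
  refine ⟨hcont, hper, fun c => ?_, hconv⟩
  have h1 := hcoer.eventually (eventually_gt_atTop c)
  rw [Metric.cobounded_eq_cocompact.symm, Filter.Eventually,
    ← Bornology.isCobounded_def, ← Bornology.isBounded_compl_iff] at h1
  obtain ⟨R, hR⟩ := h1.exists_norm_le
  refine ⟨R, fun y q hq => hR q ?_⟩
  -- The real `⨅` is a genuine lower bound only for a range bounded below, which periodicity and
  -- compactness of the cube supply.
  have hbdd : BddBelow (range fun y => H y q) := by
    obtain ⟨C, hC⟩ := (isCompact_unitCube (n := n)).exists_bound_of_continuousOn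
      (f := fun y => H y q) (hcont.comp (f := fun y => (y, q)) (by fun_prop)).continuousOn
    refine ⟨-C, ?_⟩
    rintro _ ⟨y, rfl⟩
    obtain ⟨k, hk⟩ := exists_add_lattice_mem_unitCube y
    beta_reduce
    rw [← hper k]
    exact neg_le_of_abs_le (hC _ hk)
  exact not_lt.2 ((ciInf_le hbdd y).trans hq)

/-! ### The value function: dynamic programming and Lipschitz bounds. -/

/-- `ℓ` bounds the Legendre transform of `F` at `v` from above. -/
def Admissible (F : 𝔼 → ℝ) (v : 𝔼) (ℓ : ℝ) : Prop := ∀ p, inner ℝ p v - F p ≤ ℓ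

/-- Standing assumptions on the data of the limit problem. -/
structure IsLimitData (F B g : 𝔼 → ℝ) : Prop where
  conv : ConvexOn ℝ univ F
  coer : ∀ M : ℝ, ∃ R : ℝ, ∀ p, F p ≤ M → ‖p‖ ≤ R
  cont : Continuous B
  bdd : ∃ C, ∀ x, |B x| ≤ C
  bdd_init : ∃ C, ∀ x, |g x| ≤ C
  lip : ∃ K ≥ 0, ∀ x y, g x - g y ≤ K * ‖x - y‖
  le : ∀ x, g x ≤ B x

/-- The costs of straight trajectories stopped at time `τ < t`. -/
def costSet (F B g : 𝔼 → ℝ) (x : 𝔼) (t : ℝ) : Set ℝ :=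
  {r | ∃ τ v ℓ, 0 ≤ τ ∧ τ < t ∧ Admissible F v ℓ ∧
    r = (t - τ) * ℓ + terminalCost g B (x - (t - τ) • v) τ}

open Classical in
/-- The value function, extended by the initial datum to nonpositive times. -/
noncomputable def value (F B g : 𝔼 → ℝ) (x : 𝔼) (t : ℝ) : ℝ :=
  if t ≤ 0 then g x else sInf (costSet F B g x t)

lemma Admissible.neg_le {F : 𝔼 → ℝ} {v : 𝔼} {ℓ : ℝ} (h : Admissible F v ℓ) : -F 0 ≤ ℓ := by
  simpa using h 0

lemma Admissible.convexCombination {F : 𝔼 → ℝ} {v v' : 𝔼} {ℓ ℓ' α β : ℝ} (h : Admissible F v ℓ)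
    (h' : Admissible F v' ℓ') (hα : 0 ≤ α) (hβ : 0 ≤ β) (hαβ : α + β = 1) :
    Admissible F (α • v + β • v') (α * ℓ + β * ℓ') := by
  intro p
  have h1 := mul_le_mul_of_nonneg_left (h p) hα
  have h2 := mul_le_mul_of_nonneg_left (h' p) hβ
  rw [inner_add_right, inner_smul_right, inner_smul_right]
  obtain rfl : β = 1 - α := by linarith
  linarith

/-- Superlinearity of L: F is finite, hence bounded on the ball of radius `R`, and `p = (R / ‖v‖) •
v` is a competitor. -/
lemma exists_admissible_lower {F : 𝔼 → ℝ} (hF : ConvexOn ℝ univ F) (R : ℝ) (hR : 0 ≤ R) :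
    ∃ C ≥ 0, ∀ v ℓ, Admissible F v ℓ → R * ‖v‖ - C ≤ ℓ := by
  obtain ⟨C, hC⟩ := (isCompact_closedBall (0 : 𝔼) R).exists_bound_of_continuousOn
    hF.continuous_of_univ.continuousOn
  refine ⟨|C|, abs_nonneg _, fun v ℓ h => ?_⟩
  rcases eq_or_ne v 0 with rfl | hv
  · have h1 := hC 0 (by simpa using hR)
    have h2 := h.neg_le
    simp only [norm_zero, mul_zero, zero_sub]
    linarith [le_abs_self (F 0), le_abs_self C, h1, Real.norm_eq_abs (F 0)]
  · have hv0 : 0 < ‖v‖ := norm_pos_iff.2 hv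
    have h1 := hC ((R / ‖v‖) • v) (by
      rw [mem_closedBall_zero_iff, norm_smul, Real.norm_eq_abs, abs_of_nonneg (by positivity),
        div_mul_cancel₀ _ hv0.ne'])
    have h2 := h ((R / ‖v‖) • v)
    rw [real_inner_smul_left, real_inner_self_eq_norm_sq] at h2
    have h3 : R / ‖v‖ * ‖v‖ ^ 2 = R * ‖v‖ := by field_simp
    rw [h3] at h2
    linarith [(le_abs_self _).trans (h1.trans (le_abs_self C))]

/-- Dual to the linear growth of F: slow velocities have bounded cost. -/
lemma IsLimitData.exists_admissible_ball {F B g : 𝔼 → ℝ} (hd : IsLimitData F B g) :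
    ∃ a > 0, ∃ C ≥ 0, ∀ v, ‖v‖ ≤ a → Admissible F v C := by
  obtain ⟨a, ha, C, hC, h⟩ := exists_linear_growth hd.conv hd.coer
  refine ⟨a, ha, C, hC, fun v hv p => ?_⟩
  have h1 := real_inner_le_norm p v
  have h2 : ‖p‖ * ‖v‖ ≤ ‖p‖ * a := by gcongr
  linarith [h p]

lemma IsLimitData.init_le_terminalCost {F B g : 𝔼 → ℝ} (hd : IsLimitData F B g) (x : 𝔼) (τ : ℝ) :
    g x ≤ terminalCost g B x τ := by
  unfold terminalCost; split_ifs
  · exact le_rfl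
  · exact hd.le x

lemma IsLimitData.exists_cost_lower {F B g : 𝔼 → ℝ} (hd : IsLimitData F B g) :
    ∃ C ≥ 0, ∀ x t, ∀ r ∈ costSet F B g x t, -(C + C * t) ≤ r := by
  obtain ⟨C, hC⟩ := hd.bdd_init
  have hC0 : 0 ≤ C := (abs_nonneg _).trans (hC 0)
  refine ⟨C + |F 0|, by positivity, ?_⟩
  rintro x t r ⟨τ, v, ℓ, hτ, hτt, hadm, rfl⟩
  have h1 := hadm.neg_le
  have h2 := (neg_le_of_abs_le (hC (x - (t - τ) • v))).trans (hd.init_le_terminalCost _ τ)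
  have h3 : (t - τ) * (-|F 0|) ≤ (t - τ) * ℓ := by
    apply mul_le_mul_of_nonneg_left _ (by linarith)
    linarith [le_abs_self (F 0)]
  have h4 : (t - τ) * |F 0| ≤ t * |F 0| := by gcongr; linarith
  have h5 : 0 ≤ C * t := mul_nonneg hC0 (by linarith)
  linarith [abs_nonneg (F 0)]

lemma value_zero {F B g : 𝔼 → ℝ} {t : ℝ} (ht : t ≤ 0) (x : 𝔼) : value F B g x t = g x := if_pos ht

lemma value_pos {F B g : 𝔼 → ℝ} {t : ℝ} (ht : 0 < t) (x : 𝔼) :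
    value F B g x t = sInf (costSet F B g x t) := if_neg (not_le.2 ht)

lemma IsLimitData.bddBelow_costSet {F B g : 𝔼 → ℝ} (hd : IsLimitData F B g) (x : 𝔼) (t : ℝ) :
    BddBelow (costSet F B g x t) := by
  obtain ⟨C, -, h⟩ := hd.exists_cost_lower
  exact ⟨_, fun r hr => h x t r hr⟩

lemma IsLimitData.costSet_nonempty {F B g : 𝔼 → ℝ} (hd : IsLimitData F B g) (x : 𝔼) {t : ℝ}
    (ht : 0 < t) : (costSet F B g x t).Nonempty := by
  obtain ⟨a, ha, C, hC, h⟩ := hd.exists_admissible_ball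
  exact ⟨_, 0, 0, C, le_rfl, ht, h 0 (by simpa using ha.le), rfl⟩

lemma IsLimitData.value_le_cost {F B g : 𝔼 → ℝ} (hd : IsLimitData F B g) {x : 𝔼} {t r : ℝ}
    (ht : 0 < t) (hr : r ∈ costSet F B g x t) : value F B g x t ≤ r := by
  rw [value_pos ht]
  exact csInf_le (hd.bddBelow_costSet x t) hr

lemma IsLimitData.le_value {F B g : 𝔼 → ℝ} (hd : IsLimitData F B g) {x : 𝔼} {t a : ℝ}
    (ht : 0 < t) (h : ∀ r ∈ costSet F B g x t, a ≤ r) : a ≤ value F B g x t := by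
  rw [value_pos ht]
  exact le_csInf (hd.costSet_nonempty x ht) h

lemma IsLimitData.value_le_init_add {F B g : 𝔼 → ℝ} (hd : IsLimitData F B g) (x : 𝔼) {t : ℝ}
    (ht : 0 ≤ t) {v : 𝔼} {ℓ : ℝ} (h : Admissible F v ℓ) :
    value F B g x t ≤ g (x - t • v) + t * ℓ := by
  rcases ht.eq_or_lt with rfl | ht
  · simp [value_zero]
  · refine hd.value_le_cost ht ⟨0, v, ℓ, le_rfl, ht, h, ?_⟩
    simp [terminalCost]; ring

/-- Dynamic programming inequality. -/
lemma IsLimitData.value_le_add {F B g : 𝔼 → ℝ} (hd : IsLimitData F B g) (x : 𝔼) {s t : ℝ}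
    (hs : 0 ≤ s) (hst : s ≤ t) {v : 𝔼} {ℓ : ℝ} (h : Admissible F v ℓ) :
    value F B g x t ≤ value F B g (x - s • v) (t - s) + s * ℓ := by
  rcases hst.eq_or_lt with rfl | hst
  · rw [sub_self, value_zero le_rfl]
    exact hd.value_le_init_add x hs h
  have ht : 0 < t := by linarith
  rw [← sub_le_iff_le_add]
  refine hd.le_value (by linarith) ?_
  rintro r ⟨τ, v', ℓ', hτ, hτt, h', rfl⟩
  rw [sub_le_iff_le_add]
  have hpos : 0 < t - τ := by linarith
  have hα : 0 ≤ s / (t - τ) := by positivity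
  have hβ : 0 ≤ (t - s - τ) / (t - τ) := div_nonneg (by linarith) hpos.le
  -- Jensen: the straight path with the averaged velocity has the same endpoints and stopping time
  -- as the broken path, and an admissible running cost equal to that of the broken path.
  refine hd.value_le_cost ht ⟨τ, _, _, hτ, by linarith,
    h.convexCombination h' hα hβ (by field_simp; ring), ?_⟩
  have e1 : (t - τ) • ((s / (t - τ)) • v + ((t - s - τ) / (t - τ)) • v') =
      s • v + (t - s - τ) • v' := by
    rw [smul_add, smul_smul, smul_smul, mul_div_cancel₀ _ hpos.ne', mul_div_cancel₀ _ hpos.ne']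
  rw [e1, sub_add_eq_sub_sub]
  have e2 : (t - τ) * (s / (t - τ) * ℓ + (t - s - τ) / (t - τ) * ℓ') =
      s * ℓ + (t - s - τ) * ℓ' := by field_simp
  rw [e2]; ring

/-- Standing still and stopping almost at once costs `B x` up to an arbitrarily small amount. -/
lemma IsLimitData.value_le_obstacle {F B g : 𝔼 → ℝ} (hd : IsLimitData F B g) (x : 𝔼) (t : ℝ) :
    value F B g x t ≤ B x := by
  rcases le_or_gt t 0 with ht | ht
  · rw [value_zero ht]; exact hd.le x
  obtain ⟨a, ha, C, hC, h⟩ := hd.exists_admissible_ball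
  refine le_of_forall_pos_le_add fun ε hε => ?_
  set s := min (t / 2) (ε / (C + 1)) with hs
  have hs0 : 0 < s := by positivity
  have hst : s ≤ t / 2 := min_le_left _ _
  have hsε : s * C ≤ ε := by
    have : s ≤ ε / (C + 1) := min_le_right _ _
    rw [le_div_iff₀ (by positivity)] at this
    linarith
  have := hd.value_le_cost (x := x) ht ⟨t - s, 0, C, by linarith, by linarith,
    h 0 (by simpa using ha.le), rfl⟩
  simp only [sub_sub_cancel, smul_zero, sub_zero, terminalCost,
    if_neg (show t - s ≠ 0 by linarith)] at this
  linarith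

/-- The value function does not decrease in time faster than linearly. -/
lemma IsLimitData.exists_value_time_lower {F B g : 𝔼 → ℝ} (hd : IsLimitData F B g) :
    ∃ C ≥ 0, ∀ x t h, 0 ≤ t → 0 ≤ h → value F B g x t - C * h ≤ value F B g x (t + h) := by
  obtain ⟨K, hK, hlip⟩ := hd.lip
  -- The growth rate is taken equal to the Lipschitz constant of `g`. A path stopped after time `h`
  -- is shifted in time; one stopped earlier is shortened to start at time 0, and the resulting
  -- displacement `(h - τ) • v` changes `g` by at most what the running cost saves, up to `C * h`.
  obtain ⟨C, hC, hlow⟩ := exists_admissible_lower hd.conv K hK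
  refine ⟨C, hC, fun x t h ht hh => ?_⟩
  rcases hh.eq_or_lt with rfl | hh
  · simp
  refine hd.le_value (by linarith) ?_
  rintro r ⟨τ, v, ℓ, hτ, hτt, hadm, rfl⟩
  rcases lt_or_ge h τ with hcase | hcase
  · have h1 := hd.value_le_cost (x := x) (t := t) (by linarith)
      ⟨τ - h, v, ℓ, by linarith, by linarith, hadm, rfl⟩
    have e : t - (τ - h) = t + h - τ := by ring
    rw [e] at h1
    simp only [terminalCost, if_neg (show τ - h ≠ 0 by linarith)] at h1
    simp only [terminalCost, if_neg (show τ ≠ 0 by linarith)]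
    have : 0 ≤ C * h := by positivity
    linarith
  · have h1 := hd.value_le_init_add x ht hadm
    have h2 := hd.init_le_terminalCost (x - (t + h - τ) • v) τ
    have h3 := hlip (x - t • v) (x - (t + h - τ) • v)
    have e : x - t • v - (x - (t + h - τ) • v) = (h - τ) • v := by module
    rw [e, norm_smul, Real.norm_eq_abs, abs_of_nonneg (by linarith)] at h3
    have h4 := mul_le_mul_of_nonneg_left (hlow v ℓ hadm) (sub_nonneg.2 hcase)
    have h5 : (h - τ) * C ≤ C * h := by nlinarith
    nlinarith

/-- The value function is globally Lipschitz. -/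
lemma IsLimitData.exists_value_lipschitz {F B g : 𝔼 → ℝ} (hd : IsLimitData F B g) :
    ∃ K ≥ 0, ∀ x y t s, |value F B g x t - value F B g y s| ≤ K * (‖x - y‖ + |t - s|) := by
  obtain ⟨a, ha, C, hC, hball⟩ := hd.exists_admissible_ball
  obtain ⟨C', hC', hlow⟩ := hd.exists_value_time_lower
  obtain ⟨K, hK, hlip⟩ := hd.lip
  set K' := K + (C + C') / a + C + C' with hK'
  have hCa : 0 ≤ (C + C') / a := by positivity
  have hspace : ∀ x y t, value F B g x t - value F B g y t ≤ K' * ‖x - y‖ := by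
    intro x y t
    have hKK : K * ‖x - y‖ ≤ K' * ‖x - y‖ := by gcongr; linarith
    rcases le_or_gt t 0 with ht | ht
    · rw [value_zero ht, value_zero ht]; exact (hlip x y).trans hKK
    -- Time to travel between `x` and `y` at the cheap speed `a`. The lost time is paid for by
    -- `hlow`; if it exceeds `t`, both values are compared with the initial datum.
    set s := ‖x - y‖ / a with hs
    have hs0 : 0 ≤ s := by positivity
    have hsC : (C + C') * s + K * ‖x - y‖ ≤ K' * ‖x - y‖ := by
      have : (C + C') * s = (C + C') / a * ‖x - y‖ := by rw [hs]; ring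
      have h2 : 0 ≤ (C + C') * ‖x - y‖ := by positivity
      rw [this, hK']
      linarith
    have hKn : 0 ≤ K * ‖x - y‖ := by positivity
    rcases le_or_gt s t with hst | hst
    · rcases hs0.eq_or_lt with h0 | h0
      · have : ‖x - y‖ = 0 := by
          rw [eq_comm, hs, div_eq_zero_iff] at h0
          exact h0.resolve_right ha.ne'
        rw [norm_eq_zero, sub_eq_zero] at this
        subst this
        simp
      · have hv : ‖s⁻¹ • (x - y)‖ ≤ a := by
          rw [norm_smul, Real.norm_eq_abs, abs_of_pos (by positivity), hs, inv_div]
          rcases eq_or_ne ‖x - y‖ 0 with h | h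
          · rw [h]; simpa using ha.le
          · rw [div_mul_cancel₀ _ h]
        have h1 := hd.value_le_add x hs0 hst (hball _ hv)
        rw [smul_inv_smul₀ h0.ne', sub_sub_cancel] at h1
        have h2 := hlow y (t - s) s (by linarith) hs0
        rw [sub_add_cancel] at h2
        linarith
    · have h1 := hd.value_le_init_add x ht.le (hball 0 (by simpa using ha.le))
      have h2 := hlow y 0 t le_rfl ht.le
      rw [zero_add, value_zero le_rfl] at h2
      rw [smul_zero, sub_zero] at h1
      have h3 := hlip x y
      have h4 : (C + C') * t ≤ (C + C') * s := by gcongr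
      linarith
  have htime : ∀ x t s, s ≤ t → |value F B g x t - value F B g x s| ≤ (C + C') * (t - s) := by
    have hmain : ∀ x t s, 0 ≤ s → s ≤ t →
        |value F B g x t - value F B g x s| ≤ (C + C') * (t - s) := by
      intro x t s hs hst
      have h1 := hd.value_le_add x (sub_nonneg.2 hst) (by linarith : t - s ≤ t)
        (hball 0 (by simpa using ha.le))
      rw [smul_zero, sub_zero, sub_sub_cancel] at h1
      have h2 := hlow x s (t - s) hs (by linarith)
      rw [add_sub_cancel] at h2
      have h3 : 0 ≤ C * (t - s) := mul_nonneg hC (by linarith)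
      have h4 : 0 ≤ C' * (t - s) := mul_nonneg hC' (by linarith)
      rw [abs_le]
      constructor <;> linarith
    intro x t s hst
    rcases le_or_gt 0 s with hs | hs
    · exact hmain x t s hs hst
    rcases le_or_gt t 0 with ht | ht
    · rw [value_zero ht, value_zero hs.le, sub_self, abs_zero]
      exact mul_nonneg (by positivity) (by linarith)
    · have h1 := hmain x t 0 le_rfl ht.le
      rw [value_zero le_rfl] at h1
      rw [value_zero hs.le]
      refine h1.trans ?_
      gcongr
  refine ⟨K', by positivity, fun x y t s => ?_⟩
  have h1 : |value F B g x t - value F B g y t| ≤ K' * ‖x - y‖ := by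
    have h2 := hspace y x t
    rw [norm_sub_rev] at h2
    rw [abs_le]
    constructor <;> linarith [hspace x y t]
  have h2 : |value F B g y t - value F B g y s| ≤ K' * |t - s| := by
    have h3 : |value F B g y t - value F B g y s| ≤ (C + C') * |t - s| := by
      rcases le_total s t with h | h
      · rw [abs_of_nonneg (sub_nonneg.2 h)]; exact htime y t s h
      · rw [abs_sub_comm, abs_sub_comm t, abs_of_nonneg (sub_nonneg.2 h)]; exact htime y s t h
    refine h3.trans ?_
    gcongr
    linarith
  calc _ ≤ |value F B g x t - value F B g y t| + |value F B g y t - value F B g y s| :=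
        abs_sub_le _ _ _
    _ ≤ _ := by linarith

lemma IsLimitData.exists_value_bound {F B g : 𝔼 → ℝ} (hd : IsLimitData F B g) (T : ℝ) :
    ∃ C, ∀ x, ∀ t ∈ Icc 0 T, |value F B g x t| ≤ C := by
  obtain ⟨C, hC, hlow⟩ := hd.exists_cost_lower
  obtain ⟨CB, hCB⟩ := hd.bdd
  obtain ⟨Cg, hCg⟩ := hd.bdd_init
  have hCB0 : 0 ≤ CB := (abs_nonneg _).trans (hCB 0)
  have hCg0 : 0 ≤ Cg := (abs_nonneg _).trans (hCg 0)
  refine ⟨CB + Cg + (C + C * T), fun x t ht => ?_⟩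
  have hT : 0 ≤ C * T := mul_nonneg hC (ht.1.trans ht.2)
  rw [abs_le]
  constructor
  · rcases ht.1.eq_or_lt with h | h
    · rw [← h, value_zero le_rfl]
      linarith [neg_le_of_abs_le (hCg x)]
    · have h1 := hd.le_value h (hlow x t)
      have h2 : C * t ≤ C * T := mul_le_mul_of_nonneg_left ht.2 hC
      linarith
  · linarith [hd.value_le_obstacle x t, (le_abs_self _).trans (hCB x)]

/-! ### The value function is a viscosity solution. -/

lemma fderiv_uncurry_apply {φ : 𝔼 → ℝ → ℝ} {x : 𝔼} {t : ℝ}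
    (h : DifferentiableAt ℝ (Function.uncurry φ) (x, t)) (v : 𝔼) (s : ℝ) :
    fderiv ℝ (Function.uncurry φ) (x, t) (v, s) =
      inner ℝ (gradient (fun y => φ y t) x) v + s * deriv (fun r => φ x r) t := by
  have h1 : HasFDerivAt (fun y => φ y t)
      ((fderiv ℝ (Function.uncurry φ) (x, t)).comp (ContinuousLinearMap.inl ℝ 𝔼 ℝ)) x :=
    HasFDerivAt.comp (g := Function.uncurry φ) (f := fun y => (y, t)) x h.hasFDerivAt
      (hasFDerivAt_prodMk_left x t)
  have h2 : HasDerivAt (fun r => φ x r) (fderiv ℝ (Function.uncurry φ) (x, t) (0, 1)) t :=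
    h.hasFDerivAt.comp_hasDerivAt t ((hasDerivAt_const t x).prodMk (hasDerivAt_id t))
  rw [inner_gradient_left, h1.fderiv, h2.deriv]
  have e : ((v, s) : 𝔼 × ℝ) = (v, 0) + s • (0, 1) := by simp
  rw [e, map_add, map_smul]
  simp

lemma differentiableAt_of_contDiffOn {φ : 𝔼 → ℝ → ℝ}
    (hφ : ContDiffOn ℝ 1 (Function.uncurry φ) (univ ×ˢ Ioi 0)) (x : 𝔼) {t : ℝ} (ht : 0 < t) :
    DifferentiableAt ℝ (Function.uncurry φ) (x, t) :=
  (hφ.contDiffAt ((isOpen_univ.prod isOpen_Ioi).mem_nhds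
    (show (x, t) ∈ univ ×ˢ Ioi 0 from ⟨mem_univ _, ht⟩))).differentiableAt one_ne_zero

/-- If all linear inequalities given by admissible velocities hold, so does the Hamilton–Jacobi
inequality. -/
lemma add_le_zero_of_admissible {F : 𝔼 → ℝ} (hF : ConvexOn ℝ univ F) {a : ℝ} {p : 𝔼}
    (h : ∀ v ℓ, Admissible F v ℓ → inner ℝ p v + a ≤ ℓ) : a + F p ≤ 0 := by
  refine le_of_forall_pos_le_add fun δ hδ => ?_
  obtain ⟨v, hv⟩ := exists_approx_subgradient hF p hδ
  have := h v (inner ℝ p v - F p + δ) fun q => by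
    have h1 := hv q
    rw [inner_sub_right, real_inner_comm, real_inner_comm p] at h1
    linarith
  linarith

lemma IsLimitData.value_subsolution {F B g : 𝔼 → ℝ} (hd : IsLimitData F B g) {φ : 𝔼 → ℝ → ℝ}
    (hφ : ContDiffOn ℝ 1 (Function.uncurry φ) (univ ×ˢ Ioi 0)) {x : 𝔼} {t : ℝ} (ht : 0 < t)
    (hm : IsLocalMax (fun z : 𝔼 × ℝ => value F B g z.1 z.2 - φ z.1 z.2) (x, t)) :
    max (value F B g x t - B x)
      (deriv (fun s => φ x s) t + F (gradient (fun y => φ y t) x)) ≤ 0 := by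
  have hdiff := differentiableAt_of_contDiffOn hφ x ht
  refine max_le (by linarith [hd.value_le_obstacle x t])
    (add_le_zero_of_admissible hd.conv fun v ℓ hadm => ?_)
  have := fderiv_le_of_isLocalMax (w := fun z : 𝔼 × ℝ => value F B g z.1 z.2) (ξ := (v, 1))
    (b := ℓ) hdiff hm ?_
  · rw [fderiv_uncurry_apply hdiff, one_mul] at this
    exact this
  · filter_upwards [Ioo_mem_nhdsGT ht] with s hs
    simpa using hd.value_le_add x hs.1.le hs.2.le hadm

lemma IsLimitData.value_supersolution {F B g : 𝔼 → ℝ} (hd : IsLimitData F B g) {φ : 𝔼 → ℝ → ℝ}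
    (hφ : ContDiffOn ℝ 1 (Function.uncurry φ) (univ ×ˢ Ioi 0)) {x : 𝔼} {t : ℝ} (ht : 0 < t)
    (hm : IsLocalMin (fun z : 𝔼 × ℝ => value F B g z.1 z.2 - φ z.1 z.2) (x, t)) :
    0 ≤ max (value F B g x t - B x)
      (deriv (fun s => φ x s) t + F (gradient (fun y => φ y t) x)) := by
  have hdiff := differentiableAt_of_contDiffOn hφ x ht
  rcases le_or_gt (B x) (value F B g x t) with hB | hB
  · exact le_max_of_le_left (sub_nonneg.2 hB)
  refine le_max_of_le_right (le_of_forall_pos_le_add fun ε' hε' => ?_)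
  set V := value F B g with hV
  set p := gradient (fun y => φ y t) x with hp
  set a := deriv (fun s => φ x s) t with ha
  obtain ⟨β, hβ, hβV⟩ : ∃ β > 0, V x t + 4 * β = B x := ⟨(B x - V x t) / 4, by linarith, by ring⟩
  obtain ⟨ρ, hρ, hρB⟩ : ∃ ρ > 0, ∀ y, dist y x < ρ → B x - β < B y :=
    Metric.eventually_nhds_iff.1 (hd.cont.continuousAt.eventually (lt_mem_nhds (by linarith)))
  obtain ⟨CB, hCB⟩ := hd.bdd
  have hCB0 : 0 ≤ CB := (abs_nonneg _).trans (hCB 0)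
  -- With this growth rate, a nearly optimal path stopped within a short time cannot travel as far
  -- as `ρ`. It would therefore pay at least `B x - β` on stopping, too much since `V x t = B x - 4
  -- * β`.
  set R := (|V x t| + CB + 3) / ρ with hR
  have hR0 : 0 < R := by positivity
  obtain ⟨CR, hCR, hlowR⟩ := exists_admissible_lower hd.conv R hR0.le
  obtain ⟨K, hK, hLip⟩ := hd.exists_value_lipschitz
  obtain ⟨C₁, hC₁, hlow₁⟩ := exists_admissible_lower hd.conv (K + 1) (by positivity)
  set M := K + C₁ + 1 with hM
  have hM0 : 0 < M := by positivity
  set ε := ε' / (M + 2) with hε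
  have hε0 : 0 < ε := by positivity
  obtain ⟨d₁, hd₁, hφd⟩ := Metric.eventually_nhds_iff.1
    (hdiff.hasFDerivAt.isLittleO.def hε0)
  obtain ⟨d₂, hd₂, hmd⟩ := Metric.eventually_nhds_iff.1 hm
  obtain ⟨h, hh0, hht, hh1, hhβ, hhC1, hhCβ, hhd₁, hhd₂, hhε⟩ : ∃ h : ℝ, 0 < h ∧ h < t ∧ h < 1 ∧
      h < β ∧ h * CR < 1 ∧ h * CR < β ∧ h * (M + 1) < d₁ ∧ h * (M + 1) < d₂ ∧ h < ε := by
    have hl : ∀ c d : ℝ, 0 < d → ∀ᶠ h : ℝ in 𝓝[>] 0, h * c < d := fun c d hd => by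
      have : ContinuousAt (fun h : ℝ => h * c) 0 := by fun_prop
      exact (this.eventually (gt_mem_nhds (by simpa using hd))).filter_mono nhdsWithin_le_nhds
    have hl' : ∀ d : ℝ, 0 < d → ∀ᶠ h : ℝ in 𝓝[>] 0, h < d := fun d hd => by
      simpa using hl 1 d hd
    have h0 : ∀ᶠ h : ℝ in 𝓝[>] 0, 0 < h := self_mem_nhdsWithin
    exact (h0.and ((hl' t ht).and ((hl' 1 one_pos).and ((hl' β hβ).and
      ((hl CR 1 one_pos).and ((hl CR β hβ).and ((hl _ d₁ hd₁).and ((hl _ d₂ hd₂).and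
        (hl' ε hε0))))))))).exists
  have hhsq : h ^ 2 < β := by nlinarith
  have hhsq1 : h ^ 2 < 1 := by nlinarith
  -- The optimality error `h ^ 2` still vanishes after division by `h`.
  obtain ⟨r, hr, hrlt⟩ := exists_lt_of_csInf_lt (hd.costSet_nonempty x ht)
    (show sInf (costSet F B g x t) < V x t + h ^ 2 by
      rw [hV, value_pos ht]; linarith [sq_pos_of_pos hh0])
  obtain ⟨τ, v, ℓ, hτ, hτt, hadm, rfl⟩ := hr
  rcases le_or_gt (t - τ) h with hcase | hcase
  · exfalso
    have hs0 : 0 < t - τ := by linarith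
    simp only [terminalCost, if_neg (show τ ≠ 0 by linarith)] at hrlt
    have h1 := mul_le_mul_of_nonneg_left (hlowR v ℓ hadm) hs0.le
    have h2 : (t - τ) * CR ≤ h * CR := by gcongr
    have h3 : R * ((t - τ) * ‖v‖) < R * ρ := by
      have e : R * ρ = |V x t| + CB + 3 := by rw [hR]; field_simp
      rw [e]
      have := neg_le_of_abs_le (hCB (x - (t - τ) • v))
      linarith [le_abs_self (V x t)]
    have h4 : (t - τ) * ‖v‖ < ρ := lt_of_mul_lt_mul_left h3 hR0.le
    have h5 := hρB (x - (t - τ) • v) (by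
      rw [dist_eq_norm, sub_sub_cancel_left, norm_neg, norm_smul, Real.norm_eq_abs,
        abs_of_pos hs0]
      exact h4)
    have h6 : 0 ≤ (t - τ) * (R * ‖v‖) := by positivity
    linarith
  · have hDPP : V (x - h • v) (t - h) + h * ℓ ≤
        (t - τ) * ℓ + terminalCost g B (x - (t - τ) • v) τ := by
      have h1 := hd.value_le_cost (x := x - h • v) (t := t - h) (by linarith)
        ⟨τ, v, ℓ, hτ, by linarith, hadm, rfl⟩
      have e : x - h • v - (t - h - τ) • v = x - (t - τ) • v := by module
      rw [e] at h1
      rw [hV]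
      linarith
    -- Along the path V drops at a rate at most `K * (‖v‖ + 1)`, while the cost grows at rate `K +
    -- 1` in `‖v‖`; near-optimality bounds the speed independently of `h`.
    have hvM : ‖v‖ ≤ M := by
      have h1 := (abs_le.1 (hLip x (x - h • v) t (t - h))).2
      rw [sub_sub_cancel, sub_sub_cancel, norm_smul, Real.norm_eq_abs, abs_of_pos hh0] at h1
      have h2 := mul_le_mul_of_nonneg_left (hlow₁ v ℓ hadm) hh0.le
      have h3 : h * (‖v‖ - K - C₁) ≤ h * h := by nlinarith
      have h4 := le_of_mul_le_mul_left h3 hh0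
      linarith
    have hz : ((x - h • v, t - h) : 𝔼 × ℝ) - (x, t) = -(h • (v, 1)) := by
      ext1 <;> simp
    have hnorm : ‖((x - h • v, t - h) : 𝔼 × ℝ) - (x, t)‖ ≤ h * (M + 1) := by
      rw [hz, norm_neg, norm_smul, Real.norm_eq_abs, abs_of_pos hh0]
      gcongr
      rw [Prod.norm_mk]
      exact max_le (by linarith) (by simp; linarith)
    have h1 := @hφd (x - h • v, t - h) (by rw [dist_eq_norm]; linarith)
    have h2 : V x t - φ x t ≤ V (x - h • v) (t - h) - φ (x - h • v) (t - h) :=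
      @hmd (x - h • v, t - h) (by rw [dist_eq_norm]; linarith)
    have h3 : ε * ‖((x - h • v, t - h) : 𝔼 × ℝ) - (x, t)‖ ≤ ε * (h * (M + 1)) := by gcongr
    rw [hz, map_neg, map_smul, fderiv_uncurry_apply hdiff, ← hp, ← ha, smul_eq_mul, one_mul,
      ← hz] at h1
    simp only [Function.uncurry_apply_pair] at h1
    have h4 := (abs_le.1 h1).1
    have h5 : h * (ℓ - h) ≤ h * (inner ℝ p v + a + ε * (M + 1)) := by nlinarith
    have h6 := le_of_mul_le_mul_left h5 hh0
    have h7 := hadm p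
    have h8 : ε * (M + 2) = ε' := by rw [hε]; field_simp
    linarith

theorem IsLimitData.isLimitSolution_value {F B g : 𝔼 → ℝ} (hd : IsLimitData F B g) :
    IsLimitSolution F B g (value F B g) where
  continuousOn := by
    obtain ⟨K, hK, hLip⟩ := hd.exists_value_lipschitz
    refine Continuous.continuousOn (continuous_iff_continuousAt.2 fun z => ?_)
    rw [ContinuousAt, tendsto_iff_norm_sub_tendsto_zero]
    have hlim : Tendsto (fun y : 𝔼 × ℝ => K * (‖y.1 - z.1‖ + |y.2 - z.2|)) (𝓝 z) (𝓝 0) := by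
      have : ContinuousAt (fun y : 𝔼 × ℝ => K * (‖y.1 - z.1‖ + |y.2 - z.2|)) z := by fun_prop
      simpa using this.tendsto
    exact squeeze_zero (fun _ => norm_nonneg _) (fun y => hLip _ _ _ _) hlim
  bounded := hd.exists_value_bound
  initial := fun x => value_zero le_rfl x
  subsolution := fun _ hφ _ _ ht hm => hd.value_subsolution hφ ht hm
  supersolution := fun _ hφ _ _ ht hm => hd.value_supersolution hφ ht hm

end

/-! ### Mollification preserving increment inequalities. -/

section Mollification

variable {F : Type*} [NormedAddCommGroup F] [NormedSpace ℝ F] [FiniteDimensional ℝ F]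
  [MeasurableSpace F] [BorelSpace F]

open MeasureTheory in
/-- Smooth approximations of a Lipschitz function inherit its increment inequalities. -/
lemma exists_mollification {V : F → ℝ} (hVc : Continuous V) {K : ℝ}
    (hV : ∀ z z', |V z - V z'| ≤ K * ‖z - z'‖) (hK : 0 ≤ K) {ε : ℝ} (hε : 0 < ε) :
    ∃ ψ : F → ℝ, ContDiff ℝ 1 ψ ∧ (∀ z, |ψ z - V z| ≤ K * ε) ∧
      ∀ z a b, (∀ e, ‖e‖ < ε → V (z - e) ≤ V (z - e - a) + b) → ψ z ≤ ψ (z - a) + b := by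
  let μ : Measure F := Measure.addHaar
  let f : ContDiffBump (0 : F) := ⟨ε / 2, ε, by positivity, by linarith⟩
  have hfc : HasCompactSupport (f.normed μ) := f.hasCompactSupport_normed
  let ψ : F → ℝ := convolution (f.normed μ) V (ContinuousLinearMap.lsmul ℝ ℝ) μ
  have hψ : ∀ z, ψ z = ∫ e, f.normed μ e * V (z - e) ∂μ := fun z => by
    simp only [ψ, convolution_def, ContinuousLinearMap.lsmul_apply, smul_eq_mul]
  have hint : ∀ W : F → ℝ, Continuous W → Integrable (fun e => f.normed μ e * W e) μ := by
    intro W hW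
    exact (f.continuous_normed.mul hW).integrable_of_hasCompactSupport hfc.mul_right
  refine ⟨ψ, ?_, ?_, ?_⟩
  · exact hfc.contDiff_convolution_left (n := 1) _ f.contDiff_normed hVc.locallyIntegrable
  · intro z
    have := f.dist_normed_convolution_le (μ := μ) (g := V) (x₀ := z) (ε := K * ε)
      hVc.aestronglyMeasurable fun x hx => by
        rw [Real.dist_eq]
        refine (hV _ _).trans ?_
        rw [Metric.mem_ball, dist_eq_norm] at hx
        have : ‖x - z‖ ≤ ε := hx.le
        gcongr
    rwa [Real.dist_eq] at this
  · intro z a b h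
    have hb : ψ (z - a) + b = ∫ e, f.normed μ e * (V (z - e - a) + b) ∂μ := by
      have h1 : (fun e => f.normed μ e * (V (z - e - a) + b)) =
          fun e => f.normed μ e * V (z - a - e) + f.normed μ e * b := by
        funext e; rw [sub_right_comm]; ring
      rw [h1, integral_add (hint (fun e => V (z - a - e)) (by fun_prop))
        (hint (fun _ => b) continuous_const), ← hψ, integral_mul_const, f.integral_normed, one_mul]
    rw [hb, hψ]
    refine integral_mono (hint (fun e => V (z - e)) (by fun_prop))
      (hint (fun e => V (z - e - a) + b) (by fun_prop)) fun e => ?_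
    by_cases he : ‖e‖ < ε
    · exact mul_le_mul_of_nonneg_left (h e he) (f.nonneg_normed e)
    · have : f.normed μ e = 0 := by
        rw [← Function.notMem_support, f.support_normed_eq]
        simpa using he
      simp [this]

end Mollification

/-! ### Uniqueness: every solution is the value function. -/

section

variable {n : ℕ}

local notation "𝔼" => EuclideanSpace ℝ (Fin n)

/-- The equation gives `u ≤ B` only at touching points, but the open set where `u > B` would contain
one. -/
lemma IsLimitSolution.le_obstacle {F B g : 𝔼 → ℝ} (hB : Continuous B) {u : 𝔼 → ℝ → ℝ}
    (hu : IsLimitSolution F B g u) (x : 𝔼) {t : ℝ} (ht : 0 < t) : u x t ≤ B x := by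
  by_contra! hlt
  have hopen : IsOpen ((univ : Set 𝔼) ×ˢ Ioi (0 : ℝ)) := isOpen_univ.prod isOpen_Ioi
  have huc : ContinuousOn (Function.uncurry u) (univ ×ˢ Ioi 0) :=
    hu.continuousOn.mono (prod_mono_right Ioi_subset_Ici_self)
  have hO : IsOpen ((univ ×ˢ Ioi 0) ∩ {z : 𝔼 × ℝ | B z.1 < Function.uncurry u z}) := by
    rw [isOpen_iff_mem_nhds]
    rintro z ⟨hz, hz'⟩
    have h1 : ContinuousAt (Function.uncurry u) z := huc.continuousAt (hopen.mem_nhds hz)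
    have h2 : ContinuousAt (fun z : 𝔼 × ℝ => B z.1) z := by fun_prop
    exact inter_mem (hopen.mem_nhds hz) (h2.eventually_lt h1 hz')
  obtain ⟨φ, hφ, ⟨y, s⟩, ⟨hy, hy'⟩, hm⟩ := exists_isLocalMax_sub hO
    ⟨(x, t), ⟨mem_univ _, ht⟩, hlt⟩ (huc.mono inter_subset_left)
  have h1 := hu.subsolution (fun y s => φ (y, s)) hφ.contDiffOn y s hy.2 hm
  have h2 : B y < u y s := hy'
  linarith [(le_max_left _ _).trans h1]

/-- Admissibility turns the subsolution inequality into transport in the direction `(v, 1)` at rate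
`ℓ`; the time `τ = 0` is reached by continuity. -/
lemma IsLimitSolution.le_add {F B g : 𝔼 → ℝ} {u : 𝔼 → ℝ → ℝ} (hu : IsLimitSolution F B g u)
    (x : 𝔼) {t τ : ℝ} (hτ : 0 ≤ τ) (hτt : τ < t) {v : 𝔼} {ℓ : ℝ} (hadm : Admissible F v ℓ) :
    u x t ≤ u (x - (t - τ) • v) τ + (t - τ) * ℓ := by
  have hopen : IsOpen ((univ : Set 𝔼) ×ˢ Ioi (0 : ℝ)) := isOpen_univ.prod isOpen_Ioi
  have hpos : ∀ τ, 0 < τ → τ < t → u x t ≤ u (x - (t - τ) • v) τ + (t - τ) * ℓ := by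
    intro τ hτ hτt
    have := le_add_of_viscosity (w := Function.uncurry u) (ξ := (v, (1 : ℝ))) (a := ℓ)
      (x := (x - (t - τ) • v, τ)) (s := t - τ) hopen
      (hu.continuousOn.mono (prod_mono_right Ioi_subset_Ici_self)) ?_ (by linarith) ?_
    · simpa using this
    · rintro φ hφ ⟨y, s⟩ ⟨-, hs⟩ hm
      have h1 := (le_max_right _ _).trans
        (hu.subsolution (fun y s => φ (y, s)) hφ.contDiffOn y s hs hm)
      have h2 := fderiv_uncurry_apply (φ := fun y s => φ (y, s)) (x := y) (t := s)
        ((hφ.differentiable one_ne_zero) (y, s)) v 1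
      have h3 := hadm (gradient (fun y => φ (y, s)) y)
      change fderiv ℝ φ (y, s) (v, 1) = _ at h2
      rw [h2]
      linarith
    · intro σ hσ
      refine ⟨mem_univ _, ?_⟩
      have : 0 < τ + σ := by linarith [hσ.1]
      simpa using this
  rcases hτ.eq_or_lt with rfl | hτ
  · have hlim : Tendsto (fun τ : ℝ => u (x - (t - τ) • v) τ + (t - τ) * ℓ) (𝓝[>] 0)
        (𝓝 (u (x - (t - 0) • v) 0 + (t - 0) * ℓ)) := by
      refine Tendsto.add ?_ ?_
      · have h1 := hu.continuousOn (x - (t - 0) • v, 0)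
          ⟨mem_univ _, mem_Ici.2 le_rfl⟩
        have h2 : Tendsto (fun τ : ℝ => (x - (t - τ) • v, τ)) (𝓝[>] 0)
            (𝓝[univ ×ˢ Ici 0] (x - (t - 0) • v, 0)) := by
          refine tendsto_nhdsWithin_iff.2 ⟨?_, ?_⟩
          · have : ContinuousAt (fun τ : ℝ => (x - (t - τ) • v, τ)) 0 := by fun_prop
            exact this.tendsto.mono_left nhdsWithin_le_nhds
          · filter_upwards [self_mem_nhdsWithin] with τ hτ
            exact ⟨mem_univ _, (mem_Ioi.1 hτ).le⟩
        exact h1.tendsto.comp h2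
      · have : ContinuousAt (fun τ : ℝ => (t - τ) * ℓ) 0 := by fun_prop
        exact this.tendsto.mono_left nhdsWithin_le_nhds
    refine ge_of_tendsto hlim ?_
    filter_upwards [Ioo_mem_nhdsGT hτt] with τ hτ
    exact hpos τ hτ.1 hτ.2
  · exact hpos τ hτ hτt

theorem IsLimitSolution.le_value {F B g : 𝔼 → ℝ} (hd : IsLimitData F B g) {u : 𝔼 → ℝ → ℝ}
    (hu : IsLimitSolution F B g u) (x : 𝔼) {t : ℝ} (ht : 0 < t) : u x t ≤ value F B g x t := by
  refine hd.le_value ht ?_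
  rintro r ⟨τ, v, ℓ, hτ, hτt, hadm, rfl⟩
  have h1 := hu.le_add x hτ hτt hadm
  have h2 : u (x - (t - τ) • v) τ ≤ terminalCost g B (x - (t - τ) • v) τ := by
    unfold terminalCost
    split_ifs with h
    · rw [h, hu.initial]
    · exact hu.le_obstacle hd.cont _ (lt_of_le_of_ne hτ (Ne.symm h))
  linarith

/-- Smooth classical subsolutions uniformly close to the value function. -/
lemma IsLimitData.exists_smooth_sub {F B g : 𝔼 → ℝ} (hd : IsLimitData F B g) {ε : ℝ}
    (hε : 0 < ε) :
    ∃ Ψ : 𝔼 → ℝ → ℝ, ContDiff ℝ 1 (Function.uncurry Ψ) ∧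
      (∀ x t, |Ψ x t - value F B g x t| ≤ ε) ∧
      ∀ x t, 0 < t → deriv (fun s => Ψ x s) t + F (gradient (fun y => Ψ y t) x) ≤ 0 := by
  obtain ⟨K, hK, hLip⟩ := hd.exists_value_lipschitz
  let V : 𝔼 × ℝ → ℝ := fun z => value F B g z.1 z.2
  have hV : ∀ z z', |V z - V z'| ≤ 2 * K * ‖z - z'‖ := fun z z' => by
    refine (hLip _ _ _ _).trans ?_
    have h1 : ‖z.1 - z'.1‖ ≤ ‖z - z'‖ := norm_fst_le (z - z')
    have h2 : |z.2 - z'.2| ≤ ‖z - z'‖ := norm_snd_le (z - z')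
    nlinarith
  have hVc : Continuous V := by
    have : LipschitzWith (Real.toNNReal (2 * K)) V := LipschitzWith.of_dist_le_mul fun z z' => by
      rw [Real.dist_eq, dist_eq_norm, Real.coe_toNNReal _ (by positivity)]
      exact hV z z'
    exact this.continuous
  set η := ε / (4 * K + 1) with hη
  have hη0 : 0 < η := by positivity
  obtain ⟨ψ, hψc, hψV, hψinc⟩ := exists_mollification hVc hV (by positivity) hη0
  -- Shifting time forward by the mollification radius `η` keeps the averaged times above `t`, where
  -- dynamic programming applies. Shift and mollification each cost `2 * K * η`.
  have hΨc : ContDiff ℝ 1 (fun z : 𝔼 × ℝ => ψ (z + (0, η))) :=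
    hψc.comp (contDiff_id.add contDiff_const)
  refine ⟨fun x t => ψ ((x, t) + (0, η)), hΨc, fun x t => ?_, fun x t ht => ?_⟩
  · have h1 := hψV ((x, t) + (0, η))
    have h2 := hV ((x, t) + (0, η)) (x, t)
    rw [add_sub_cancel_left, Prod.norm_mk, norm_zero, Real.norm_eq_abs, abs_of_pos hη0,
      max_eq_right hη0.le] at h2
    have h3 : 4 * K * η ≤ ε := by
      rw [hη, mul_div_assoc', div_le_iff₀ (by positivity)]; nlinarith
    calc _ ≤ |ψ ((x, t) + (0, η)) - V ((x, t) + (0, η))| + |V ((x, t) + (0, η)) - V (x, t)| :=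
          abs_sub_le _ _ _
      _ ≤ ε := by linarith
  · refine add_le_zero_of_admissible hd.conv fun v ℓ hadm => ?_
    have hdiff := (hΨc.differentiable one_ne_zero) (x, t)
    have h1 := fderiv_uncurry_apply (φ := fun x t => ψ ((x, t) + (0, η))) (x := x) (t := t)
      hdiff v 1
    rw [one_mul] at h1
    rw [← h1]
    refine fderiv_le_of_isLocalMax (w := fun z : 𝔼 × ℝ => ψ (z + (0, η))) hdiff
      (Eventually.of_forall fun z => ((sub_self (ψ (z + (0, η)))).trans
        (sub_self (ψ ((x, t) + (0, η)))).symm).le) ?_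
    filter_upwards [Ioo_mem_nhdsGT ht] with s hs
    have h2 := hψinc ((x, t) + (0, η)) (s • (v, 1)) (s * ℓ) fun e he => by
      have he2 : |e.2| < η := (norm_snd_le e).trans_lt he
      have h3 := hd.value_le_add (x - e.1) hs.1.le (t := t + η - e.2)
        (by linarith [hs.2, (abs_lt.1 he2).2]) hadm
      simpa [V] using h3
    rwa [add_sub_right_comm] at h2

lemma hasGradientAt_sqrt_one_add_norm_sq (x : 𝔼) :
    HasGradientAt (fun y : 𝔼 => √(1 + ‖y‖ ^ 2)) ((√(1 + ‖x‖ ^ 2))⁻¹ • x) x := by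
  have hpos : 0 < 1 + ‖x‖ ^ 2 := by positivity
  rw [hasGradientAt_iff_hasFDerivAt]
  have h1 := ((hasFDerivAt_id x).norm_sq.const_add 1).sqrt hpos.ne'
  refine h1.congr_fderiv (ContinuousLinearMap.ext fun z => ?_)
  simp only [InnerProductSpace.toDual_apply_apply, inner_smul_left, conj_trivial, id]
  simp
  ring

lemma norm_gradient_sqrt_le (x : 𝔼) : ‖(√(1 + ‖x‖ ^ 2))⁻¹ • x‖ ≤ 1 := by
  have hpos : 0 < 1 + ‖x‖ ^ 2 := by positivity
  have h1 : 0 < √(1 + ‖x‖ ^ 2) := Real.sqrt_pos.2 hpos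
  rw [norm_smul, norm_inv, Real.norm_eq_abs, abs_of_pos h1, inv_mul_le_iff₀ h1, mul_one]
  exact Real.le_sqrt_of_sq_le (by linarith)

/-- A smooth subsolution near V is itself the test function for `u`, so no doubling of variables is
needed. Convexity of F absorbs the penalty that makes it strict and confines the minimum of `u - χ`
to a compact set. -/
theorem IsLimitSolution.value_le {F B g : 𝔼 → ℝ} (hd : IsLimitData F B g) {u : 𝔼 → ℝ → ℝ}
    (hu : IsLimitSolution F B g u) (x₁ : 𝔼) {T : ℝ} (hT : 0 < T) :
    value F B g x₁ T ≤ u x₁ T := by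
  set V := value F B g with hVdef
  obtain ⟨Cu, hCu⟩ := hu.bounded (T + 1)
  obtain ⟨CV, hCV⟩ := hd.exists_value_bound (T + 1)
  set C := |Cu| + |CV| with hC
  have hC0 : 0 ≤ C := by positivity
  have hCu' : ∀ x, ∀ t ∈ Icc 0 (T + 1), -C ≤ u x t := fun x t ht => by
    linarith [neg_le_of_abs_le (hCu x t ht), le_abs_self Cu, abs_nonneg CV]
  have hCV' : ∀ x, ∀ t ∈ Icc 0 (T + 1), |V x t| ≤ C := fun x t ht => by
    linarith [hCV x t ht, le_abs_self CV, abs_nonneg Cu]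
  obtain ⟨M₀, hM₀⟩ := (isCompact_closedBall (0 : 𝔼) 1).exists_bound_of_continuousOn
    hd.conv.continuous_of_univ.continuousOn
  set M := |M₀| + 1 with hM
  have hFM : ∀ q : 𝔼, ‖q‖ ≤ 1 → F q < M := fun q hq => by
    linarith [(le_abs_self _).trans (hM₀ q (by simpa using hq)), le_abs_self M₀]
  have key : ∀ κ, 0 < κ → κ < 1 → ∀ ε > 0,
      V x₁ T - 2 * ε - κ * (2 * C + √(1 + ‖x₁‖ ^ 2) + M * T + 1) ≤ u x₁ T := by
    intro κ hκ hκ1 ε hε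
    obtain ⟨Ψ, hΨc, hΨV, hΨs⟩ := hd.exists_smooth_sub hε
    -- `κ * A = 2 * C` bounds `V - u`, so the spatial penalty at radius `ρ` and the exponential at
    -- time `T + 1` both keep the minimum off the boundary.
    set A := 2 * C / κ with hA
    let χ : 𝔼 → ℝ → ℝ := fun x t => (1 - κ) * Ψ x t -
      κ * (√(1 + ‖x‖ ^ 2) + (M * t + Real.exp (A * (t - T)))) - (κ * C + ε)
    have hχc : ContDiff ℝ 1 (Function.uncurry χ) := by
      have h1 : ContDiff ℝ 1 (fun z : 𝔼 × ℝ => √(1 + ‖z.1‖ ^ 2)) :=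
        (contDiff_const.add (contDiff_fst.norm_sq ℝ)).sqrt fun z => by positivity
      have h2 : ContDiff ℝ 1 (fun z : 𝔼 × ℝ => M * z.2 + Real.exp (A * (z.2 - T))) := by fun_prop
      exact ((contDiff_const.mul hΨc).sub (contDiff_const.mul (h1.add h2))).sub contDiff_const
    have hχV : ∀ x, ∀ t ∈ Icc 0 (T + 1),
        χ x t ≤ V x t - κ * ‖x‖ - κ * Real.exp (A * (t - T)) := by
      intro x t ht
      have h1 := (abs_le.1 (hΨV x t)).2
      have h2 : (1 - κ) * Ψ x t ≤ (1 - κ) * (V x t + ε) := by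
        apply mul_le_mul_of_nonneg_left _ (by linarith)
        linarith
      have h3 : κ * (-V x t) ≤ κ * C :=
        mul_le_mul_of_nonneg_left (by linarith [neg_le_of_abs_le (hCV' x t ht)]) hκ.le
      have h4 : κ * ‖x‖ ≤ κ * √(1 + ‖x‖ ^ 2) :=
        mul_le_mul_of_nonneg_left (Real.le_sqrt_of_sq_le (by linarith)) hκ.le
      have h5 : 0 ≤ κ * (M * t) := mul_nonneg hκ.le (mul_nonneg (by positivity) ht.1)
      have h6 : 0 ≤ κ * ε := by positivity
      simp only [χ]
      linarith
    suffices hle : χ x₁ T ≤ u x₁ T by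
      have h1 := (abs_le.1 (hΨV x₁ T)).1
      have h2 : (1 - κ) * (V x₁ T - ε) ≤ (1 - κ) * Ψ x₁ T := by
        apply mul_le_mul_of_nonneg_left _ (by linarith)
        linarith
      have h3 : κ * V x₁ T ≤ κ * C :=
        mul_le_mul_of_nonneg_left ((le_abs_self _).trans (hCV' x₁ T ⟨hT.le, by linarith⟩)) hκ.le
      have h6 : 0 ≤ κ * ε := by positivity
      simp only [χ, sub_self, mul_zero, Real.exp_zero] at hle
      linarith
    by_contra! hlt
    set ρ := A + ‖x₁‖ + 1 with hρ
    have hA0 : 0 ≤ A := by positivity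
    have hκA : κ * A = 2 * C := by rw [hA]; field_simp
    let S : Set (𝔼 × ℝ) := Metric.closedBall 0 ρ ×ˢ Icc 0 (T + 1)
    have hS : IsCompact S := (isCompact_closedBall _ _).prod isCompact_Icc
    have h₁S : ((x₁, T) : 𝔼 × ℝ) ∈ S :=
      ⟨by simp [hρ]; linarith, hT.le, by simp⟩
    have hcont : ContinuousOn (fun z : 𝔼 × ℝ => u z.1 z.2 - χ z.1 z.2) S :=
      (hu.continuousOn.mono fun z hz => ⟨mem_univ _, hz.2.1⟩).sub hχc.continuous.continuousOn
    obtain ⟨⟨x, t⟩, ⟨hxρ, htI⟩, hmin⟩ := hS.exists_isMinOn ⟨_, h₁S⟩ hcont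
    have hneg : u x t - χ x t < 0 := by
      have : u x t - χ x t ≤ u x₁ T - χ x₁ T := hmin h₁S
      linarith
    simp only [mem_closedBall_zero_iff] at hxρ
    have hup := hχV x t htI
    have hVC := (le_abs_self _).trans (hCV' x t htI)
    have huC := hCu' x t htI
    have hexp : 0 < κ * Real.exp (A * (t - T)) := by positivity
    have hxn : 0 ≤ κ * ‖x‖ := by positivity
    have hx : ‖x‖ < ρ := by
      refine lt_of_le_of_ne hxρ fun h => ?_
      have : κ * A ≤ κ * ‖x‖ := by
        rw [h, hρ]; gcongr; linarith [norm_nonneg x₁]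
      linarith
    have ht0 : 0 < t := by
      refine lt_of_le_of_ne htI.1 fun h => ?_
      have h1 : V x t = g x := value_zero h.symm.le x
      have h2 : u x t = g x := by rw [← h]; exact hu.initial x
      linarith
    have htT : t < T + 1 := by
      refine lt_of_le_of_ne htI.2 fun h => ?_
      have h1 : κ * A ≤ κ * Real.exp (A * (t - T)) := by
        rw [h, add_sub_cancel_left, mul_one]
        gcongr
        linarith [Real.add_one_le_exp A]
      linarith
    have hSn : S ∈ 𝓝 ((x, t) : 𝔼 × ℝ) := by
      refine prod_mem_nhds ?_ (Icc_mem_nhds ht0 htT)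
      exact mem_of_superset (Metric.isOpen_ball.mem_nhds (by simpa using hx))
        Metric.ball_subset_closedBall
    have hsup := hu.supersolution χ hχc.contDiffOn x t ht0 (hmin.isLocalMin hSn)
    -- At the minimum `u < χ ≤ V ≤ B`, so the obstacle is inactive and the differential inequality
    -- must hold for `χ`, which is a strict subsolution.
    have hobs : u x t - B x < 0 := by
      linarith [hd.value_le_obstacle x t]
    set q := gradient (fun y => Ψ y t) x with hq
    set a := deriv (fun s => Ψ x s) t with ha
    set d := (√(1 + ‖x‖ ^ 2))⁻¹ • x with hdd
    have hΨd := (hΨc.differentiable one_ne_zero) (x, t)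
    have hgrad : gradient (fun y => χ y t) x = (1 - κ) • q + κ • (-d) := by
      refine HasGradientAt.gradient ?_
      have h1 : DifferentiableAt ℝ (fun y => Ψ y t) x :=
        DifferentiableAt.comp (g := Function.uncurry Ψ) (f := fun y => (y, t)) x hΨd (by fun_prop)
      have h2 := hasGradientAt_iff_hasFDerivAt.1 h1.hasGradientAt
      have h3 := hasGradientAt_iff_hasFDerivAt.1 (hasGradientAt_sqrt_one_add_norm_sq x)
      rw [hasGradientAt_iff_hasFDerivAt]
      refine (((h2.const_mul (1 - κ)).sub ((h3.add_const
        (M * t + Real.exp (A * (t - T)))).const_mul κ)).sub_const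
        (κ * C + ε)).congr_fderiv ?_
      rw [smul_neg, ← sub_eq_add_neg, map_sub, ← hq, ← hdd]
      exact congrArg₂ _ (map_smul _ _ _).symm (map_smul _ _ _).symm
    have hderiv : deriv (fun s => χ x s) t =
        (1 - κ) * a - κ * (M + Real.exp (A * (t - T)) * A) := by
      have h1 : DifferentiableAt ℝ (fun s => Ψ x s) t :=
        DifferentiableAt.comp (g := Function.uncurry Ψ) (f := fun s => (x, s)) t hΨd (by fun_prop)
      have h2 : HasDerivAt (fun s : ℝ => M * s + Real.exp (A * (s - T)))
          (M + Real.exp (A * (t - T)) * A) t := by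
        have i1 := (hasDerivAt_id t).const_mul M
        have i2 := (((hasDerivAt_id t).sub_const T).const_mul A).exp
        exact (i1.add i2).congr_deriv (by simp)
      exact (((h1.hasDerivAt.const_mul (1 - κ)).sub
        ((h2.const_add (√(1 + ‖x‖ ^ 2))).const_mul κ)).sub_const (κ * C + ε)).deriv
    have hconv := hd.conv.2 (mem_univ q) (mem_univ (-d)) (sub_nonneg.2 hκ1.le) hκ.le (by ring)
    have hFd : κ * F (-d) < κ * M :=
      mul_lt_mul_of_pos_left (hFM _ (by rw [norm_neg]; exact norm_gradient_sqrt_le x)) hκ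
    have hsub : (1 - κ) * (a + F q) ≤ 0 :=
      mul_nonpos_of_nonneg_of_nonpos (by linarith) (hΨs x t ht0)
    have hexpA : 0 ≤ κ * (Real.exp (A * (t - T)) * A) := by positivity
    rw [hgrad, hderiv] at hsup
    simp only [smul_eq_mul] at hconv
    have : max (u x t - B x) ((1 - κ) * a - κ * (M + Real.exp (A * (t - T)) * A) +
        F ((1 - κ) • q + κ • (-d))) < 0 := max_lt hobs (by linarith)
    linarith
  refine le_of_forall_pos_le_add fun η hη => ?_
  set Q := 2 * C + √(1 + ‖x₁‖ ^ 2) + M * T + 1 with hQ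
  have hQ0 : 0 < Q := by positivity
  have h1 := key (min (1 / 2) (η / (2 * Q))) (by positivity)
    ((min_le_left _ _).trans_lt (by norm_num)) (η / 4) (by positivity)
  have h2 : min (1 / 2) (η / (2 * Q)) * Q ≤ η / 2 := by
    calc min (1 / 2) (η / (2 * Q)) * Q ≤ η / (2 * Q) * Q := by gcongr; exact min_le_right _ _
      _ = η / 2 := by field_simp
  linarith

/-! ### The extended-real formula and the effective datum. -/

lemma IsLimitData.value_eq_iInf {F B g : 𝔼 → ℝ} (hd : IsLimitData F B g) (x : 𝔼) {t : ℝ}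
    (ht : 0 < t) :
    ((value F B g x t : ℝ) : EReal) = ⨅ τ ∈ Ico 0 t, ⨅ y : 𝔼,
      ((t - τ : ℝ) : EReal) * legendre F ((t - τ)⁻¹ • (x - y)) +
        ((terminalCost g B y τ : ℝ) : EReal) := by
  apply le_antisymm
  · refine le_iInf₂ fun τ hτ => le_iInf fun y => ?_
    have hpos : 0 < t - τ := by linarith [hτ.2]
    set v := (t - τ)⁻¹ • (x - y) with hv
    have hle : ∀ p, ((inner ℝ p v - F p : ℝ) : EReal) ≤ legendre F v := fun p =>
      le_iSup (fun p : 𝔼 => ((inner ℝ p v - F p : ℝ) : EReal)) p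
    -- A velocity of infinite cost contributes `⊤`, matching the absence of admissible `ℓ`; the
    -- value `⊥` is excluded by the competitor `p = 0`.
    induction hL : legendre F v with
    | bot =>
      have := hle 0
      rw [hL] at this
      exact absurd (le_bot_iff.1 this) (EReal.coe_ne_bot _)
    | top => rw [EReal.coe_mul_top_of_pos hpos, EReal.top_add_coe]; exact le_top
    | coe ℓ =>
      have hadm : Admissible F v ℓ := fun p => by
        have := hle p
        rwa [hL, EReal.coe_le_coe_iff] at this
      have h1 := hd.value_le_cost (x := x) ht ⟨τ, v, ℓ, hτ.1, hτ.2, hadm, rfl⟩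
      rw [hv, smul_inv_smul₀ hpos.ne', sub_sub_cancel] at h1
      exact_mod_cast h1
  · by_contra! hlt
    obtain ⟨r, hr1, hr2⟩ := EReal.lt_iff_exists_real_btwn.1 hlt
    rw [EReal.coe_lt_coe_iff, value_pos ht] at hr1
    obtain ⟨r', ⟨τ, v, ℓ, hτ, hτt, hadm, rfl⟩, hr'⟩ :=
      exists_lt_of_csInf_lt (hd.costSet_nonempty x ht) hr1
    have hpos : 0 < t - τ := by linarith
    have h1 : (⨅ τ ∈ Ico 0 t, ⨅ y : 𝔼,
      ((t - τ : ℝ) : EReal) * legendre F ((t - τ)⁻¹ • (x - y)) +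
        ((terminalCost g B y τ : ℝ) : EReal)) ≤
        (((t - τ) * ℓ + terminalCost g B (x - (t - τ) • v) τ : ℝ) : EReal) := by
      refine (iInf₂_le τ ⟨hτ, hτt⟩).trans ((iInf_le _ (x - (t - τ) • v)).trans ?_)
      rw [sub_sub_cancel, inv_smul_smul₀ hpos.ne', EReal.coe_add, EReal.coe_mul]
      have hL : legendre F v ≤ (ℓ : EReal) := iSup_le fun p => EReal.coe_le_coe_iff.2 (hadm p)
      gcongr
    have h2 := hr2.trans_le h1
    rw [EReal.coe_lt_coe_iff] at h2
    linarith

lemma effectiveDatum_le_add {Ω : Set 𝔼} {b : 𝔼 → 𝔼 → ℝ} (hne : (frontier Ω).Nonempty) {C : ℝ}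
    (hC : ∀ x, ∀ y ∈ frontier Ω, |b x y| ≤ C) {x x' : 𝔼} {ε : ℝ}
    (h : ∀ y ∈ frontier Ω, b x y ≤ b x' y + ε) :
    effectiveDatum Ω b x ≤ effectiveDatum Ω b x' + ε := by
  unfold effectiveDatum
  rw [← sub_le_iff_le_add]
  refine le_csInf (hne.image _) ?_
  rintro _ ⟨y, hy, rfl⟩
  have h1 : sInf (b x '' frontier Ω) ≤ b x y := by
    refine csInf_le ⟨-C, ?_⟩ ⟨y, hy, rfl⟩
    rintro _ ⟨z, hz, rfl⟩
    exact neg_le_of_abs_le (hC x z hz)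
  linarith [h y hy]

lemma abs_effectiveDatum_le {Ω : Set 𝔼} {b : 𝔼 → 𝔼 → ℝ} (hne : (frontier Ω).Nonempty) {C : ℝ}
    (hC : ∀ x, ∀ y ∈ frontier Ω, |b x y| ≤ C) (x : 𝔼) : |effectiveDatum Ω b x| ≤ C := by
  have hlow : ∀ r ∈ b x '' frontier Ω, -C ≤ r := by
    rintro _ ⟨z, hz, rfl⟩
    exact neg_le_of_abs_le (hC x z hz)
  obtain ⟨y, hy⟩ := hne
  rw [abs_le]
  exact ⟨le_csInf ⟨_, y, hy, rfl⟩ hlow,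
    (csInf_le ⟨-C, hlow⟩ ⟨y, hy, rfl⟩).trans ((le_abs_self _).trans (hC x y hy))⟩

lemma continuous_effectiveDatum {Ω : Set 𝔼} {b : 𝔼 → 𝔼 → ℝ} (hne : (frontier Ω).Nonempty)
    (hb : IsBUCOn (Function.uncurry b) (univ ×ˢ frontier Ω)) :
    Continuous (effectiveDatum Ω b) := by
  obtain ⟨⟨C, hC⟩, huc⟩ := hb
  have hC' : ∀ x, ∀ y ∈ frontier Ω, |b x y| ≤ C := fun x y hy => hC (x, y) ⟨mem_univ _, hy⟩
  refine Metric.continuous_iff.2 fun x ε hε => ?_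
  obtain ⟨δ, hδ, h⟩ := Metric.uniformContinuousOn_iff.1 huc (ε / 2) (half_pos hε)
  refine ⟨δ, hδ, fun x' hx' => ?_⟩
  have hy : ∀ y ∈ frontier Ω, |b x' y - b x y| < ε / 2 := fun y hy => by
    have := h (x', y) ⟨mem_univ _, hy⟩ (x, y) ⟨mem_univ _, hy⟩ (by
      rw [Prod.dist_eq, dist_self]; exact max_lt hx' hδ)
    simpa [Real.dist_eq] using this
  have h1 := effectiveDatum_le_add hne hC' (x := x) (x' := x') (ε := ε / 2) fun y hy' => by
    linarith [(abs_lt.1 (hy y hy')).1]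
  have h2 := effectiveDatum_le_add hne hC' (x := x') (x' := x) (ε := ε / 2) fun y hy' => by
    linarith [(abs_lt.1 (hy y hy')).2]
  rw [Real.dist_eq, abs_lt]
  constructor <;> linarith

/-- In a one-point space a nonempty `Ω` is everything and has empty frontier. -/
lemma IsPerforatedDomain.nontrivial {Ω : Set 𝔼} (hΩ : IsPerforatedDomain Ω) : Nontrivial 𝔼 := by
  by_contra h
  rw [not_nontrivial_iff_subsingleton] at h
  have : Ω = univ := Subsingleton.eq_univ_of_nonempty hΩ.isConnected.nonempty
  have h2 := hΩ.frontier_nonempty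
  rw [this, frontier_univ] at h2
  exact not_nonempty_empty h2

end

end PerforatedHJ

open PerforatedHJ
theorem proposition2p2 {n : ℕ} (Ω : Set (EuclideanSpace ℝ (Fin n))) (hΩ : IsPerforatedDomain Ω)
    (H : EuclideanSpace ℝ (Fin n) → EuclideanSpace ℝ (Fin n) → ℝ)
    (hH_cont : Continuous (Function.uncurry H))
    (hH_per : ∀ (k : Fin n → ℤ) (y p : EuclideanSpace ℝ (Fin n)), H (y + lattice k) p = H y p)
    (hH_coer : Filter.Tendsto (fun p : EuclideanSpace ℝ (Fin n) =>
      ⨅ y : EuclideanSpace ℝ (Fin n), H y p)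
      (Filter.cocompact (EuclideanSpace ℝ (Fin n))) Filter.atTop)
    (hH_conv : ∀ y : EuclideanSpace ℝ (Fin n), ConvexOn ℝ Set.univ (H y))
    (b : EuclideanSpace ℝ (Fin n) → EuclideanSpace ℝ (Fin n) → ℝ)
    (hb_buc : IsBUCOn (Function.uncurry b) (Set.univ ×ˢ frontier Ω))
    (hb_per : ∀ (k : Fin n → ℤ) (x : EuclideanSpace ℝ (Fin n)), ∀ y ∈ frontier Ω,
      b x (y + lattice k) = b x y)
    (g : EuclideanSpace ℝ (Fin n) → ℝ)
    (hg_buc : IsBUCOn g Set.univ) (hg_lip : ∃ K, LipschitzWith K g)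
    (hgb : ∀ x, g x ≤ effectiveDatum Ω b x) :
    (∃ u, IsLimitSolution (effectiveHamiltonian Ω H) (effectiveDatum Ω b) g u) ∧
    ∀ u, IsLimitSolution (effectiveHamiltonian Ω H) (effectiveDatum Ω b) g u →
      (∀ x, u x 0 = g x) ∧
      ∀ (x : EuclideanSpace ℝ (Fin n)) (t : ℝ), 0 < t →
        ((u x t : ℝ) : EReal) =
          ⨅ τ ∈ Set.Ico 0 t, ⨅ y : EuclideanSpace ℝ (Fin n),
            ((t - τ : ℝ) : EReal) * legendre (effectiveHamiltonian Ω H) ((t - τ)⁻¹ • (x - y)) +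
              ((terminalCost g (effectiveDatum Ω b) y τ : ℝ) : EReal) := by
  have := hΩ.nontrivial
  have hH : IsCellHamiltonian H := .of_tendsto hH_cont hH_per hH_coer hH_conv
  have hd : IsLimitData (effectiveHamiltonian Ω H) (effectiveDatum Ω b) g :=
    { conv := convexOn_effectiveHamiltonian hΩ hH
      coer := coercive_effectiveHamiltonian hΩ hH
      cont := continuous_effectiveDatum hΩ.frontier_nonempty hb_buc
      bdd := by
        obtain ⟨C, hC⟩ := hb_buc.1
        exact ⟨C, abs_effectiveDatum_le hΩ.frontier_nonempty
          fun x y hy => hC (x, y) ⟨mem_univ _, hy⟩⟩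
      bdd_init := by
        obtain ⟨C, hC⟩ := hg_buc.1
        exact ⟨C, fun x => hC x (mem_univ x)⟩
      lip := by
        obtain ⟨K, hK⟩ := hg_lip
        refine ⟨K, K.2, fun x y => ?_⟩
        have := hK.dist_le_mul x y
        rw [Real.dist_eq, dist_eq_norm] at this
        exact (le_abs_self _).trans this
      le := hgb }
  refine ⟨⟨_, hd.isLimitSolution_value⟩, fun u hu => ⟨hu.initial, fun x t ht => ?_⟩⟩
  rw [le_antisymm (hu.le_value hd x ht) (hu.value_le hd x ht)]
  exact hd.value_eq_iInf x ht
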